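/- **Setting.** Let $T$ be a text of length $n\ge 1$ whose symbols are nonnegative integers smaller than $(n+1)^d$, for a fixed $d$ (an alphabet of polynomial size). A partition of $T$ is a factorization $T=T_1T_2\cdots T_k$ into nonempty contiguous substrings. For a nonempty string $w$ let $n_c$ be the number of occurrences of the symbol $c$ in $w$ and $\sigma_w$ the number of distinct symbols that occur in $w$; logarithms without a base are binary. Put $$|w|\,H_0(w)=\sum_{c\in w} n_c\log\frac{|w|}{n_c},\qquad |w|\,H_0^a(w)=\log(|w|!)-\sum_{c\in w}\log(n_c!).$$ Let $H\in\{H_0,H_0^a\}$, let $\lambda>0$ be a constant, and let $f(m,s)$, for $1\le s\le m$, be a nonnegative overhead function that is nondecreasing in both arguments, bounded by a polynomial in $m$, and can be evaluated in constant time. The compressed size of $w$ is estimated by $$|\mathcal C(w)|=\lambda\,|w|\,H(w)+f(|w|,\sigma_w)$$ ($H=H_0$: $0$-th order compressor with model cost $f$; $H=H_0^a$: adaptive $0$-th order compressor, in particular $|\mathcal C(w)|=|w|H_0^a(w)$ for $\lambda=1$, $f=0$), and a partition $T_1\cdots T_k$ has cost $\sum_i|\mathcal C(T_i)|$. It is $(1+\epsilon)$-optimal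 if its cost is at most $1+\epsilon$ times the cost of every partition of $T$. **Theorem 3.** For all $d,\lambda,f$ and $H$ as above there are an algorithm and a constant $K$ such that, for every $\epsilon>0$ and every such text $T$, the algorithm, given $T$, $\epsilon$ and $\lambda$, finds a $(1+\epsilon)$-optimal partition of $T$ in at most $K\,n\,(1+\log_{1+\epsilon}n)$ steps and with $O(n)$ memory cells. (For every fixed $\epsilon>0$ and $n\ge2$ this is $O(n\log_{1+\epsilon}n)$ time and $O(n)$ space.) The machine is a unit-cost random access machine with integer words of $O(\log n)$ bits (integer addition, truncated subtraction, multiplication, division with remainder, comparison and array access) and with real cells (addition, subtraction, multiplication and comparison of reals, conversion of an integer to a real, binary logarithm of an integer, evaluation of $f$ at integers; no conversion of reals to integers). -/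

import Mathlib

noncomputable section

/-! Texts are lists of natural numbers (symbols); logarithms are in base 2 (sizes in bits). -/

/-- Zeroth-order empirical entropy
`H₀(w) = (1/|w|) ∑_c n_c log (|w| / n_c)`, `n_c` the number of occurrences of `c` in `w`. -/
def entropy0 (w : List ℕ) : ℝ :=
  (1 / (w.length : ℝ)) *
    ∑ c ∈ w.toFinset, (w.count c : ℝ) * Real.logb 2 ((w.length : ℝ) / (w.count c : ℝ))

/-- Zeroth-order adaptive empirical entropy
`H₀ᵃ(w) = (1/|w|) (log (|w|!) - ∑_c log (n_c!))`. -/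
def adaptiveEntropy0 (w : List ℕ) : ℝ :=
  (1 / (w.length : ℝ)) *
    (Real.logb 2 (w.length.factorial : ℝ) -
      ∑ c ∈ w.toFinset, Real.logb 2 ((w.count c).factorial : ℝ))

/-- The estimated compressed size `λ |w| H(w) + f(|w|, σ_w)` of a string `w`, with `σ_w` the
number of distinct symbols that occur in `w`. -/
def estimatedSize (H : List ℕ → ℝ) (lam : ℝ) (f : ℕ → ℕ → ℝ) (w : List ℕ) : ℝ :=
  lam * ((w.length : ℝ) * H w) + f w.length w.toFinset.card

/-- Overhead functions `f(m, s)` (model cost and other inefficiencies) for strings of length `m`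
with `s` distinct symbols, `1 ≤ s ≤ m`: nonnegative, nondecreasing in both arguments, and
polynomially bounded. -/
structure IsOverhead (f : ℕ → ℕ → ℝ) : Prop where
  nonneg : ∀ m s, 1 ≤ s → s ≤ m → 0 ≤ f m s
  mono : ∀ m s m' s', 1 ≤ s → s ≤ m → s' ≤ m' → m ≤ m' → s ≤ s' → f m s ≤ f m' s'
  poly : ∃ c : ℕ, ∀ m s, 1 ≤ s → s ≤ m → f m s ≤ (c : ℝ) * (m : ℝ) ^ c

/-- `parts` is a partition of `T` into nonempty contiguous substrings. -/
def IsPartition (parts : List (List ℕ)) (T : List ℕ) : Prop :=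
  parts.flatten = T ∧ [] ∉ parts

/-- Cost of a partition: the sum of the estimated sizes of its parts. -/
def partitionCost (size : List ℕ → ℝ) (parts : List (List ℕ)) : ℝ :=
  (parts.map size).sum

/-- `parts` is a partition of `T` whose cost is at most `1 + ε` times that of any partition. -/
def IsApproxOptimal (size : List ℕ → ℝ) (ε : ℝ) (T : List ℕ) (parts : List (List ℕ)) : Prop :=
  IsPartition parts T ∧
    ∀ parts', IsPartition parts' T →
      partitionCost size parts ≤ (1 + ε) * partitionCost size parts'

/-! ### The machine model

A random access machine with unit costs.  It has integer cells, which hold natural numbers below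
a word bound, and real cells.  Programs are finite pieces of text (the language has loops and
conditionals), they use finitely many scalar variables and finitely many arrays, and array cells
are addressed by computed integers.  There is no conversion from reals to integers:
reals influence integers only through comparisons. -/

namespace RealRAM

/-- Contents of the scalar variables and of the arrays. -/
structure State where
  ivar : ℕ → ℕ
  iarr : ℕ → ℕ → ℕ
  rvar : ℕ → ℝ
  rarr : ℕ → ℕ → ℝ

/-- A machine: the function `f` that it evaluates in constant time, the number `space` of cells
available in each array, and the word bound: integers have to stay below `word`. -/
structure Machine where
  f : ℕ → ℕ → ℝ
  space : ℕ
  word : ℕ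

/-- Integer expressions (truncated subtraction; division by zero yields zero). -/
inductive IExpr
  | const (k : ℕ)
  | var (x : ℕ)
  | cell (a : ℕ) (i : IExpr)
  | add (e₁ e₂ : IExpr)
  | sub (e₁ e₂ : IExpr)
  | mul (e₁ e₂ : IExpr)
  | div (e₁ e₂ : IExpr)
  | mod (e₁ e₂ : IExpr)

/-- Real expressions: `log e` is the binary logarithm of an integer (zero for `e = 0`), and
`overhead e₁ e₂` is the value of the machine's function `f` at two integers. -/
inductive RExpr
  | var (x : ℕ)
  | cell (a : ℕ) (i : IExpr)
  | ofNat (e : IExpr)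
  | log (e : IExpr)
  | overhead (e₁ e₂ : IExpr)
  | add (e₁ e₂ : RExpr)
  | sub (e₁ e₂ : RExpr)
  | mul (e₁ e₂ : RExpr)

/-- Tests. -/
inductive BExpr
  | ilt (e₁ e₂ : IExpr)
  | ieq (e₁ e₂ : IExpr)
  | rle (e₁ e₂ : RExpr)
  | not (b : BExpr)
  | and (b₁ b₂ : BExpr)

/-- Programs. -/
inductive Prog
  | skip
  | setI (x : ℕ) (e : IExpr)
  | setR (x : ℕ) (e : RExpr)
  | storeI (a : ℕ) (i : IExpr) (e : IExpr)
  | storeR (a : ℕ) (i : IExpr) (e : RExpr)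
  | seq (p q : Prog)
  | ite (b : BExpr) (p q : Prog)
  | loop (b : BExpr) (p : Prog)

/-- Value of an integer expression. -/
def IExpr.eval (s : State) : IExpr → ℕ
  | .const k => k
  | .var x => s.ivar x
  | .cell a i => s.iarr a (i.eval s)
  | .add e₁ e₂ => e₁.eval s + e₂.eval s
  | .sub e₁ e₂ => e₁.eval s - e₂.eval s
  | .mul e₁ e₂ => e₁.eval s * e₂.eval s
  | .div e₁ e₂ => e₁.eval s / e₂.eval s
  | .mod e₁ e₂ => e₁.eval s % e₂.eval s

/-- No fault in the evaluation: all intermediate integers are below the word bound and all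
addressed cells exist. -/
def IExpr.Ok (M : Machine) (s : State) : IExpr → Prop
  | .const k => k < M.word
  | .var x => s.ivar x < M.word
  | .cell a i => i.Ok M s ∧ i.eval s < M.space ∧ s.iarr a (i.eval s) < M.word
  | .add e₁ e₂ => e₁.Ok M s ∧ e₂.Ok M s ∧ e₁.eval s + e₂.eval s < M.word
  | .sub e₁ e₂ => e₁.Ok M s ∧ e₂.Ok M s
  | .mul e₁ e₂ => e₁.Ok M s ∧ e₂.Ok M s ∧ e₁.eval s * e₂.eval s < M.word
  | .div e₁ e₂ => e₁.Ok M s ∧ e₂.Ok M s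
  | .mod e₁ e₂ => e₁.Ok M s ∧ e₂.Ok M s

/-- Number of elementary operations in the evaluation. -/
def IExpr.cost : IExpr → ℕ
  | .const _ => 1
  | .var _ => 1
  | .cell _ i => i.cost + 1
  | .add e₁ e₂ => e₁.cost + e₂.cost + 1
  | .sub e₁ e₂ => e₁.cost + e₂.cost + 1
  | .mul e₁ e₂ => e₁.cost + e₂.cost + 1
  | .div e₁ e₂ => e₁.cost + e₂.cost + 1
  | .mod e₁ e₂ => e₁.cost + e₂.cost + 1

/-- Value of a real expression. -/
def RExpr.eval (M : Machine) (s : State) : RExpr → ℝ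
  | .var x => s.rvar x
  | .cell a i => s.rarr a (i.eval s)
  | .ofNat e => (e.eval s : ℝ)
  | .log e => Real.logb 2 (e.eval s : ℝ)
  | .overhead e₁ e₂ => M.f (e₁.eval s) (e₂.eval s)
  | .add e₁ e₂ => e₁.eval M s + e₂.eval M s
  | .sub e₁ e₂ => e₁.eval M s - e₂.eval M s
  | .mul e₁ e₂ => e₁.eval M s * e₂.eval M s

/-- No fault in the evaluation. -/
def RExpr.Ok (M : Machine) (s : State) : RExpr → Prop
  | .var _ => True
  | .cell _ i => i.Ok M s ∧ i.eval s < M.space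
  | .ofNat e => e.Ok M s
  | .log e => e.Ok M s
  | .overhead e₁ e₂ => e₁.Ok M s ∧ e₂.Ok M s
  | .add e₁ e₂ => e₁.Ok M s ∧ e₂.Ok M s
  | .sub e₁ e₂ => e₁.Ok M s ∧ e₂.Ok M s
  | .mul e₁ e₂ => e₁.Ok M s ∧ e₂.Ok M s

/-- Number of elementary operations in the evaluation. -/
def RExpr.cost : RExpr → ℕ
  | .var _ => 1
  | .cell _ i => i.cost + 1
  | .ofNat e => e.cost + 1
  | .log e => e.cost + 1
  | .overhead e₁ e₂ => e₁.cost + e₂.cost + 1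
  | .add e₁ e₂ => e₁.cost + e₂.cost + 1
  | .sub e₁ e₂ => e₁.cost + e₂.cost + 1
  | .mul e₁ e₂ => e₁.cost + e₂.cost + 1

/-- Truth of a test. -/
def BExpr.Holds (M : Machine) (s : State) : BExpr → Prop
  | .ilt e₁ e₂ => e₁.eval s < e₂.eval s
  | .ieq e₁ e₂ => e₁.eval s = e₂.eval s
  | .rle e₁ e₂ => e₁.eval M s ≤ e₂.eval M s
  | .not b => ¬ b.Holds M s
  | .and b₁ b₂ => b₁.Holds M s ∧ b₂.Holds M s

/-- No fault in the evaluation (both sides of a conjunction are evaluated). -/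
def BExpr.Ok (M : Machine) (s : State) : BExpr → Prop
  | .ilt e₁ e₂ => e₁.Ok M s ∧ e₂.Ok M s
  | .ieq e₁ e₂ => e₁.Ok M s ∧ e₂.Ok M s
  | .rle e₁ e₂ => e₁.Ok M s ∧ e₂.Ok M s
  | .not b => b.Ok M s
  | .and b₁ b₂ => b₁.Ok M s ∧ b₂.Ok M s

/-- Number of elementary operations in the evaluation. -/
def BExpr.cost : BExpr → ℕ
  | .ilt e₁ e₂ => e₁.cost + e₂.cost + 1
  | .ieq e₁ e₂ => e₁.cost + e₂.cost + 1
  | .rle e₁ e₂ => e₁.cost + e₂.cost + 1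
  | .not b => b.cost + 1
  | .and b₁ b₂ => b₁.cost + b₂.cost + 1

def State.setI (s : State) (x v : ℕ) : State :=
  { s with ivar := Function.update s.ivar x v }

def State.setR (s : State) (x : ℕ) (v : ℝ) : State :=
  { s with rvar := Function.update s.rvar x v }

def State.storeI (s : State) (a i v : ℕ) : State :=
  { s with iarr := Function.update s.iarr a (Function.update (s.iarr a) i v) }

def State.storeR (s : State) (a i : ℕ) (v : ℝ) : State :=
  { s with rarr := Function.update s.rarr a (Function.update (s.rarr a) i v) }

/-- `Exec M p s s' t`: started in state `s`, the program `p` halts on the machine `M` without a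
fault, in state `s'` and after `t` elementary steps. -/
inductive Exec (M : Machine) : Prog → State → State → ℕ → Prop
  | skip (s : State) : Exec M .skip s s 1
  | setI (s : State) (x : ℕ) (e : IExpr) (he : e.Ok M s) :
      Exec M (.setI x e) s (s.setI x (e.eval s)) (e.cost + 1)
  | setR (s : State) (x : ℕ) (e : RExpr) (he : e.Ok M s) :
      Exec M (.setR x e) s (s.setR x (e.eval M s)) (e.cost + 1)
  | storeI (s : State) (a : ℕ) (i e : IExpr) (hi : i.Ok M s) (hb : i.eval s < M.space)
      (he : e.Ok M s) :
      Exec M (.storeI a i e) s (s.storeI a (i.eval s) (e.eval s)) (i.cost + e.cost + 1)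
  | storeR (s : State) (a : ℕ) (i : IExpr) (e : RExpr) (hi : i.Ok M s)
      (hb : i.eval s < M.space) (he : e.Ok M s) :
      Exec M (.storeR a i e) s (s.storeR a (i.eval s) (e.eval M s)) (i.cost + e.cost + 1)
  | seq (p q : Prog) (s s₁ s₂ : State) (t₁ t₂ : ℕ) (hp : Exec M p s s₁ t₁)
      (hq : Exec M q s₁ s₂ t₂) : Exec M (.seq p q) s s₂ (t₁ + t₂)
  | ite_true (b : BExpr) (p q : Prog) (s s' : State) (t : ℕ) (hok : b.Ok M s)
      (hb : b.Holds M s) (hp : Exec M p s s' t) : Exec M (.ite b p q) s s' (b.cost + 1 + t)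
  | ite_false (b : BExpr) (p q : Prog) (s s' : State) (t : ℕ) (hok : b.Ok M s)
      (hb : ¬ b.Holds M s) (hq : Exec M q s s' t) : Exec M (.ite b p q) s s' (b.cost + 1 + t)
  | loop_true (b : BExpr) (p : Prog) (s s₁ s₂ : State) (t₁ t₂ : ℕ) (hok : b.Ok M s)
      (hb : b.Holds M s) (hp : Exec M p s s₁ t₁) (hl : Exec M (.loop b p) s₁ s₂ t₂) :
      Exec M (.loop b p) s s₂ (b.cost + 1 + t₁ + t₂)
  | loop_false (b : BExpr) (p : Prog) (s : State) (hok : b.Ok M s) (hb : ¬ b.Holds M s) :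
      Exec M (.loop b p) s s (b.cost + 1)

/-- Initial state: the text in integer array `0`, its length in integer variable `0`, and the
parameters `ε` and `λ` in the real variables `0` and `1`; everything else is zero. -/
def initial (T : List ℕ) (ε lam : ℝ) : State where
  ivar x := if x = 0 then T.length else 0
  iarr a i := if a = 0 then T.getD i 0 else 0
  rvar x := if x = 0 then ε else if x = 1 then lam else 0
  rarr _ _ := 0

/-- Output: the sequence of part lengths, from left to right, in integer array `1`, and the number
of parts in integer variable `1`. -/
def output (s : State) : List ℕ :=
  (List.range (s.ivar 1)).map (s.iarr 1)

end RealRAM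

end

open Finset

namespace RealRAM

-- Both entropies satisfy `|w| H(w) = g(|w|) - ∑ g(n_c)`, with `g(m) = m log m` or `g(m) = log m!`,
-- and in both cases the increments of `g` are nondecreasing. Adding a symbol at either end of a
-- window changes this quantity by the increment of `g` at the length minus its increment at a
-- count, hence by a nonnegative amount that a table of `g` gives in constant time. So the cost is
-- monotone under inclusion of windows. A window with two different symbols carries at least one
-- bit, and a window with a single symbol has no entropy and costs only `f`. After scaling by a
-- suitable integer constant `N`, every window therefore costs zero or at least one (`exists_scale`,
-- `info_dichotomy`, `sound_of_isEntropyFn`).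
--
-- Partitions are paths from `0` to `n` whose edges are windows. For each left end only the longest
-- windows within each of a geometric sequence of thresholds are kept. Because of the gap above zero
-- and the polynomial bound on costs (`cost_le_pow`), the number of thresholds is `O(1 + log_{1+ε}
-- n)` (`thresholds_le`). Every edge `(i, j)` is dominated by a kept edge `(i, j')` with `j ≤ j'`
-- and at most `1 + ε` times the cost (`exists_reach`). Overshooting is harmless: by monotonicity,
-- what is left of a part that begins before `j'` costs no more than the whole part. Hence a
-- shortest path in the pruned graph is `(1 + ε)`-optimal (`Setup.Solved.le_cost`).
--
-- The pruned graph may have too many edges for linear space. The text is therefore processed from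
-- right to left in blocks of length about `n` divided by the number of thresholds, so that the
-- edges leaving one block fit into `n` cells. In a block, a window anchored at the left border
-- grows from threshold to threshold, which costs `O(n)` per block. For each threshold it is slid
-- through the block and brought back. The distance covered by the right end is the increase of the
-- maximal right end across the block, and these increases telescope over the blocks
-- (`run_blockEdgesProg`, `run_blocksProg`). If there are more thresholds than positions, exhaustive
-- quadratic search already meets the time bound (`run_exactProg`).
--
-- Count arrays need symbols below `n`. A preliminary phase refines the partition of the positions
-- into symbol classes, one base-`(n + 1)` digit at a time, in linear time per digit
-- (`run_renameProg`).

infixr:60 " ;; " => Prog.seq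

/-! ### Frames -/

/-- `p` contains no assignment to the integer variable `y`. -/
def Prog.keepsI (y : ℕ) : Prog → Bool
  | .setI x _ => !(Nat.beq x y)
  | .seq p q => p.keepsI y && q.keepsI y
  | .ite _ p q => p.keepsI y && q.keepsI y
  | .loop _ p => p.keepsI y
  | _ => true

/-- `p` contains no assignment to the real variable `y`. -/
def Prog.keepsR (y : ℕ) : Prog → Bool
  | .setR x _ => !(Nat.beq x y)
  | .seq p q => p.keepsR y && q.keepsR y
  | .ite _ p q => p.keepsR y && q.keepsR y
  | .loop _ p => p.keepsR y
  | _ => true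

/-- `p` contains no assignment to the integer array `y`. -/
def Prog.keepsIArr (y : ℕ) : Prog → Bool
  | .storeI x _ _ => !(Nat.beq x y)
  | .seq p q => p.keepsIArr y && q.keepsIArr y
  | .ite _ p q => p.keepsIArr y && q.keepsIArr y
  | .loop _ p => p.keepsIArr y
  | _ => true

/-- `p` contains no assignment to the real array `y`. -/
def Prog.keepsRArr (y : ℕ) : Prog → Bool
  | .storeR x _ _ => !(Nat.beq x y)
  | .seq p q => p.keepsRArr y && q.keepsRArr y
  | .ite _ p q => p.keepsRArr y && q.keepsRArr y
  | .loop _ p => p.keepsRArr y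
  | _ => true

/-- `s'` agrees with `s` outside of what `p` assigns to. -/
structure Frame (p : Prog) (s s' : State) : Prop where
  ivar : ∀ {y}, p.keepsI y = true → s'.ivar y = s.ivar y
  rvar : ∀ {y}, p.keepsR y = true → s'.rvar y = s.rvar y
  iarr : ∀ {y}, p.keepsIArr y = true → s'.iarr y = s.iarr y
  rarr : ∀ {y}, p.keepsRArr y = true → s'.rarr y = s.rarr y

theorem Frame.refl (p : Prog) (s : State) : Frame p s s :=
  ⟨fun _ => rfl, fun _ => rfl, fun _ => rfl, fun _ => rfl⟩

theorem Frame.trans {p : Prog} {s s₁ s₂ : State} (h : Frame p s s₁) (h' : Frame p s₁ s₂) :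
    Frame p s s₂ :=
  ⟨fun hy => (h'.ivar hy).trans (h.ivar hy), fun hy => (h'.rvar hy).trans (h.rvar hy),
    fun hy => (h'.iarr hy).trans (h.iarr hy), fun hy => (h'.rarr hy).trans (h.rarr hy)⟩

/-- Preservation thus reduces to a syntactic check. For a concrete program the check evaluates to
`true`, so it is discharged by `rfl` throughout. -/
theorem Exec.frame {M : Machine} {p : Prog} {s s' : State} {t : ℕ} (h : Exec M p s s' t) :
    Frame p s s' := by
  induction h with
  | skip s => exact .refl _ _
  | setI s x e he =>
    refine ⟨fun hy => ?_, fun _ => rfl, fun _ => rfl, fun _ => rfl⟩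
    simp only [Prog.keepsI, Bool.not_eq_true'] at hy
    exact Function.update_of_ne (Ne.symm (Nat.ne_of_beq_eq_false hy)) _ _
  | setR s x e he =>
    refine ⟨fun _ => rfl, fun hy => ?_, fun _ => rfl, fun _ => rfl⟩
    simp only [Prog.keepsR, Bool.not_eq_true'] at hy
    exact Function.update_of_ne (Ne.symm (Nat.ne_of_beq_eq_false hy)) _ _
  | storeI s a i e hi hb he =>
    refine ⟨fun _ => rfl, fun _ => rfl, fun hy => ?_, fun _ => rfl⟩
    simp only [Prog.keepsIArr, Bool.not_eq_true'] at hy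
    exact Function.update_of_ne (Ne.symm (Nat.ne_of_beq_eq_false hy)) _ _
  | storeR s a i e hi hb he =>
    refine ⟨fun _ => rfl, fun _ => rfl, fun _ => rfl, fun hy => ?_⟩
    simp only [Prog.keepsRArr, Bool.not_eq_true'] at hy
    exact Function.update_of_ne (Ne.symm (Nat.ne_of_beq_eq_false hy)) _ _
  | seq p q s s₁ s₂ t₁ t₂ hp hq h1 h2 =>
    refine ⟨fun hy => ?_, fun hy => ?_, fun hy => ?_, fun hy => ?_⟩
    · simp only [Prog.keepsI, Bool.and_eq_true] at hy
      rw [h2.ivar hy.2, h1.ivar hy.1]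
    · simp only [Prog.keepsR, Bool.and_eq_true] at hy
      rw [h2.rvar hy.2, h1.rvar hy.1]
    · simp only [Prog.keepsIArr, Bool.and_eq_true] at hy
      rw [h2.iarr hy.2, h1.iarr hy.1]
    · simp only [Prog.keepsRArr, Bool.and_eq_true] at hy
      rw [h2.rarr hy.2, h1.rarr hy.1]
  | ite_true b p q s s' t hok hb hp h1 =>
    refine ⟨fun hy => ?_, fun hy => ?_, fun hy => ?_, fun hy => ?_⟩
    · simp only [Prog.keepsI, Bool.and_eq_true] at hy
      exact h1.ivar hy.1
    · simp only [Prog.keepsR, Bool.and_eq_true] at hy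
      exact h1.rvar hy.1
    · simp only [Prog.keepsIArr, Bool.and_eq_true] at hy
      exact h1.iarr hy.1
    · simp only [Prog.keepsRArr, Bool.and_eq_true] at hy
      exact h1.rarr hy.1
  | ite_false b p q s s' t hok hb hp h1 =>
    refine ⟨fun hy => ?_, fun hy => ?_, fun hy => ?_, fun hy => ?_⟩
    · simp only [Prog.keepsI, Bool.and_eq_true] at hy
      exact h1.ivar hy.2
    · simp only [Prog.keepsR, Bool.and_eq_true] at hy
      exact h1.rvar hy.2
    · simp only [Prog.keepsIArr, Bool.and_eq_true] at hy
      exact h1.iarr hy.2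
    · simp only [Prog.keepsRArr, Bool.and_eq_true] at hy
      exact h1.rarr hy.2
  | loop_true b p s s₁ s₂ t₁ t₂ hok hb hp hl h1 h2 =>
    refine ⟨fun hy => ?_, fun hy => ?_, fun hy => ?_, fun hy => ?_⟩
    · rw [h2.ivar hy, h1.ivar hy]
    · rw [h2.rvar hy, h1.rvar hy]
    · rw [h2.iarr hy, h1.iarr hy]
    · rw [h2.rarr hy, h1.rarr hy]
  | loop_false b p s hok hb => exact .refl _ _

/-! ### Total correctness with running time -/

/-- `p`, started in `s`, halts without a fault in a state and after a time that satisfy `Q`. -/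
def Run (M : Machine) (p : Prog) (s : State) (Q : State → ℕ → Prop) : Prop :=
  ∃ s' t, Exec M p s s' t ∧ Q s' t

section Rules

variable {M : Machine} {s : State} {Q : State → ℕ → Prop}

/-- The frame of the execution comes for free, so postconditions only mention what a program
changes. -/
theorem Run.conseq {p : Prog} {R : State → ℕ → Prop} (h : Run M p s R)
    (hR : ∀ s' t, Frame p s s' → R s' t → Q s' t) : Run M p s Q := by
  obtain ⟨s', t, he, hr⟩ := h
  exact ⟨s', t, he, hR _ _ he.frame hr⟩

/-- This rule and those below for the other loop-free constructs are equivalences so that `simp` can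
execute such programs symbolically. -/
theorem run_skip : Run M .skip s Q ↔ Q s 1 := by
  constructor
  · rintro ⟨s', t, he, hq⟩
    cases he
    exact hq
  · exact fun h => ⟨_, _, .skip s, h⟩

theorem run_setI {x : ℕ} {e : IExpr} :
    Run M (.setI x e) s Q ↔ e.Ok M s ∧ Q (s.setI x (e.eval s)) (e.cost + 1) := by
  constructor
  · rintro ⟨s', t, he, hq⟩
    cases he with
    | setI _ _ _ h => exact ⟨h, hq⟩
  · exact fun h => ⟨_, _, .setI s x e h.1, h.2⟩

theorem run_setR {x : ℕ} {e : RExpr} :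
    Run M (.setR x e) s Q ↔ e.Ok M s ∧ Q (s.setR x (e.eval M s)) (e.cost + 1) := by
  constructor
  · rintro ⟨s', t, he, hq⟩
    cases he with
    | setR _ _ _ h => exact ⟨h, hq⟩
  · exact fun h => ⟨_, _, .setR s x e h.1, h.2⟩

theorem run_storeI {a : ℕ} {i e : IExpr} :
    Run M (.storeI a i e) s Q ↔ i.Ok M s ∧ i.eval s < M.space ∧ e.Ok M s ∧
      Q (s.storeI a (i.eval s) (e.eval s)) (i.cost + e.cost + 1) := by
  constructor
  · rintro ⟨s', t, he, hq⟩
    cases he with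
    | storeI _ _ _ _ h1 h2 h3 => exact ⟨h1, h2, h3, hq⟩
  · exact fun h => ⟨_, _, .storeI s a i e h.1 h.2.1 h.2.2.1, h.2.2.2⟩

theorem run_storeR {a : ℕ} {i : IExpr} {e : RExpr} :
    Run M (.storeR a i e) s Q ↔ i.Ok M s ∧ i.eval s < M.space ∧ e.Ok M s ∧
      Q (s.storeR a (i.eval s) (e.eval M s)) (i.cost + e.cost + 1) := by
  constructor
  · rintro ⟨s', t, he, hq⟩
    cases he with
    | storeR _ _ _ _ h1 h2 h3 => exact ⟨h1, h2, h3, hq⟩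
  · exact fun h => ⟨_, _, .storeR s a i e h.1 h.2.1 h.2.2.1, h.2.2.2⟩

theorem run_seq {p q : Prog} :
    Run M (p ;; q) s Q ↔ Run M p s fun s₁ t₁ => Run M q s₁ fun s₂ t₂ => Q s₂ (t₁ + t₂) := by
  constructor
  · rintro ⟨s', t, he, hq⟩
    cases he with
    | seq _ _ _ s₁ _ t₁ t₂ h1 h2 => exact ⟨_, _, h1, _, _, h2, hq⟩
  · rintro ⟨s₁, t₁, h1, s₂, t₂, h2, hq⟩
    exact ⟨_, _, .seq _ _ _ _ _ _ _ h1 h2, hq⟩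

theorem run_ite {b : BExpr} {p q : Prog} :
    Run M (.ite b p q) s Q ↔ b.Ok M s ∧
      (b.Holds M s → Run M p s fun s' t => Q s' (b.cost + 1 + t)) ∧
      (¬ b.Holds M s → Run M q s fun s' t => Q s' (b.cost + 1 + t)) := by
  constructor
  · rintro ⟨s', t, he, hq⟩
    cases he with
    | ite_true _ _ _ _ _ t hok hb h => exact ⟨hok, fun _ => ⟨_, _, h, hq⟩, fun hn => (hn hb).elim⟩
    | ite_false _ _ _ _ _ t hok hb h =>
      exact ⟨hok, fun hn => (hb hn).elim, fun _ => ⟨_, _, h, hq⟩⟩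
  · rintro ⟨hok, h1, h2⟩
    by_cases hb : b.Holds M s
    · obtain ⟨s', t, h, hq⟩ := h1 hb
      exact ⟨_, _, .ite_true _ _ _ _ _ _ hok hb h, hq⟩
    · obtain ⟨s', t, h, hq⟩ := h2 hb
      exact ⟨_, _, .ite_false _ _ _ _ _ _ hok hb h, hq⟩

theorem Run.seq {p q : Prog} {R : State → ℕ → Prop} (h : Run M p s R)
    (hq : ∀ s₁ t₁, Frame p s s₁ → R s₁ t₁ → Run M q s₁ fun s₂ t₂ => Q s₂ (t₁ + t₂)) :
    Run M (p ;; q) s Q :=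
  run_seq.2 (h.conseq hq)

/-- The loop rule: `μ` bounds the time that remains, up to the last evaluation of the test. -/
theorem Run.loop {b : BExpr} {p : Prog} (I : State → Prop) (μ : State → ℕ) (h0 : I s)
    (hok : ∀ s', I s' → Frame p s s' → b.Ok M s')
    (hbody : ∀ s', I s' → Frame p s s' → b.Holds M s' →
      Run M p s' fun s'' t => I s'' ∧ t + b.cost + 1 + μ s'' ≤ μ s') :
    Run M (.loop b p) s fun s' t => I s' ∧ ¬ b.Holds M s' ∧ t + μ s' ≤ μ s + b.cost + 1 := by
  -- Induction on a bound for the remaining budget: each round pays at least for its test, so the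
  -- budget strictly decreases and termination comes with the time bound.
  suffices h : ∀ k s', μ s' ≤ k → I s' → Frame p s s' →
      Run M (.loop b p) s' fun s'' t =>
        I s'' ∧ ¬ b.Holds M s'' ∧ t + μ s'' ≤ μ s' + b.cost + 1 from
    h _ s le_rfl h0 (.refl _ _)
  intro k
  induction k with
  | zero =>
    intro s' hk hI hF
    by_cases hb : b.Holds M s'
    · obtain ⟨s₁, t₁, -, -, h2⟩ := hbody s' hI hF hb
      omega
    · exact ⟨_, _, .loop_false b p s' (hok s' hI hF) hb, hI, hb, by omega⟩
  | succ k ih =>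
    intro s' hk hI hF
    by_cases hb : b.Holds M s'
    · obtain ⟨s₁, t₁, he, hI', h2⟩ := hbody s' hI hF hb
      obtain ⟨s₂, t₂, he', hI'', hb'', h3⟩ := ih s₁ (by omega) hI' (hF.trans he.frame)
      exact ⟨_, _, .loop_true b p _ _ _ _ _ (hok s' hI hF) hb he he', hI'', hb'', by omega⟩
    · exact ⟨_, _, .loop_false b p s' (hok s' hI hF) hb, hI, hb, by omega⟩

end Rules

/-! ### Symbolic evaluation -/

section Eval

variable (s : State) (x y a b i j v : ℕ) (r : ℝ)

theorem ivar_setI : (s.setI x v).ivar y = if y = x then v else s.ivar y := by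
  simp only [State.setI, Function.update_apply]

theorem rvar_setR : (s.setR x r).rvar y = if y = x then r else s.rvar y := by
  simp only [State.setR, Function.update_apply]

theorem iarr_storeI : (s.storeI a i v).iarr b =
    if b = a then Function.update (s.iarr b) i v else s.iarr b := by
  by_cases h : b = a
  · subst h; simp [State.storeI]
  · simp [State.storeI, h]

theorem rarr_storeR : (s.storeR a i r).rarr b =
    if b = a then Function.update (s.rarr b) i r else s.rarr b := by
  by_cases h : b = a
  · subst h; simp [State.storeR]
  · simp [State.storeR, h]

theorem rvar_setI : (s.setI x v).rvar = s.rvar := rfl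
theorem iarr_setI : (s.setI x v).iarr = s.iarr := rfl
theorem rarr_setI : (s.setI x v).rarr = s.rarr := rfl
theorem ivar_setR : (s.setR x r).ivar = s.ivar := rfl
theorem iarr_setR : (s.setR x r).iarr = s.iarr := rfl
theorem rarr_setR : (s.setR x r).rarr = s.rarr := rfl
theorem ivar_storeI : (s.storeI a i v).ivar = s.ivar := rfl
theorem rvar_storeI : (s.storeI a i v).rvar = s.rvar := rfl
theorem rarr_storeI : (s.storeI a i v).rarr = s.rarr := rfl
theorem ivar_storeR : (s.storeR a i r).ivar = s.ivar := rfl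
theorem rvar_storeR : (s.storeR a i r).rvar = s.rvar := rfl
theorem iarr_storeR : (s.storeR a i r).iarr = s.iarr := rfl

end Eval

attribute [simp] IExpr.eval IExpr.Ok IExpr.cost RExpr.eval RExpr.Ok RExpr.cost BExpr.Holds
  BExpr.Ok BExpr.cost run_skip run_setI run_setR run_storeI run_storeR run_seq run_ite
  ivar_setI rvar_setR iarr_storeI rarr_storeR rvar_setI iarr_setI rarr_setI ivar_setR iarr_setR
  rarr_setR ivar_storeI rvar_storeI rarr_storeI ivar_storeR rvar_storeR iarr_storeR

/-! ### Occurrence counts -/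

/-- The number of positions in `[i, j)` with symbol `c`. -/
def cnt (A : ℕ → ℕ) (i j c : ℕ) : ℕ :=
  ∑ p ∈ Ico i j, if A p = c then 1 else 0

theorem cnt_self (A : ℕ → ℕ) (i c : ℕ) : cnt A i i c = 0 := by
  simp [cnt]

theorem cnt_succ_right (A : ℕ → ℕ) {i j : ℕ} (h : i ≤ j) (c : ℕ) :
    cnt A i (j + 1) c = cnt A i j c + if A j = c then 1 else 0 :=
  sum_Ico_succ_top h _

theorem cnt_succ_left (A : ℕ → ℕ) {i j : ℕ} (h : i < j) (c : ℕ) :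
    cnt A i j c = cnt A (i + 1) j c + if A i = c then 1 else 0 := by
  rw [cnt, sum_eq_sum_Ico_succ_bot h, add_comm]
  rfl

theorem cnt_le (A : ℕ → ℕ) (i j c : ℕ) : cnt A i j c ≤ j - i := by
  refine (sum_le_card_nsmul _ _ 1 fun p _ => ?_).trans ?_
  · split <;> simp
  · simp

/-- The sum of `g` over the counts of the symbols below `n`. -/
def countSum (g : ℕ → ℝ) (n : ℕ) (h : ℕ → ℕ) : ℝ :=
  ∑ c ∈ range n, g (h c)

/-- The number of symbols below `n` that occur. -/
def distinct (n : ℕ) (h : ℕ → ℕ) : ℕ :=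
  ∑ c ∈ range n, if h c = 0 then 0 else 1

/-- Only the term of the symbol `a` changes; this is what makes a constant-time update of the
entropy possible. -/
theorem countSum_add {g : ℕ → ℝ} {n a : ℕ} {h h' : ℕ → ℕ} (ha : a < n)
    (hh : ∀ c, h' c = h c + if a = c then 1 else 0) :
    countSum g n h' = countSum g n h + (g (h a + 1) - g (h a)) := by
  have hm := mem_range.2 ha
  rw [countSum, countSum, ← add_sum_erase _ _ hm, ← add_sum_erase _ _ hm,
    sum_congr rfl (g := fun c => g (h c)) fun c hc => by
      rw [hh, if_neg (ne_of_mem_erase hc).symm, add_zero], hh, if_pos rfl]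
  ring

theorem distinct_add {n a : ℕ} {h h' : ℕ → ℕ} (ha : a < n)
    (hh : ∀ c, h' c = h c + if a = c then 1 else 0) :
    distinct n h' = distinct n h + if h a = 0 then 1 else 0 := by
  have hm := mem_range.2 ha
  rw [distinct, distinct, ← add_sum_erase _ _ hm, ← add_sum_erase _ _ hm,
    sum_congr rfl (g := fun c => if h c = 0 then 0 else 1) fun c hc => by
      rw [hh, if_neg (ne_of_mem_erase hc).symm, add_zero], hh, if_pos rfl,
    if_neg (Nat.succ_ne_zero _)]
  split <;> omega

theorem distinct_le (n : ℕ) (h : ℕ → ℕ) : distinct n h ≤ n := by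
  refine (sum_le_card_nsmul _ _ 1 fun c _ => ?_).trans (by simp)
  split <;> simp

/-! ### The setting -/

/-- The data of a computation: the machine, the length `n` of the text, the factor `N` by which
all costs are scaled, the parameters, the text `A` over the alphabet `{0, …, n - 1}`, and the
function `g` that defines the entropy. -/
structure Setup where
  M : Machine
  n : ℕ
  N : ℕ
  lam : ℝ
  eps : ℝ
  A : ℕ → ℕ
  g : ℕ → ℝ

namespace Setup

/-- The scaled cost of the window `[i, j)`. -/
def cost (S : Setup) (i j : ℕ) : ℝ :=
  S.N * (S.lam * (S.g (j - i) - countSum S.g S.n (cnt S.A i j)) +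
    S.M.f (j - i) (distinct S.n (cnt S.A i j)))

/-- The machine is large enough. -/
structure Fits (S : Setup) : Prop where
  pos : 0 < S.n
  symb : ∀ p < S.n, S.A p < S.n
  word : 4 * S.n + 4 < S.M.word
  scale : S.N < S.M.word
  space : 2 * S.n ≤ S.M.space

/-- The input of the main phase is in place. -/
structure Base (S : Setup) (s : State) : Prop where
  len : s.ivar 0 = S.n
  eps : s.rvar 0 = S.eps
  lam : s.rvar 1 = S.lam
  symb : ∀ p < S.n, s.iarr 2 p = S.A p
  table : ∀ x ≤ S.n, s.rarr 0 x = S.g x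

/-- `p` leaves the input of the main phase intact. -/
def keepsBase (p : Prog) : Bool :=
  p.keepsI 0 && p.keepsR 0 && p.keepsR 1 && p.keepsIArr 2 && p.keepsRArr 0

theorem Base.frame {S : Setup} {s s' : State} {p : Prog} (h : S.Base s) (hF : Frame p s s')
    (hp : keepsBase p = true) : S.Base s' := by
  simp only [keepsBase, Bool.and_eq_true] at hp
  obtain ⟨⟨⟨⟨h0, h1⟩, h2⟩, h3⟩, h4⟩ := hp
  refine ⟨?_, ?_, ?_, ?_, ?_⟩
  · rw [hF.ivar h0, h.len]
  · rw [hF.rvar h1, h.eps]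
  · rw [hF.rvar h2, h.lam]
  · rw [hF.iarr h3]; exact h.symb
  · rw [hF.rarr h4]; exact h.table

/-- The counts `h` are stored, together with the sum of `g` and the number of symbols. -/
structure Counts (S : Setup) (h : ℕ → ℕ) (s : State) : Prop where
  cell : ∀ c < S.n, s.iarr 7 c = h c
  sum : s.rvar 2 = countSum S.g S.n h
  dist : s.ivar 4 = distinct S.n h

/-- `p` leaves the counts intact. -/
def keepsCounts (p : Prog) : Bool :=
  p.keepsI 4 && p.keepsR 2 && p.keepsIArr 7

theorem Counts.frame {S : Setup} {s s' : State} {p : Prog} {h : ℕ → ℕ} (hc : S.Counts h s)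
    (hF : Frame p s s') (hp : keepsCounts p = true) : S.Counts h s' := by
  simp only [keepsCounts, Bool.and_eq_true] at hp
  obtain ⟨⟨h0, h1⟩, h2⟩ := hp
  refine ⟨?_, ?_, ?_⟩
  · rw [hF.iarr h2]; exact hc.cell
  · rw [hF.rvar h1]; exact hc.sum
  · rw [hF.ivar h0]; exact hc.dist

section Updates

variable {S : Setup} {s : State} {h : ℕ → ℕ}

theorem Base.setI (hB : S.Base s) (x v : ℕ) (hx : x ≠ 0 := by decide) : S.Base (s.setI x v) :=
  ⟨by simpa [hx.symm] using hB.len, hB.eps, hB.lam, hB.symb, hB.table⟩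

theorem Base.setR (hB : S.Base s) (x : ℕ) (v : ℝ) (hx : x ≠ 0 := by decide)
    (hx' : x ≠ 1 := by decide) : S.Base (s.setR x v) :=
  ⟨hB.len, by simpa [hx.symm] using hB.eps, by simpa [hx'.symm] using hB.lam, hB.symb, hB.table⟩

theorem Base.storeI (hB : S.Base s) (a i v : ℕ) (ha : a ≠ 2 := by decide) :
    S.Base (s.storeI a i v) :=
  ⟨hB.len, hB.eps, hB.lam, by simpa [ha.symm] using hB.symb, hB.table⟩

theorem Base.storeR (hB : S.Base s) (a i : ℕ) (v : ℝ) (ha : a ≠ 0 := by decide) :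
    S.Base (s.storeR a i v) :=
  ⟨hB.len, hB.eps, hB.lam, hB.symb, by simpa [ha.symm] using hB.table⟩

theorem Counts.setI (hC : S.Counts h s) (x v : ℕ) (hx : x ≠ 4 := by decide) :
    S.Counts h (s.setI x v) :=
  ⟨hC.cell, hC.sum, by simpa [hx.symm] using hC.dist⟩

theorem Counts.setR (hC : S.Counts h s) (x : ℕ) (v : ℝ) (hx : x ≠ 2 := by decide) :
    S.Counts h (s.setR x v) :=
  ⟨hC.cell, by simpa [hx.symm] using hC.sum, hC.dist⟩

theorem Counts.storeI (hC : S.Counts h s) (a i v : ℕ) (ha : a ≠ 7 := by decide) :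
    S.Counts h (s.storeI a i v) :=
  ⟨by simpa [ha.symm] using hC.cell, hC.sum, hC.dist⟩

theorem Counts.storeR (hC : S.Counts h s) (a i : ℕ) (v : ℝ) : S.Counts h (s.storeR a i v) :=
  ⟨hC.cell, hC.sum, hC.dist⟩

end Updates

end Setup

open Setup

/-! ### Windows -/

/-- Count the symbol at position `var 2`. -/
def addProg : Prog :=
  .setI 3 (.cell 2 (.var 2)) ;;
  .setR 2 (.add (.var 2) (.sub (.cell 0 (.add (.cell 7 (.var 3)) (.const 1)))
    (.cell 0 (.cell 7 (.var 3))))) ;;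
  .ite (.ieq (.cell 7 (.var 3)) (.const 0)) (.setI 4 (.add (.var 4) (.const 1))) .skip ;;
  .storeI 7 (.var 3) (.add (.cell 7 (.var 3)) (.const 1))

/-- Uncount the symbol at position `var 2`. -/
def removeProg : Prog :=
  .setI 3 (.cell 2 (.var 2)) ;;
  .storeI 7 (.var 3) (.sub (.cell 7 (.var 3)) (.const 1)) ;;
  .setR 2 (.sub (.var 2) (.sub (.cell 0 (.add (.cell 7 (.var 3)) (.const 1)))
    (.cell 0 (.cell 7 (.var 3))))) ;;
  .ite (.ieq (.cell 7 (.var 3)) (.const 0)) (.setI 4 (.sub (.var 4) (.const 1))) .skip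

/-- By `countSum_add` and `distinct_add` a single count decides both updates. The bound `hle` keeps
the lookup of `g` inside the table. -/
theorem run_addProg {S : Setup} (hS : S.Fits) {s : State} (hB : S.Base s) {h h' : ℕ → ℕ}
    (hC : S.Counts h s) {p : ℕ} (hp : s.ivar 2 = p) (hpn : p < S.n)
    (hh : ∀ c, h' c = h c + if S.A p = c then 1 else 0) (hle : h' (S.A p) ≤ S.n) :
    Run S.M addProg s fun s' t => S.Counts h' s' ∧ t ≤ 50 := by
  have h1 := hB.symb p hpn
  have h2 := hS.symb p hpn
  have h3 := hC.cell _ h2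
  have h4 := hh (S.A p)
  rw [if_pos rfl] at h4
  have h5 := hS.word
  have h6 := hS.space
  have h7 := hB.table (h (S.A p)) (by omega)
  have h8 := hB.table (h (S.A p) + 1) (by omega)
  have h9 := hC.dist
  have h10 := distinct_le S.n h
  have h11 := countSum_add (g := S.g) h2 hh
  have h12 := distinct_add h2 hh
  have h13 := hC.sum
  have h14 : ∀ c < S.n, Function.update (s.iarr 7) (S.A p) (h (S.A p) + 1) c = h' c := by
    intro c hc
    rw [Function.update_apply, hh]
    split
    · subst c; simp
    · rw [hC.cell c hc, if_neg (Ne.symm ‹_›), add_zero]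
  simp [addProg, hp, h1, h3, h7, h8, h9, h13]
  constructorm* _ ∧ _ <;> try omega
  · intro hz
    constructorm* _ ∧ _ <;> try omega
    refine ⟨by simpa using h14, ?_, ?_⟩
    · simp [h11]
    · simp [h12, hz]
  · intro hz
    constructorm* _ ∧ _ <;> try omega
    refine ⟨by simpa using h14, ?_, ?_⟩
    · simp [h11]
    · simp [h12, hz, h9]

/-- The inverse of counting: the same relation between `h` and `h'` is read backwards. -/
theorem run_removeProg {S : Setup} (hS : S.Fits) {s : State} (hB : S.Base s) {h h' : ℕ → ℕ}
    (hC : S.Counts h' s) {p : ℕ} (hp : s.ivar 2 = p) (hpn : p < S.n)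
    (hh : ∀ c, h' c = h c + if S.A p = c then 1 else 0) (hle : h' (S.A p) ≤ S.n) :
    Run S.M removeProg s fun s' t => S.Counts h s' ∧ t ≤ 50 := by
  have h1 := hB.symb p hpn
  have h2 := hS.symb p hpn
  have h3 := hC.cell _ h2
  have h4 := hh (S.A p)
  rw [if_pos rfl] at h4
  rw [h4] at h3
  have h5 := hS.word
  have h6 := hS.space
  have h7 := hB.table (h (S.A p)) (by omega)
  have h8 := hB.table (h (S.A p) + 1) (by omega)
  have h9 := hC.dist
  have h10 := distinct_le S.n h'
  have h11 := countSum_add (g := S.g) h2 hh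
  have h12 := distinct_add h2 hh
  have h13 := hC.sum
  have h14 : ∀ c < S.n, Function.update (s.iarr 7) (S.A p) (h (S.A p)) c = h c := by
    intro c hc
    rw [Function.update_apply]
    split
    · subst c; simp
    · rw [hC.cell c hc, hh, if_neg (Ne.symm ‹_›), add_zero]
  simp [removeProg, hp, h1, h3, h7, h8, h9, h13]
  constructorm* _ ∧ _ <;> try omega
  · intro hz
    constructorm* _ ∧ _ <;> try omega
    refine ⟨by simpa using h14, ?_, ?_⟩
    · simp [h11]
    · simp [h12, hz]
  · intro hz
    refine ⟨by simpa using h14, ?_, ?_⟩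
    · simp [h11]
    · simp [h12, hz, h9]

theorem run_addRight {S : Setup} (hS : S.Fits) {s : State} (hB : S.Base s) {i j : ℕ}
    (hC : S.Counts (cnt S.A i j) s) (hij : i ≤ j) (hj : j < S.n) (hp : s.ivar 2 = j) :
    Run S.M addProg s fun s' t => S.Counts (cnt S.A i (j + 1)) s' ∧ t ≤ 50 :=
  run_addProg hS hB hC hp hj (cnt_succ_right S.A hij) ((cnt_le _ _ _ _).trans (by omega))

theorem run_addLeft {S : Setup} (hS : S.Fits) {s : State} (hB : S.Base s) {i j : ℕ}
    (hC : S.Counts (cnt S.A (i + 1) j) s) (hij : i < j) (hj : j ≤ S.n) (hp : s.ivar 2 = i) :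
    Run S.M addProg s fun s' t => S.Counts (cnt S.A i j) s' ∧ t ≤ 50 :=
  run_addProg hS hB hC hp (by omega) (cnt_succ_left S.A hij) ((cnt_le _ _ _ _).trans (by omega))

theorem run_removeRight {S : Setup} (hS : S.Fits) {s : State} (hB : S.Base s) {i j : ℕ}
    (hC : S.Counts (cnt S.A i (j + 1)) s) (hij : i ≤ j) (hj : j < S.n) (hp : s.ivar 2 = j) :
    Run S.M removeProg s fun s' t => S.Counts (cnt S.A i j) s' ∧ t ≤ 50 :=
  run_removeProg hS hB hC hp hj (cnt_succ_right S.A hij) ((cnt_le _ _ _ _).trans (by omega))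

theorem run_removeLeft {S : Setup} (hS : S.Fits) {s : State} (hB : S.Base s) {i j : ℕ}
    (hC : S.Counts (cnt S.A i j) s) (hij : i < j) (hj : j ≤ S.n) (hp : s.ivar 2 = i) :
    Run S.M removeProg s fun s' t => S.Counts (cnt S.A (i + 1) j) s' ∧ t ≤ 50 :=
  run_removeProg hS hB hC hp (by omega) (cnt_succ_left S.A hij)
    ((cnt_le _ _ _ _).trans (by omega))

/-- Real variable 3 becomes the scaled cost of the current window `[var 5, var 6)`. -/
def costProg (N : ℕ) : Prog :=
  .setI 15 (.sub (.var 6) (.var 5)) ;;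
  .setR 3 (.mul (.ofNat (.const N)) (.add (.mul (.var 1) (.sub (.cell 0 (.var 15)) (.var 2)))
    (.overhead (.var 15) (.var 4))))

theorem run_costProg {S : Setup} (hS : S.Fits) {s : State} (hB : S.Base s) {i j : ℕ}
    (hC : S.Counts (cnt S.A i j) s) (hij : i ≤ j) (hj : j ≤ S.n) (h5 : s.ivar 5 = i)
    (h6 : s.ivar 6 = j) :
    Run S.M (costProg S.N) s fun s' t => s'.rvar 3 = S.cost i j ∧ t ≤ 50 := by
  have h1 := hS.word
  have h2 := hS.space
  have h3 := hS.scale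
  have h4 := hB.table (j - i) (by omega)
  have h9 := distinct_le S.n (cnt S.A i j)
  have h10 := hS.pos
  simp [costProg, h5, h6, hC.dist, hC.sum, h4, hB.lam, Setup.cost]
  omega

/-- Extend the window `[var 5, var 6)` to the right as long as its cost stays below real
variable 4. -/
def extendProg (N : ℕ) : Prog :=
  .setI 17 (.const 1) ;;
  .loop (.ilt (.const 0) (.var 17))
    (.ite (.ilt (.var 6) (.var 0))
      (.setI 2 (.var 6) ;; addProg ;; .setI 6 (.add (.var 6) (.const 1)) ;; costProg N ;;
        .ite (.rle (.var 3) (.var 4)) .skip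
          (.setI 6 (.sub (.var 6) (.const 1)) ;; .setI 2 (.var 6) ;; removeProg ;;
            .setI 17 (.const 0)))
      (.setI 17 (.const 0)))

/-- The window is enlarged tentatively and the last step is undone if it was too expensive, so the
failed test itself certifies maximality. Costs are compared with `θ` only for nonempty windows,
because nothing is known about the cost of an empty one. -/
theorem run_extendProg {S : Setup} (hS : S.Fits) {s : State} (hB : S.Base s) {i j : ℕ}
    (hC : S.Counts (cnt S.A i j) s) (hij : i ≤ j) (hj : j ≤ S.n) (h5 : s.ivar 5 = i)
    (h6 : s.ivar 6 = j) {θ : ℝ} (hθ : s.rvar 4 = θ) (hc : i < j → S.cost i j ≤ θ) :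
    Run S.M (extendProg S.N) s fun s' t => ∃ j', s'.ivar 6 = j' ∧ j ≤ j' ∧ j' ≤ S.n ∧
      S.Counts (cnt S.A i j') s' ∧ (i < j' → S.cost i j' ≤ θ) ∧
      (j' < S.n → θ < S.cost i (j' + 1)) ∧ t ≤ 300 * (j' - j) + 310 := by
  have hw := hS.word
  refine (run_seq.2 (run_setI.2 ⟨by simp; omega, ?_⟩))
  refine (Run.loop (fun s' => ∃ j', s'.ivar 6 = j' ∧ j ≤ j' ∧ j' ≤ S.n ∧
      S.Counts (cnt S.A i j') s' ∧ (i < j' → S.cost i j' ≤ θ) ∧ s'.ivar 17 ≤ 1 ∧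
      (s'.ivar 17 = 0 → j' < S.n → θ < S.cost i (j' + 1)))
    -- A round either advances the right end or clears the flag in variable 17; each pays for one
    -- round.
    (fun s' => 300 * (S.n - s'.ivar 6) + 300 * s'.ivar 17) ?_ ?_ ?_).conseq ?_
  · exact ⟨j, by simpa using h6, le_rfl, hj,
      hC.setI _ _, hc,
      by simp, by simp⟩
  · rintro s' ⟨j', -, -, -, -, -, h, -⟩ -
    simp; omega
  · rintro s' ⟨j', h1, h2, h3, hC', h4, h7, -⟩ hF hb
    simp only [BExpr.Holds, IExpr.eval] at hb
    have hB' : S.Base s' := (hB.setI _ _).frame hF rfl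
    have h8 : s'.ivar 5 = i := by rw [hF.ivar rfl]; simpa using h5
    have h9 : s'.rvar 4 = θ := by rw [hF.rvar rfl]; simpa using hθ
    have h10 : s'.ivar 17 = 1 := by omega
    have h11 := hB'.len
    refine run_ite.2 ⟨by simp; omega, fun hlt => ?_, fun hge => ?_⟩
    · simp only [BExpr.Holds, IExpr.eval, h1, h11] at hlt
      refine run_seq.2 (run_setI.2 ⟨by simp; omega, ?_⟩)
      refine Run.seq (run_addRight hS (hB'.setI _ _) (hC'.setI _ _) (h2.trans' hij) hlt
        (by simpa using h1)) fun s₁ t₁ hF₁ ⟨hC₁, ht₁⟩ => ?_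
      have e6 : s₁.ivar 6 = j' := by rw [hF₁.ivar rfl]; simpa using h1
      have e5 : s₁.ivar 5 = i := by rw [hF₁.ivar rfl]; simpa using h8
      have e17 : s₁.ivar 17 = 1 := by rw [hF₁.ivar rfl]; simpa using h10
      have e4 : s₁.rvar 4 = θ := by rw [hF₁.rvar rfl]; simpa using h9
      have hB₁ : S.Base s₁ := (hB'.setI _ _).frame hF₁ rfl
      refine run_seq.2 (run_setI.2 ⟨by simp; omega, ?_⟩)
      refine Run.seq (run_costProg (j := j' + 1) hS (hB₁.setI _ _) (hC₁.setI _ _)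
        (by omega) hlt
        (by simpa using e5) (by simpa using e6)) fun s₂ t₂ hF₂ ⟨hv, ht₂⟩ => ?_
      have hB₂ : S.Base s₂ := (hB₁.setI _ _).frame hF₂ rfl
      have hC₂ := (hC₁.setI _ _).frame hF₂ rfl
      have d6 : s₂.ivar 6 = j' + 1 := by rw [hF₂.ivar rfl]; simpa using e6
      have d17 : s₂.ivar 17 = 1 := by rw [hF₂.ivar rfl]; simpa using e17
      have d4 : s₂.rvar 4 = θ := by rw [hF₂.rvar rfl]; simpa using e4
      refine run_ite.2 ⟨by simp, fun hle => ?_, fun hgt => ?_⟩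
      · simp only [BExpr.Holds, RExpr.eval, hv, d4] at hle
        refine run_skip.2 ⟨⟨j' + 1, d6, by omega, hlt, hC₂, fun _ => hle, by omega, by omega⟩, ?_⟩
        simp [h1, h10, d6, d17]
        omega
      · simp only [BExpr.Holds, RExpr.eval, hv, d4] at hgt
        refine run_seq.2 (run_setI.2 ⟨by simp; omega, ?_⟩)
        have hB₃ := hB₂.setI 6 (IExpr.eval s₂ (.sub (.var 6) (.const 1)))
        have hC₃ := hC₂.setI 6 (IExpr.eval s₂ (.sub (.var 6) (.const 1)))
        generalize hs₃ : s₂.setI 6 (IExpr.eval s₂ (.sub (.var 6) (.const 1))) = s₃ at *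
        have c6 : s₃.ivar 6 = j' := by subst hs₃; simp [d6]
        refine run_seq.2 (run_setI.2 ⟨by simp; omega, ?_⟩)
        refine Run.seq (run_removeRight hS (hB₃.setI _ _) (hC₃.setI _ _)
          (h2.trans' hij) hlt (by simpa using c6)) fun s₄ t₄ hF₄ ⟨hC₄, ht₄⟩ => ?_
        have b6 : s₄.ivar 6 = j' := by rw [hF₄.ivar rfl]; simpa using c6
        refine run_setI.2 ⟨by simp; omega, ⟨j', by simpa using b6, h2, h3, hC₄.setI _ _, h4,
          by simp, fun _ _ => not_le.1 hgt⟩, ?_⟩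
        simp [h1, h10, b6]
        omega
    · simp only [BExpr.Holds, IExpr.eval, h1, h11] at hge
      refine run_setI.2 ⟨by simp; omega, ⟨j', by simpa using h1, h2, h3, hC'.setI _ _, h4,
        by simp, fun _ h => by omega⟩, ?_⟩
      simp [h1, h10]
      omega
  · rintro s' t - ⟨⟨j', h1, h2, h3, hC', h4, h7, h8⟩, hb, ht⟩
    simp only [BExpr.Holds, IExpr.eval] at hb
    refine ⟨j', h1, h2, h3, hC', h4, h8 (by omega), ?_⟩
    simp [h1, h6] at ht ⊢
    omega

/-! ### Maximal windows for a cost threshold -/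

namespace Setup

/-- The properties of the costs on which the pruning of the edges depends. -/
structure Sound (S : Setup) : Prop where
  mono : ∀ {i i' j j'}, i ≤ i' → i' < j' → j' ≤ j → j ≤ S.n → S.cost i' j' ≤ S.cost i j
  single : ∀ {i}, i < S.n → S.cost i (i + 1) = S.N * S.M.f 1 1
  gap : ∀ {i j}, i < j → j ≤ S.n → S.cost i j ≤ 0 ∨ 1 ≤ S.cost i j
  nonneg : ∀ {i j}, i < j → j ≤ S.n → 0 ≤ S.cost i j

/-- `j` is the largest right end of a window with left end `i` and cost at most `θ`. -/
structure IsEnd (S : Setup) (θ : ℝ) (i j : ℕ) : Prop where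
  lt : i < j
  le : j ≤ S.n
  cost_le : S.cost i j ≤ θ
  lt_cost : j < S.n → θ < S.cost i (j + 1)

variable {S : Setup}

/-- Otherwise `[i', j' + 1)` would lie inside `[i, j)` and cost at most `θ ≤ θ'`, against the
maximality of `j'`. This monotonicity in both the left end and the threshold is what lets the right
pointer avoid going back. -/
theorem IsEnd.mono (hS : S.Sound) {θ θ' : ℝ} {i i' j j' : ℕ} (h : S.IsEnd θ i j)
    (h' : S.IsEnd θ' i' j') (hi : i ≤ i') (hθ : θ ≤ θ') : j ≤ j' := by
  by_contra hlt
  push Not at hlt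
  have h1 := hS.mono hi (by have := h'.lt; omega : i' < j' + 1) hlt h.le
  have h2 := h'.lt_cost (by have := h.le; omega)
  linarith [h.cost_le]

/-- A threshold that admits a single symbol leaves a nonempty set of candidates. -/
theorem exists_isEnd (hS : S.Sound) {θ : ℝ} {i : ℕ} (hi : i < S.n)
    (hθ : S.N * S.M.f 1 1 ≤ θ) : ∃ j, S.IsEnd θ i j := by
  classical
  have h1 : i < i + 1 ∧ S.cost i (i + 1) ≤ θ := ⟨by omega, (hS.single hi).trans_le hθ⟩
  have h2 := Nat.findGreatest_spec (P := fun j => i < j ∧ S.cost i j ≤ θ) hi h1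
  refine ⟨_, h2.1, Nat.findGreatest_le _, h2.2, fun hlt => ?_⟩
  have h3 := Nat.findGreatest_is_greatest (P := fun j => i < j ∧ S.cost i j ≤ θ)
    (Nat.lt_succ_self _) hlt
  by_contra hle
  exact h3 ⟨by omega, not_lt.1 hle⟩

open Classical in
/-- The largest right end of a window with left end `i` and cost at most `θ`. -/
noncomputable def reach (S : Setup) (θ : ℝ) (i : ℕ) : ℕ :=
  -- The default matters at `i = S.n`, where no window starts: the value `S.n` keeps `reach`
  -- monotone up to the end of the text and gives the starting value of the telescoping sums.
  if h : ∃ j, S.IsEnd θ i j then h.choose else S.n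

theorem isEnd_reach (hS : S.Sound) {θ : ℝ} {i : ℕ} (hi : i < S.n)
    (hθ : S.N * S.M.f 1 1 ≤ θ) : S.IsEnd θ i (S.reach θ i) := by
  have h := exists_isEnd hS hi hθ
  rw [reach, dif_pos h]
  exact h.choose_spec

theorem IsEnd.eq_reach (hS : S.Sound) {θ : ℝ} {i j : ℕ} (h : S.IsEnd θ i j) :
    j = S.reach θ i := by
  have h' : ∃ j, S.IsEnd θ i j := ⟨j, h⟩
  rw [reach, dif_pos h']
  exact le_antisymm (h.mono hS h'.choose_spec le_rfl le_rfl)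
    (h'.choose_spec.mono hS h le_rfl le_rfl)

end Setup

theorem run_extendProg_reach {S : Setup} (hS : S.Fits) (hV : S.Sound) {s : State} (hB : S.Base s)
    {i j : ℕ} (hC : S.Counts (cnt S.A i j) s) (hi : i < S.n) (hij : i ≤ j) (hj : j ≤ S.n)
    (h5 : s.ivar 5 = i) (h6 : s.ivar 6 = j) {θ : ℝ} (hθ : s.rvar 4 = θ)
    (hc : i < j → S.cost i j ≤ θ) (hF : S.N * S.M.f 1 1 ≤ θ) :
    Run S.M (extendProg S.N) s fun s' t => s'.ivar 6 = S.reach θ i ∧ j ≤ S.reach θ i ∧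
      S.Counts (cnt S.A i (S.reach θ i)) s' ∧ t ≤ 300 * (S.reach θ i - j) + 310 := by
  refine (run_extendProg hS hB hC hij hj h5 h6 hθ hc).conseq ?_
  rintro s' t - ⟨j', h1, h2, h3, h4, h7, h8, ht⟩
  -- An empty window cannot be final, since the first symbol alone already fits under `θ`.
  have hlt : i < j' := by
    by_contra hle
    have hji : j' = i := by omega
    subst hji
    have := h8 hi
    rw [hV.single hi] at this
    linarith
  obtain rfl := IsEnd.eq_reach hV ⟨hlt, h3, h7 hlt, h8⟩
  exact ⟨h1, h2, h4, ht⟩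

/-! ### Sweeping a window through a block -/

/-- Shrink the window `[var 5, var 6)` to `[var 5, var x)`. -/
def shrinkProg (x : ℕ) : Prog :=
  .loop (.ilt (.var x) (.var 6))
    (.setI 6 (.sub (.var 6) (.const 1)) ;; .setI 2 (.var 6) ;; removeProg)

/-- The syntactic condition `hx` only demands that the target variable `x` is not one that the loop
overwrites. -/
theorem run_shrinkProg {S : Setup} (hS : S.Fits) {s : State} (hB : S.Base s) {i j l x : ℕ}
    (hC : S.Counts (cnt S.A i j) s) (hx : (shrinkProg x).keepsI x = true) (hil : i ≤ l)
    (hlj : l ≤ j) (hj : j ≤ S.n) (h6 : s.ivar 6 = j) (hl : s.ivar x = l) :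
    Run S.M (shrinkProg x) s fun s' t => s'.ivar 6 = l ∧ S.Counts (cnt S.A i l) s' ∧
      t ≤ 100 * (j - l) + 10 := by
  have hw := hS.word
  refine (Run.loop (fun s' => ∃ j', s'.ivar 6 = j' ∧ l ≤ j' ∧ j' ≤ S.n ∧
      S.Counts (cnt S.A i j') s')
    (fun s' => 100 * (s'.ivar 6 - l)) ⟨j, h6, hlj, hj, hC⟩ ?_ ?_).conseq ?_
  · rintro s' ⟨j', h1, h2, h3, -⟩ hF
    simp [hF.ivar hx, hl, h1]; omega
  · rintro s' ⟨j', h1, h2, h3, hC'⟩ hF hb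
    simp only [BExpr.Holds, IExpr.eval, hF.ivar hx, hl, h1] at hb
    have hB' := hB.frame hF rfl
    obtain ⟨j', rfl⟩ : ∃ j'', j' = j'' + 1 := ⟨j' - 1, by omega⟩
    refine run_seq.2 (run_setI.2 ⟨by simp; omega, ?_⟩)
    refine run_seq.2 (run_setI.2 ⟨by simp; omega, ?_⟩)
    refine (run_removeRight (i := i) (j := j') hS ((hB'.setI _ _).setI _ _)
      ((hC'.setI _ _).setI _ _) (by omega) h3 (by simp [h1])).conseq fun s₁ t₁ hF₁ ⟨hC₁, ht₁⟩ => ?_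
    have e6 : s₁.ivar 6 = j' := by rw [hF₁.ivar rfl]; simp [h1]
    refine ⟨⟨j', e6, by omega, by omega, hC₁⟩, ?_⟩
    simp [h1, e6]
    omega
  · rintro s' t hF ⟨⟨j', h1, h2, h3, hC'⟩, hb, ht⟩
    simp only [BExpr.Holds, IExpr.eval, hF.ivar hx, hl, h1] at hb
    obtain rfl : j' = l := by omega
    refine ⟨h1, hC', ?_⟩
    simp [h1, h6] at ht
    omega

/-- Move the left end of the window `[var 5, var 6)` back to `var 8`. -/
def rewindProg : Prog :=
  .loop (.ilt (.var 8) (.var 5))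
    (.setI 5 (.sub (.var 5) (.const 1)) ;; .setI 2 (.var 5) ;; addProg)

theorem run_rewindProg {S : Setup} (hS : S.Fits) {s : State} (hB : S.Base s) {b i j : ℕ}
    (hC : S.Counts (cnt S.A i j) s) (hbi : b ≤ i) (hij : i ≤ j) (hj : j ≤ S.n)
    (h5 : s.ivar 5 = i) (h8 : s.ivar 8 = b) :
    Run S.M rewindProg s fun s' t => s'.ivar 5 = b ∧ S.Counts (cnt S.A b j) s' ∧
      t ≤ 100 * (i - b) + 10 := by
  have hw := hS.word
  refine (Run.loop (fun s' => ∃ i', s'.ivar 5 = i' ∧ b ≤ i' ∧ i' ≤ j ∧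
      S.Counts (cnt S.A i' j) s')
    (fun s' => 100 * (s'.ivar 5 - b)) ⟨i, h5, hbi, hij, hC⟩ ?_ ?_).conseq ?_
  · rintro s' ⟨i', h1, h2, h3, -⟩ hF
    have : s'.ivar 8 = b := by rw [hF.ivar rfl, h8]
    simp [this, h1]; omega
  · rintro s' ⟨i', h1, h2, h3, hC'⟩ hF hb
    have h8' : s'.ivar 8 = b := by rw [hF.ivar rfl, h8]
    simp only [BExpr.Holds, IExpr.eval, h8', h1] at hb
    have hB' := hB.frame hF rfl
    obtain ⟨i', rfl⟩ : ∃ i'', i' = i'' + 1 := ⟨i' - 1, by omega⟩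
    refine run_seq.2 (run_setI.2 ⟨by simp; omega, ?_⟩)
    refine run_seq.2 (run_setI.2 ⟨by simp; omega, ?_⟩)
    refine (run_addLeft (i := i') (j := j) hS ((hB'.setI _ _).setI _ _)
      ((hC'.setI _ _).setI _ _) h3 hj (by simp [h1])).conseq fun s₁ t₁ hF₁ ⟨hC₁, ht₁⟩ => ?_
    have e5 : s₁.ivar 5 = i' := by rw [hF₁.ivar rfl]; simp [h1]
    refine ⟨⟨i', e5, by omega, by omega, hC₁⟩, ?_⟩
    simp [h1, e5]
    omega
  · rintro s' t hF ⟨⟨i', h1, h2, h3, hC'⟩, hb, ht⟩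
    have h8' : s'.ivar 8 = b := by rw [hF.ivar rfl, h8]
    simp only [BExpr.Holds, IExpr.eval, h8', h1] at hb
    obtain rfl : i' = b := by omega
    refine ⟨h1, hC', ?_⟩
    simp [h1, h5] at ht
    omega

/-- The cell for the edge of `var 5` at threshold `var x`, in blocks of length `var 13` that start
at `var 8`. -/
def edgeCell (x : ℕ) : IExpr :=
  .add (.mul (.var x) (.var 13)) (.sub (.var 5) (.var 8))

/-- Move the left end of the window through the block `[var 8, var 9)` and record the maximal
windows for the threshold in real variable 4. -/
def slideProg (N : ℕ) : Prog :=
  .setI 5 (.var 8) ;;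
  .loop (.ilt (.var 5) (.var 9))
    (extendProg N ;; costProg N ;; .storeI 8 (edgeCell 10) (.var 6) ;;
      .storeR 1 (edgeCell 10) (.var 3) ;; .setI 2 (.var 5) ;; removeProg ;;
      .setI 5 (.add (.var 5) (.const 1)))

/-- The maximal window of `i` for threshold `k` is recorded at cell `x`. -/
def Setup.Recorded (S : Setup) (θ : ℝ) (i x : ℕ) (s : State) : Prop :=
  s.iarr 8 x = S.reach θ i ∧ s.rarr 1 x = S.cost i (S.reach θ i)

set_option maxHeartbeats 1000000 in
-- By `IsEnd.mono` both ends move only to the right, so the time is linear in the block length plus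
-- the distance covered by the right end. The cells below `k * B` stay untouched and keep the
-- records of the earlier thresholds. At the end the right end belongs to the last position `e - 1`
-- of the block, although the left end is already `e`.
theorem run_slideProg {S : Setup} (hS : S.Fits) (hV : S.Sound) {s : State} (hB : S.Base s)
    {b e j k B : ℕ} (hC : S.Counts (cnt S.A b j) s) (hbe : b < e) (he : e ≤ S.n)
    (heB : e - b ≤ B) (hkB : (k + 1) * B ≤ S.n) {θ : ℝ} (hθ : s.rvar 4 = θ)
    (hF : S.N * S.M.f 1 1 ≤ θ)
    (h6 : s.ivar 6 = j) (hj : j = S.reach θ b) (h8 : s.ivar 8 = b) (h9 : s.ivar 9 = e)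
    (h10 : s.ivar 10 = k) (h13 : s.ivar 13 = B) :
    Run S.M (slideProg S.N) s fun s' t => s'.ivar 6 = S.reach θ (e - 1) ∧ s'.ivar 5 = e ∧
      S.Counts (cnt S.A e (S.reach θ (e - 1))) s' ∧ e ≤ S.reach θ (e - 1) ∧
      j ≤ S.reach θ (e - 1) ∧
      (∀ i, b ≤ i → i < e → S.Recorded θ i (k * B + (i - b)) s') ∧
      (∀ x < k * B, s'.iarr 8 x = s.iarr 8 x ∧ s'.rarr 1 x = s.rarr 1 x) ∧
      t ≤ 600 * (e - b) + 300 * (S.reach θ (e - 1) - j) + 20 := by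
  have hw := hS.word
  have hsp := hS.space
  have hb : S.IsEnd θ b j := hj ▸ isEnd_reach hV (by omega) hF
  have hend : S.IsEnd θ (e - 1) (S.reach θ (e - 1)) := isEnd_reach hV (by omega) hF
  have hjend := hb.mono hV hend (by omega) le_rfl
  refine run_seq.2 (run_setI.2 ⟨by simp; omega, ?_⟩)
  refine (Run.loop (fun s' => ∃ i j', s'.ivar 5 = i ∧ s'.ivar 6 = j' ∧ b ≤ i ∧ i ≤ e ∧ i ≤ j' ∧
      j ≤ j' ∧ j' ≤ S.reach θ (e - 1) ∧ (i < j' → S.cost i j' ≤ θ) ∧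
      (i = e → j' = S.reach θ (e - 1)) ∧ S.Counts (cnt S.A i j') s' ∧
      (∀ p, b ≤ p → p < i → S.Recorded θ p (k * B + (p - b)) s') ∧
      (∀ x < k * B, s'.iarr 8 x = s.iarr 8 x ∧ s'.rarr 1 x = s.rarr 1 x))
    -- One account for each of the two pointers.
    (fun s' => 600 * (e - s'.ivar 5) + 300 * (S.n - s'.ivar 6)) ?_ ?_ ?_).conseq ?_
  · refine ⟨b, j, by simpa using h8, by simpa using h6, le_rfl, hbe.le, hb.lt.le, le_rfl, hjend,
      fun _ => hb.cost_le, fun h => by omega, hC.setI _ _, fun p h h' => by omega,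
      fun x _ => ⟨rfl, rfl⟩⟩
  · rintro s' ⟨i, j', h1, h2, h3, h4, -⟩ hF'
    have e9 : s'.ivar 9 = e := by rw [hF'.ivar rfl]; simpa using h9
    simp [h1, e9]
    omega
  · rintro s' ⟨i, j', h1, h2, h3, h4, h5, h7, h7', h11, -, hC', hR, hx⟩ hF' hlt
    have e9 : s'.ivar 9 = e := by rw [hF'.ivar rfl]; simpa using h9
    have e8 : s'.ivar 8 = b := by rw [hF'.ivar rfl]; simpa using h8
    have e10 : s'.ivar 10 = k := by rw [hF'.ivar rfl]; simpa using h10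
    have e13 : s'.ivar 13 = B := by rw [hF'.ivar rfl]; simpa using h13
    have e4 : s'.rvar 4 = θ := by rw [hF'.rvar rfl]; simpa using hθ
    have hB' : S.Base s' := (hB.setI _ _).frame hF' rfl
    simp only [BExpr.Holds, IExpr.eval, h1, e9] at hlt
    have hi : S.IsEnd θ i (S.reach θ i) := isEnd_reach hV (by omega) hF
    have hiend := hi.mono hV hend (by omega) le_rfl
    refine Run.seq (run_extendProg_reach hS hV hB' hC' (by omega) h5 (h7'.trans hend.le) h1 h2 e4
      h11 hF) ?_
    rintro s₁ t₁ hF₁ ⟨d6, hj', hC₁, ht₁⟩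
    have hB₁ := hB'.frame hF₁ rfl
    have d5 : s₁.ivar 5 = i := by rw [hF₁.ivar rfl, h1]
    refine Run.seq (run_costProg hS hB₁ hC₁ hi.lt.le hi.le d5 d6) ?_
    rintro s₂ t₂ hF₂ ⟨c3, ht₂⟩
    have hB₂ := hB₁.frame hF₂ rfl
    have hC₂ := hC₁.frame hF₂ rfl
    have c5 : s₂.ivar 5 = i := by rw [hF₂.ivar rfl, d5]
    have c6 : s₂.ivar 6 = S.reach θ i := by rw [hF₂.ivar rfl, d6]
    have c8 : s₂.ivar 8 = b := by rw [hF₂.ivar rfl, hF₁.ivar rfl, e8]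
    have c10 : s₂.ivar 10 = k := by rw [hF₂.ivar rfl, hF₁.ivar rfl, e10]
    have c13 : s₂.ivar 13 = B := by rw [hF₂.ivar rfl, hF₁.ivar rfl, e13]
    have cI : s₂.iarr 8 = s'.iarr 8 := by rw [hF₂.iarr rfl, hF₁.iarr rfl]
    have cR : s₂.rarr 1 = s'.rarr 1 := by rw [hF₂.rarr rfl, hF₁.rarr rfl]
    have hkB' : k * B + B ≤ S.n := by rw [← Nat.succ_mul]; exact hkB
    have hkk : k < S.M.word :=
      (Nat.le_mul_of_pos_right k (by omega : 0 < B)).trans_lt (by omega)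
    have hcell : (edgeCell 10).eval s₂ = k * B + (i - b) := by simp [edgeCell, c10, c13, c5, c8]
    have hcell' : (edgeCell 10).Ok S.M s₂ := by
      simp [edgeCell, c10, c13, c5, c8]
      have := hi.le
      omega
    have hcost : (edgeCell 10).cost = 7 := rfl
    refine run_seq.2 (run_storeI.2 ⟨hcell', by rw [hcell]; omega, by
      simp [c6]; have := hi.le; omega, ?_⟩)
    rw [hcell]
    generalize hs₃ : s₂.storeI 8 (k * B + (i - b)) (IExpr.eval s₂ (.var 6)) = s₃
    have hB₃ : S.Base s₃ := hs₃ ▸ hB₂.storeI _ _ _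
    have hC₃ := hs₃ ▸ hC₂.storeI 8 (k * B + (i - b)) (IExpr.eval s₂ (.var 6))
    have hcell₃ : (edgeCell 10).eval s₃ = k * B + (i - b) := by subst hs₃; exact hcell
    have hcell₃' : (edgeCell 10).Ok S.M s₃ := by subst hs₃; exact hcell'
    refine run_seq.2 (run_storeR.2 ⟨hcell₃', by rw [hcell₃]; omega, trivial, ?_⟩)
    rw [hcell₃]
    generalize hs₄ : s₃.storeR 1 (k * B + (i - b)) (RExpr.eval S.M s₃ (.var 3)) = s₄
    have hB₄ : S.Base s₄ := hs₄ ▸ hB₃.storeR _ _ _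
    have hC₄ := hs₄ ▸ hC₃.storeR 1 (k * B + (i - b)) (RExpr.eval S.M s₃ (.var 3))
    have b5 : s₄.ivar 5 = i := by subst hs₄ hs₃; simpa using c5
    have b6 : s₄.ivar 6 = S.reach θ i := by subst hs₄ hs₃; simpa using c6
    have bI : s₄.iarr 8 = Function.update (s'.iarr 8) (k * B + (i - b)) (S.reach θ i) := by
      subst hs₄ hs₃; simp [c6, cI]
    have bR : s₄.rarr 1 =
        Function.update (s'.rarr 1) (k * B + (i - b)) (S.cost i (S.reach θ i)) := by
      subst hs₄ hs₃; simp [c3, cR]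
    refine run_seq.2 (run_setI.2 ⟨by simp; omega, ?_⟩)
    refine Run.seq (run_removeLeft (i := i) (j := S.reach θ i) hS (hB₄.setI _ _) (hC₄.setI _ _)
      hi.lt hi.le (by simpa using b5)) ?_
    rintro s₅ t₅ hF₅ ⟨hC₅, ht₅⟩
    have a5 : s₅.ivar 5 = i := by rw [hF₅.ivar rfl]; simpa using b5
    have a6 : s₅.ivar 6 = S.reach θ i := by rw [hF₅.ivar rfl]; simpa using b6
    have aI := (hF₅.iarr (y := 8) rfl).trans bI
    have aR := (hF₅.rarr (y := 1) rfl).trans bR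
    refine run_setI.2 ⟨by simp; omega, ⟨i + 1, S.reach θ i, by simp [a5], by simpa using a6,
      by omega, hlt, hi.lt, by omega, hiend, fun h => ?_, fun h => ?_, hC₅.setI _ _, ?_, ?_⟩, ?_⟩
    -- Dropping the first symbol cannot raise the cost, so the next search may start from the
    -- present right end.
    · exact (hV.mono (by omega) h le_rfl hi.le).trans hi.cost_le
    · have : i = e - 1 := by omega
      rw [this]
    · intro p hp hp'
      rcases Nat.lt_succ_iff_lt_or_eq.1 hp' with hp' | rfl
      · obtain ⟨r1, r2⟩ := hR p hp hp'
        have hne : p - b ≠ i - b := by omega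
        constructor
        · simpa [aI, Function.update_apply, hne] using r1
        · simpa [aR, Function.update_apply, hne] using r2
      · constructor
        · simp [aI]
        · simp [aR]
    · intro x hxk
      have hne : x ≠ k * B + (i - b) := by omega
      simpa [aI, aR, Function.update_apply, hne] using hx x hxk
    · simp [a5, h1, h2, a6, hcost]
      have := hi.le
      omega
  · rintro s' t hF' ⟨⟨i, j', h1, h2, h3, h4, h5, h7, h7', -, h11, hC', hR, hx⟩, hlt, ht⟩
    have e9 : s'.ivar 9 = e := by rw [hF'.ivar rfl]; simpa using h9
    simp only [BExpr.Holds, IExpr.eval, h1, e9] at hlt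
    obtain rfl : i = e := by omega
    obtain rfl := h11 rfl
    refine ⟨h2, h1, hC', h5, h7, hR, hx, ?_⟩
    have := hend.le
    simp [h1, h2, h6, h8] at ht ⊢
    omega

/-! ### Geometric thresholds and the edges of a block -/

namespace Setup

/-- The thresholds: a geometric sequence, preceded by zero if single symbols cost nothing. -/
noncomputable def thr (S : Setup) : ℕ → ℝ
  | 0 => S.N * S.M.f 1 1
  | k + 1 => if S.thr k ≤ 0 then 1 else S.thr k * (1 + S.eps)

theorem thr_le_succ {S : Setup} (he : 0 < S.eps) (k : ℕ) : S.thr k ≤ S.thr (k + 1) := by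
  rw [thr]
  split
  · linarith
  · nlinarith

theorem thr_mono {S : Setup} (he : 0 < S.eps) : Monotone S.thr :=
  monotone_nat_of_le_succ (thr_le_succ he)

theorem single_le_thr {S : Setup} (he : 0 < S.eps) (k : ℕ) : S.N * S.M.f 1 1 ≤ S.thr k :=
  thr_mono he (Nat.zero_le k)

/-- A positive first threshold is at least one by `gap`, and a zero first threshold is followed by
one. The shift of the index by one pays for this possible zero; afterwards each step multiplies by
`1 + S.eps`. -/
theorem pow_le_thr_succ {S : Setup} (hV : S.Sound) (hn : 0 < S.n) (he : 0 < S.eps) (k : ℕ) :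
    (1 + S.eps) ^ k ≤ S.thr (k + 1) := by
  induction k with
  | zero =>
    rw [thr]
    split
    · simp
    · rename_i h
      rw [thr, ← hV.single hn] at h
      have := (hV.gap (Nat.zero_lt_succ 0) hn).resolve_left h
      rw [thr, ← hV.single hn]
      simp only [zero_add, pow_zero] at *
      nlinarith
  | succ k ih =>
    have h1 : 0 < (1 + S.eps) ^ k := by positivity
    rw [thr, if_neg (by linarith), pow_succ]
    exact mul_le_mul_of_nonneg_right ih (by linarith)

/-- The windows for the thresholds up to `k` approximate all windows of cost at most `thr k`. -/
theorem exists_reach {S : Setup} (hV : S.Sound) (he : 0 < S.eps) {i j : ℕ} (hij : i < j)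
    (hj : j ≤ S.n) (k : ℕ) (hc : S.cost i j ≤ S.thr k) :
    ∃ k' ≤ k, j ≤ S.reach (S.thr k') i ∧
      S.cost i (S.reach (S.thr k') i) ≤ (1 + S.eps) * S.cost i j := by
  have hle : ∀ k, S.cost i j ≤ S.thr k → j ≤ S.reach (S.thr k) i := by
    intro k hk
    have hr := isEnd_reach hV (by omega : i < S.n) (single_le_thr he k)
    by_contra hlt
    push Not at hlt
    have h1 := hr.lt_cost (by omega)
    have h2 := hV.mono (le_refl i) (by have := hr.lt; omega) hlt hj
    linarith
  have h0 := hV.nonneg hij hj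
  induction k with
  | zero =>
    have hr := isEnd_reach hV (by omega : i < S.n) (single_le_thr he 0)
    refine ⟨0, le_rfl, hle 0 hc, hr.cost_le.trans ?_⟩
    -- Every window contains a single symbol, so `thr 0` is a lower bound for its cost and no factor
    -- is lost.
    have h1 := hV.mono (le_refl i) (by omega : i < i + 1) hij hj
    rw [hV.single (by omega)] at h1
    rw [thr]
    nlinarith
  | succ k ih =>
    by_cases hk : S.cost i j ≤ S.thr k
    · obtain ⟨k', hk', h⟩ := ih hk
      exact ⟨k', by omega, h⟩
    · have hr := isEnd_reach hV (by omega : i < S.n) (single_le_thr he (k + 1))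
      refine ⟨k + 1, le_rfl, hle _ hc, hr.cost_le.trans ?_⟩
      push Not at hk
      rw [thr]
      split
      -- The threshold jumps from zero to one. No cost lies strictly between, so a window too
      -- expensive for `thr k` costs at least one.
      · have h1 := (hV.gap hij hj)
        rcases h1 with h1 | h1
        · rw [thr, if_pos ‹_›] at hc
          have h2 := single_le_thr he k
          have h3 := hV.mono (le_refl i) (by omega : i < i + 1) hij hj
          have h4 := hV.nonneg (by omega : i < i + 1) (by omega)
          rw [hV.single (by omega)] at h3 h4
          linarith
        · nlinarith
      · rw [mul_comm]
        exact mul_le_mul_of_nonneg_left hk.le (by linarith)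

end Setup

/-- Record the maximal windows of the block `[var 8, var 9)` for all thresholds; variable 10
becomes the number of thresholds. -/
def blockEdgesProg (N : ℕ) : Prog :=
  .setI 6 (.var 8) ;; .setI 10 (.const 0) ;; .setI 11 (.const 1) ;;
  .setR 4 (.mul (.ofNat (.const N)) (.overhead (.const 1) (.const 1))) ;;
  .loop (.ilt (.const 0) (.var 11))
    (.setI 5 (.var 8) ;; extendProg N ;; .setI 7 (.var 6) ;; slideProg N ;; rewindProg ;;
      shrinkProg 7 ;; .ite (.ieq (.var 6) (.var 0)) (.setI 11 (.const 0)) .skip ;;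
      .setI 10 (.add (.var 10) (.const 1)) ;;
      .ite (.rle (.var 4) (.ofNat (.const 0))) (.setR 4 (.ofNat (.const 1)))
        (.setR 4 (.mul (.var 4) (.add (.ofNat (.const 1)) (.var 0)))))

set_option maxHeartbeats 1000000 in
-- Thresholds increase, so the window anchored at `b` only grows, by at most `S.n` over all
-- thresholds. For each threshold it is slid through the block, rewound and shrunk back, at a cost
-- proportional to the block length plus the gain of `reach` between `b` and `e - 1`. The loop stops
-- as soon as the anchored window reaches the end of the text, at the latest with threshold `kk`,
-- which by `hkk` admits every window.
theorem run_blockEdgesProg {S : Setup} (hS : S.Fits) (hV : S.Sound) (heps : 0 < S.eps)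
    {s : State} (hB : S.Base s) {b e B kk : ℕ} (hC : S.Counts (cnt S.A b b) s)
    (hbe : b < e) (he : e ≤ S.n) (heB : e - b ≤ B) (hkB : (kk + 1) * B ≤ S.n)
    (hkk : ∀ i j, i < j → j ≤ S.n → S.cost i j ≤ S.thr kk)
    (h8 : s.ivar 8 = b) (h9 : s.ivar 9 = e) (h13 : s.ivar 13 = B) :
    Run S.M (blockEdgesProg S.N) s fun s' t => ∃ k, s'.ivar 10 = k + 1 ∧ k ≤ kk ∧
      S.reach (S.thr k) b = S.n ∧ s'.ivar 6 = S.n ∧ s'.ivar 5 = b ∧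
      S.Counts (cnt S.A b S.n) s' ∧
      (∀ k' ≤ k, ∀ i, b ≤ i → i < e → S.Recorded (S.thr k') i (k' * B + (i - b)) s') ∧
      t ≤ 2000 * ((kk + 1) * (e - b)) + 1000 * S.n +
        1000 * ∑ k ∈ Ico 0 (kk + 1), (S.reach (S.thr k) (e - 1) - S.reach (S.thr k) b) + 100 := by
  have hw := hS.word
  have hsp := hS.space
  have hsc := hS.scale
  have hBpos : 0 < B := by omega
  have hkn : kk + 1 ≤ S.n := (Nat.le_mul_of_pos_right _ hBpos).trans hkB
  have hend : ∀ k i, i < S.n → S.IsEnd (S.thr k) i (S.reach (S.thr k) i) :=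
    fun k i hi => isEnd_reach hV hi (single_le_thr heps k)
  refine run_seq.2 (run_setI.2 ⟨by simp; omega, ?_⟩)
  refine run_seq.2 (run_setI.2 ⟨by simp; omega, ?_⟩)
  refine run_seq.2 (run_setI.2 ⟨by simp; omega, ?_⟩)
  refine run_seq.2 (run_setR.2 ⟨by simp; omega, ?_⟩)
  refine (Run.loop (fun s' => ∃ k j, s'.ivar 10 = k ∧ s'.ivar 6 = j ∧ b ≤ j ∧ j ≤ S.n ∧
      s'.rvar 4 = S.thr k ∧ S.Counts (cnt S.A b j) s' ∧ s'.ivar 11 ≤ 1 ∧ k ≤ kk + 1 ∧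
      (s'.ivar 11 = 1 → k ≤ kk ∧ (b < j → S.cost b j ≤ S.thr k)) ∧
      (s'.ivar 11 = 0 → ∃ k', k = k' + 1 ∧ j = S.n ∧ S.reach (S.thr k') b = S.n ∧
        s'.ivar 5 = b) ∧
      (∀ k' < k, ∀ i, b ≤ i → i < e → S.Recorded (S.thr k') i (k' * B + (i - b)) s'))
    -- The terms pay for the moves of the left end, the fixed work per threshold, the growth of the
    -- anchored window, and the excursions of the right end.
    (fun s' => 1500 * ((kk + 1 - s'.ivar 10) * (e - b)) + 500 * (kk + 1 - s'.ivar 10) +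
      300 * (S.n - s'.ivar 6) + 400 * ∑ k ∈ Ico (s'.ivar 10) (kk + 1),
        (S.reach (S.thr k) (e - 1) - S.reach (S.thr k) b)) ?_ ?_ ?_).conseq ?_
  · refine ⟨0, b, by simp, by simpa using h8, le_rfl, by omega, by simp [thr],
      (((hC.setI _ _).setI _ _).setI _ _).setR _ _, by simp, by omega,
      fun _ => ⟨by omega, fun h => by omega⟩, by simp, fun k' h => by omega⟩
  · rintro s' ⟨k, j, h1, h2, h3, h4, h5, h6, h7, -⟩ -
    simp; omega
  · rintro s' ⟨k, j, h1, h2, h3, h4, h5, hC', h7, hk1, hgo, -, hR⟩ hF' hlt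
    simp only [BExpr.Holds, IExpr.eval] at hlt
    have e11 : s'.ivar 11 = 1 := by omega
    obtain ⟨hk, hcj⟩ := hgo e11
    have e8 : s'.ivar 8 = b := by rw [hF'.ivar rfl]; simpa using h8
    have e9 : s'.ivar 9 = e := by rw [hF'.ivar rfl]; simpa using h9
    have e13 : s'.ivar 13 = B := by rw [hF'.ivar rfl]; simpa using h13
    have hB' : S.Base s' := ((((hB.setI _ _).setI _ _).setI _ _).setR _ _).frame hF' rfl
    have hkB' : (k + 1) * B ≤ S.n := (Nat.mul_le_mul_right _ (by omega)).trans hkB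
    have hr := hend k b (by omega)
    have hr' := hend k (e - 1) (by omega)
    refine run_seq.2 (run_setI.2 ⟨by simp; omega, ?_⟩)
    refine Run.seq (run_extendProg_reach hS hV (hB'.setI _ _) (hC'.setI _ _) (by omega) h3 h4
      (by simpa using e8) (by simpa using h2) (by simpa using h5) hcj (single_le_thr heps k)) ?_
    rintro s₁ t₁ hF₁ ⟨d6, hjr, hC₁, ht₁⟩
    have hB₁ := (hB'.setI _ _).frame hF₁ rfl
    have d8 : s₁.ivar 8 = b := by rw [hF₁.ivar rfl]; simpa using e8
    have d9 : s₁.ivar 9 = e := by rw [hF₁.ivar rfl]; simpa using e9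
    have d10 : s₁.ivar 10 = k := by rw [hF₁.ivar rfl]; simpa using h1
    have d11 : s₁.ivar 11 = 1 := by rw [hF₁.ivar rfl]; simpa using e11
    have d13 : s₁.ivar 13 = B := by rw [hF₁.ivar rfl]; simpa using e13
    have d4 : s₁.rvar 4 = S.thr k := by rw [hF₁.rvar rfl]; simpa using h5
    have dI : s₁.iarr 8 = s'.iarr 8 := by rw [hF₁.iarr rfl]; simp
    have dR : s₁.rarr 1 = s'.rarr 1 := by rw [hF₁.rarr rfl]; simp
    refine run_seq.2 (run_setI.2 ⟨by simp; have := hr.le; omega, ?_⟩)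
    refine Run.seq (run_slideProg hS hV (hB₁.setI _ _) (hC₁.setI _ _) hbe he heB hkB'
      (by simpa using d4) (single_le_thr heps k) (by simpa using d6) rfl (by simpa using d8)
      (by simpa using d9) (by simpa using d10) (by simpa using d13)) ?_
    rintro s₂ t₂ hF₂ ⟨c6, c5, hC₂, her, hbr, hR₂, hx₂, ht₂⟩
    have hB₂ := (hB₁.setI _ _).frame hF₂ rfl
    have c8 : s₂.ivar 8 = b := by rw [hF₂.ivar rfl]; simpa using d8
    have c10 : s₂.ivar 10 = k := by rw [hF₂.ivar rfl]; simpa using d10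
    have c11 : s₂.ivar 11 = 1 := by rw [hF₂.ivar rfl]; simpa using d11
    have c7 : s₂.ivar 7 = S.reach (S.thr k) b := by rw [hF₂.ivar rfl]; simpa using d6
    have c4 : s₂.rvar 4 = S.thr k := by rw [hF₂.rvar rfl]; simpa using d4
    refine Run.seq (run_rewindProg hS hB₂ hC₂ hbe.le her hr'.le c5 c8) ?_
    rintro s₃ t₃ hF₃ ⟨b5, hC₃, ht₃⟩
    have hB₃ := hB₂.frame hF₃ rfl
    have b6 : s₃.ivar 6 = S.reach (S.thr k) (e - 1) := by rw [hF₃.ivar rfl, c6]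
    have b7 : s₃.ivar 7 = S.reach (S.thr k) b := by rw [hF₃.ivar rfl, c7]
    refine Run.seq (run_shrinkProg hS hB₃ hC₃ rfl hr.lt.le hbr hr'.le b6 b7) ?_
    rintro s₄ t₄ hF₄ ⟨a6, hC₄, ht₄⟩
    have hB₄ := hB₃.frame hF₄ rfl
    have a5 : s₄.ivar 5 = b := by rw [hF₄.ivar rfl, b5]
    have a10 : s₄.ivar 10 = k := by rw [hF₄.ivar rfl, hF₃.ivar rfl, c10]
    have a11 : s₄.ivar 11 = 1 := by rw [hF₄.ivar rfl, hF₃.ivar rfl, c11]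
    have a4 : s₄.rvar 4 = S.thr k := by rw [hF₄.rvar rfl, hF₃.rvar rfl, c4]
    have aI : s₄.iarr 8 = s₂.iarr 8 := by rw [hF₄.iarr rfl, hF₃.iarr rfl]
    have aR : s₄.rarr 1 = s₂.rarr 1 := by rw [hF₄.rarr rfl, hF₃.rarr rfl]
    have a0 := hB₄.len
    have a00 := hB₄.eps
    have hRec : ∀ k' < k + 1, ∀ i, b ≤ i → i < e →
        s₄.iarr 8 (k' * B + (i - b)) = S.reach (S.thr k') i ∧
        s₄.rarr 1 (k' * B + (i - b)) = S.cost i (S.reach (S.thr k') i) := by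
      intro k' hk' i hi hi'
      rw [aI, aR]
      rcases Nat.lt_succ_iff_lt_or_eq.1 hk' with hk' | rfl
      -- Rows of the edge table do not overlap because the block has at most `B` positions.
      · have hlt : k' * B + (i - b) < k * B := by
          have : (k' + 1) * B ≤ k * B := Nat.mul_le_mul_right _ hk'
          rw [Nat.succ_mul] at this
          omega
        obtain ⟨x1, x2⟩ := hx₂ _ hlt
        rw [x1, x2]
        simp only [iarr_setI, rarr_setI, dI, dR]
        exact hR k' hk' i hi hi'
      · exact hR₂ i hi hi'
    have htime : t₁ + t₂ + t₃ + t₄ ≤ 300 * (S.reach (S.thr k) b - j) + 700 * (e - b) +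
        400 * (S.reach (S.thr k) (e - 1) - S.reach (S.thr k) b) + 350 := by
      omega
    have hthr : S.thr (k + 1) = if S.thr k ≤ 0 then 1 else S.thr k * (1 + S.eps) := rfl
    -- If the anchored window stops short of the end, one symbol more costs over `thr k`, which is
    -- impossible for `k = kk`.
    have hcost' : S.reach (S.thr k) b < S.n → k + 1 ≤ kk := by
      intro h
      by_contra hc
      obtain rfl : k = kk := by omega
      have := hr.lt_cost h
      have := hkk b (S.reach (S.thr k) b + 1) (by have := hr.lt; omega) h
      linarith
    have hcost'' : S.cost b (S.reach (S.thr k) b) ≤ S.thr (k + 1) :=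
      hr.cost_le.trans (thr_le_succ heps k)
    have hpot : 1500 * ((kk + 1 - (k + 1)) * (e - b)) + 500 * (kk + 1 - (k + 1)) +
        300 * (S.n - S.reach (S.thr k) b) + 400 * ∑ k ∈ Ico (k + 1) (kk + 1),
          (S.reach (S.thr k) (e - 1) - S.reach (S.thr k) b) + (t₁ + t₂ + t₃ + t₄) + 100 ≤
        1500 * ((kk + 1 - k) * (e - b)) + 500 * (kk + 1 - k) +
        300 * (S.n - j) + 400 * ∑ k ∈ Ico k (kk + 1),
          (S.reach (S.thr k) (e - 1) - S.reach (S.thr k) b) := by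
      rw [sum_eq_sum_Ico_succ_bot (by omega : k < kk + 1)]
      obtain ⟨m, rfl⟩ : ∃ m, kk = k + m := ⟨kk - k, by omega⟩
      have q1 : k + m + 1 - (k + 1) = m := by omega
      have q2 : k + m + 1 - k = m + 1 := by omega
      have := hr.le
      have q3 : (m + 1) * (e - b) = m * (e - b) + (e - b) := Nat.succ_mul _ _
      rw [q1, q2, q3]
      omega
    -- The end of the loop body, treated once for both outcomes of the test for termination.
    have hfin : ∀ s₅ : State, s₅.ivar 10 = k → s₅.ivar 6 = S.reach (S.thr k) b →
        s₅.rvar 4 = S.thr k → S.Base s₅ → S.Counts (cnt S.A b (S.reach (S.thr k) b)) s₅ →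
        s₅.ivar 11 ≤ 1 → (s₅.ivar 11 = 0 ↔ S.reach (S.thr k) b = S.n) →
        s₅.iarr 8 = s₄.iarr 8 → s₅.rarr 1 = s₄.rarr 1 → s₅.ivar 5 = b → ∀ t₅ ≤ 10,
        Run S.M (.setI 10 (.add (.var 10) (.const 1)) ;;
          .ite (.rle (.var 4) (.ofNat (.const 0))) (.setR 4 (.ofNat (.const 1)))
            (.setR 4 (.mul (.var 4) (.add (.ofNat (.const 1)) (.var 0))))) s₅
          fun s' t => (∃ k j, s'.ivar 10 = k ∧ s'.ivar 6 = j ∧ b ≤ j ∧ j ≤ S.n ∧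
            s'.rvar 4 = S.thr k ∧ S.Counts (cnt S.A b j) s' ∧ s'.ivar 11 ≤ 1 ∧ k ≤ kk + 1 ∧
            (s'.ivar 11 = 1 → k ≤ kk ∧ (b < j → S.cost b j ≤ S.thr k)) ∧
            (s'.ivar 11 = 0 → ∃ k', k = k' + 1 ∧ j = S.n ∧ S.reach (S.thr k') b = S.n ∧
              s'.ivar 5 = b) ∧
            (∀ k' < k, ∀ i, b ≤ i → i < e →
              S.Recorded (S.thr k') i (k' * B + (i - b)) s')) ∧
            s'.ivar 10 = k + 1 ∧ s'.ivar 6 = S.reach (S.thr k) b ∧ t ≤ 30 := by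
      intro s₅ f10 f6 f4 fB fC f11 f11' fI fR f5 t₅ ht₅
      have f0 := fB.eps
      refine run_seq.2 (run_setI.2 ⟨by simp; omega, ?_⟩)
      refine run_ite.2 ⟨by simp; omega, fun hz => ?_, fun hz => ?_⟩
      · simp only [BExpr.Holds, RExpr.eval, IExpr.eval, rvar_setI, f4, Nat.cast_zero] at hz
        refine run_setR.2 ⟨by simp; omega, ⟨k + 1, _, by simp [f10], by simp [f6], hr.lt.le, hr.le,
          by simp [hthr, hz], (fC.setI _ _).setR _ _, by simpa using f11, by omega, fun h =>
          ⟨hcost' (by simp at h; have := hr.le; have := f11'.2; omega), fun _ => hcost''⟩,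
          fun h => ⟨k, rfl, ?_, ?_, ?_⟩, ?_⟩, ?_⟩
        · exact f11'.1 (by simpa using h)
        · exact f11'.1 (by simpa using h)
        · simpa using f5
        · simpa [Setup.Recorded, fI, fR] using hRec
        · simp [f10, f6]
      · simp only [BExpr.Holds, RExpr.eval, IExpr.eval, rvar_setI, f4, Nat.cast_zero] at hz
        refine run_setR.2 ⟨by simp; omega, ⟨k + 1, _, by simp [f10], by simp [f6], hr.lt.le, hr.le,
          by simp [hthr, hz, f4, f0], (fC.setI _ _).setR _ _, by simpa using f11, by omega, fun h =>
          ⟨hcost' (by simp at h; have := hr.le; have := f11'.2; omega), fun _ => hcost''⟩,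
          fun h => ⟨k, rfl, ?_, ?_, ?_⟩, ?_⟩, ?_⟩
        · exact f11'.1 (by simpa using h)
        · exact f11'.1 (by simpa using h)
        · simpa using f5
        · simpa [Setup.Recorded, fI, fR] using hRec
        · simp [f10, f6]
    refine run_seq.2 (run_ite.2 ⟨by simp; have := hr.le; omega, fun hz => ?_, fun hz => ?_⟩)
    · simp only [BExpr.Holds, IExpr.eval, a6, a0] at hz
      refine run_setI.2 ⟨by simp; omega, ?_⟩
      refine (hfin _ (by simpa using a10) (by simpa using a6) (by simpa using a4) (hB₄.setI _ _)
        (hC₄.setI _ _) (by simp) (by simpa using hz) rfl rfl (by simpa using a5) 0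
        (by omega)).conseq ?_
      rintro s₅ t₅ - ⟨hI, g10, g6, ht₅⟩
      refine ⟨hI, ?_⟩
      rw [g10, g6, h1, h2]
      simp only [IExpr.cost, BExpr.cost]
      omega
    · simp only [BExpr.Holds, IExpr.eval, a6, a0] at hz
      refine run_skip.2 ?_
      refine (hfin _ (by simpa using a10) (by simpa using a6) (by simpa using a4) hB₄
        hC₄ (by omega) (by simp [a11, hz]) rfl rfl a5 0 (by omega)).conseq ?_
      rintro s₅ t₅ - ⟨hI, g10, g6, ht₅⟩
      refine ⟨hI, ?_⟩
      rw [g10, g6, h1, h2]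
      simp only [IExpr.cost, BExpr.cost]
      omega
  · rintro s' t - ⟨⟨k, j, h1, h2, h3, h4, h5, hC', h7, hk1, -, hz, hR⟩, hlt, ht⟩
    simp only [BExpr.Holds, IExpr.eval] at hlt
    obtain ⟨k', rfl, rfl, hk', h5'⟩ := hz (by omega)
    refine ⟨k', h1, by omega, hk', h2, h5', hC', fun k'' h i => hR k'' (by omega) i, ?_⟩
    have q : kk + 1 ≤ (kk + 1) * (e - b) := Nat.le_mul_of_pos_right _ (by omega)
    simp [h1, h2] at ht ⊢
    omega

/-! ### Shortest paths from right to left -/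

namespace Setup

/-- From `m` on, `P` holds the costs of the partitions that the successors `X` describe, and these
are nearly optimal in each step. -/
structure Solved (S : Setup) (X : ℕ → ℕ) (P : ℕ → ℝ) (m : ℕ) : Prop where
  edge : ∀ i, m ≤ i → i < S.n → i < X i ∧ X i ≤ S.n ∧ P i = S.cost i (X i) + P (X i)
  approx : ∀ i j, m ≤ i → i < j → j ≤ S.n →
    ∃ j', j ≤ j' ∧ j' ≤ S.n ∧ P i ≤ (1 + S.eps) * S.cost i j + P j'
  last : P S.n = 0

/-- All positions after `i` are solved, and for `i` the edges to the positions in `R` have been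
tried. -/
structure Relaxing (S : Setup) (X : ℕ → ℕ) (P : ℕ → ℝ) (i : ℕ) (R : ℕ → Prop) : Prop where
  solved : S.Solved X P (i + 1)
  unset : ∀ p < i, X p = 0
  edge : X i ≠ 0 → i < X i ∧ X i ≤ S.n ∧ P i = S.cost i (X i) + P (X i)
  best : ∀ j, R j → X i ≠ 0 ∧ P i ≤ S.cost i j + P j

theorem Relaxing.start {S : Setup} {X : ℕ → ℕ} {P : ℕ → ℝ} {i : ℕ} (h : S.Solved X P (i + 1))
    (hu : ∀ p < i + 1, X p = 0) : S.Relaxing X P i fun _ => False :=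
  ⟨h, fun p hp => hu p (by omega), fun h => (h (hu i (by omega))).elim, fun _ h => h.elim⟩

theorem Relaxing.congr {S : Setup} {X : ℕ → ℕ} {P : ℕ → ℝ} {i : ℕ} {R R' : ℕ → Prop}
    (h : S.Relaxing X P i R) (hR : ∀ j, R' j → R j) : S.Relaxing X P i R' :=
  ⟨h.solved, h.unset, h.edge, fun j hj => h.best j (hR j hj)⟩

/-- It suffices that the edges tried at `i` dominate every edge from `i`, up to the factor `1 +
S.eps` and overshooting. -/
theorem Relaxing.finish {S : Setup} {X : ℕ → ℕ} {P : ℕ → ℝ} {i : ℕ} {R : ℕ → Prop}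
    (h : S.Relaxing X P i R) (hR : ∀ j, i < j → j ≤ S.n → ∃ j', j ≤ j' ∧ j' ≤ S.n ∧ R j' ∧
      S.cost i j' ≤ (1 + S.eps) * S.cost i j) (hi : i < S.n) : S.Solved X P i := by
  refine ⟨fun p hp hpn => ?_, fun p j hp hpj hj => ?_, h.solved.last⟩
  · rcases hp.eq_or_lt with rfl | hp
    -- The single-symbol edge is dominated by some tried edge, so a successor of `i` has been set.
    · obtain ⟨j', -, -, h1, -⟩ := hR (i + 1) (by omega) hi
      exact h.edge (h.best j' h1).1
    · exact h.solved.edge p hp hpn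
  · rcases hp.eq_or_lt with rfl | hp
    · obtain ⟨j', h1, h2, h3, h4⟩ := hR j hpj hj
      exact ⟨j', h1, h2, by linarith [(h.best j' h3).2]⟩
    · exact h.solved.approx p j hp hpj hj

/-- Only the entries at `i` change, and the solved positions lie beyond `i`. Zero is a safe mark for
a missing successor, since a successor of `i` exceeds `i`. -/
theorem Relaxing.update {S : Setup} {X : ℕ → ℕ} {P : ℕ → ℝ} {i j : ℕ} {R : ℕ → Prop}
    (h : S.Relaxing X P i R) (hi : i < j) (hj : j ≤ S.n)
    (hb : X i = 0 ∨ S.cost i j + P j < P i) :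
    S.Relaxing (Function.update X i j) (Function.update P i (S.cost i j + P j)) i
      fun j' => R j' ∨ j' = j := by
  have hP : ∀ p, i < p → Function.update P i (S.cost i j + P j) p = P p := fun p hp =>
    Function.update_of_ne (by omega) _ _
  have hX : ∀ p, i ≠ p → Function.update X i j p = X p := fun p hp =>
    Function.update_of_ne hp.symm _ _
  refine ⟨⟨fun p hp hpn => ?_, fun p q hp hpq hq => ?_, ?_⟩, fun p hp => ?_, fun _ => ?_,
    fun q hq => ?_⟩
  · obtain ⟨h1, h2, h3⟩ := h.solved.edge p hp hpn
    rw [hX p (by omega), hP p (by omega), hP _ (by omega)]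
    exact ⟨h1, h2, h3⟩
  · obtain ⟨j', h1, h2, h3⟩ := h.solved.approx p q hp hpq hq
    refine ⟨j', h1, h2, ?_⟩
    rw [hP p (by omega), hP _ (by omega)]
    exact h3
  · rw [hP _ (by omega)]
    exact h.solved.last
  · rw [hX p (by omega)]
    exact h.unset p hp
  · simp [hi, hj, hP j hi]
  · refine ⟨by simp; omega, ?_⟩
    rw [Function.update_self]
    rcases hq with hq | rfl
    · obtain ⟨h1, h2⟩ := h.best q hq
      rcases hb with hb | hb
      · exact (h1 hb).elim
      -- `R` is an arbitrary predicate, so the degenerate target `i`, whose stored cost has just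
      -- changed, has to be considered too.
      · by_cases hqi : q = i
        · subst hqi
          rw [Function.update_self]
          linarith
        · rw [Function.update_of_ne hqi]
          linarith
    · rw [hP _ hi]

theorem Relaxing.keep {S : Setup} {X : ℕ → ℕ} {P : ℕ → ℝ} {i j : ℕ} {R : ℕ → Prop}
    (h : S.Relaxing X P i R) (hX : X i ≠ 0) (hb : P i ≤ S.cost i j + P j) :
    S.Relaxing X P i fun j' => R j' ∨ j' = j :=
  ⟨h.solved, h.unset, h.edge, fun q hq => hq.elim (h.best q) fun e => e ▸ ⟨hX, hb⟩⟩

end Setup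

/-- Try the edge from `var 5` to `var 6`, whose cost is in real variable 3. -/
def relaxProg : Prog :=
  .setR 7 (.add (.var 3) (.cell 2 (.var 6))) ;;
  .ite (.and (.not (.ieq (.cell 9 (.var 5)) (.const 0))) (.rle (.cell 2 (.var 5)) (.var 7))) .skip
    (.storeI 9 (.var 5) (.var 6) ;; .storeR 2 (.var 5) (.var 7))

theorem run_relaxProg {S : Setup} (hS : S.Fits) {s : State} {i j : ℕ} {R : ℕ → Prop}
    (hR : S.Relaxing (s.iarr 9) (s.rarr 2) i R) (hij : i < j) (hj : j ≤ S.n)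
    (h5 : s.ivar 5 = i) (h6 : s.ivar 6 = j) (h3 : s.rvar 3 = S.cost i j) :
    Run S.M relaxProg s fun s' t =>
      S.Relaxing (s'.iarr 9) (s'.rarr 2) i (fun j' => R j' ∨ j' = j) ∧ t ≤ 50 := by
  have hw := hS.word
  have hsp := hS.space
  -- The test reads this cell, so its content has to stay below the word bound.
  have hX : s.iarr 9 i ≤ S.n := by
    by_cases h : s.iarr 9 i = 0
    · omega
    · exact (hR.edge h).2.1
  refine run_seq.2 (run_setR.2 ⟨by simp [h6]; omega, ?_⟩)
  refine run_ite.2 ⟨by simp [h5]; omega, fun hb => ?_, fun hb => ?_⟩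
  · simp [h5, h6, h3] at hb
    exact run_skip.2 ⟨hR.keep hb.1 hb.2, by simp⟩
  · simp [h5, h6, h3] at hb
    have := hR.update hij hj (by by_cases h : s.iarr 9 i = 0; exacts [.inl h, .inr (hb h)])
    simp [h5, h6, h3]
    refine ⟨by omega, by omega, by omega, by omega, by omega, by simpa using this⟩

/-- Solve the positions in the block `[var 8, var 9)`, from right to left. -/
def blockSolveProg : Prog :=
  .setI 5 (.var 9) ;;
  .loop (.ilt (.var 8) (.var 5))
    (.setI 5 (.sub (.var 5) (.const 1)) ;; .setI 16 (.const 0) ;;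
      .loop (.ilt (.var 16) (.var 10))
        (.setI 6 (.cell 8 (edgeCell 16)) ;; .setR 3 (.cell 1 (edgeCell 16)) ;; relaxProg ;;
          .setI 16 (.add (.var 16) (.const 1))))

set_option maxHeartbeats 1000000 in
-- Since the window `[b, S.n)` fits under `thr k`, so does every window that starts in the block.
-- Hence the recorded thresholds up to `k` dominate all edges from the block, even if larger
-- thresholds exist.
theorem run_blockSolveProg {S : Setup} (hS : S.Fits) (hV : S.Sound) (heps : 0 < S.eps)
    {s : State} {b e B k : ℕ} (hbe : b < e) (he : e ≤ S.n) (heB : e - b ≤ B)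
    (hkB : (k + 1) * B ≤ S.n) (hk : S.reach (S.thr k) b = S.n)
    (hR : ∀ k' ≤ k, ∀ i, b ≤ i → i < e → S.Recorded (S.thr k') i (k' * B + (i - b)) s)
    (hs : S.Solved (s.iarr 9) (s.rarr 2) e) (hu : ∀ p < e, s.iarr 9 p = 0)
    (h8 : s.ivar 8 = b) (h9 : s.ivar 9 = e) (h10 : s.ivar 10 = k + 1) (h13 : s.ivar 13 = B) :
    Run S.M blockSolveProg s fun s' t =>
      S.Solved (s'.iarr 9) (s'.rarr 2) b ∧ (∀ p < b, s'.iarr 9 p = 0) ∧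
      t ≤ 300 * ((k + 1) * (e - b)) + 10 := by
  have hw := hS.word
  have hsp := hS.space
  have hBpos : 0 < B := by omega
  have hkn : k + 1 ≤ S.n := (Nat.le_mul_of_pos_right _ hBpos).trans hkB
  have hend : ∀ k i, i < S.n → S.IsEnd (S.thr k) i (S.reach (S.thr k) i) :=
    fun k i hi => isEnd_reach hV hi (single_le_thr heps k)
  refine run_seq.2 (run_setI.2 ⟨by simp; omega, ?_⟩)
  refine (Run.loop (fun s' => ∃ i, s'.ivar 5 = i ∧ b ≤ i ∧ i ≤ e ∧
      S.Solved (s'.iarr 9) (s'.rarr 2) i ∧ ∀ p < i, s'.iarr 9 p = 0)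
    (fun s' => (s'.ivar 5 - b) * (100 * (k + 1) + 100)) ?_ ?_ ?_).conseq ?_
  · exact ⟨e, by simpa using h9, hbe.le, le_rfl, hs, hu⟩
  · rintro s' ⟨i, h1, h2, h3, -⟩ hF
    have e8 : s'.ivar 8 = b := by rw [hF.ivar rfl]; simpa using h8
    simp; omega
  · rintro s' ⟨i, h1, h2, h3, hs', hu'⟩ hF hlt
    have e8 : s'.ivar 8 = b := by rw [hF.ivar rfl]; simpa using h8
    have e10 : s'.ivar 10 = k + 1 := by rw [hF.ivar rfl]; simpa using h10
    have e13 : s'.ivar 13 = B := by rw [hF.ivar rfl]; simpa using h13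
    have eI : s'.iarr 8 = s.iarr 8 := hF.iarr rfl
    have eR : s'.rarr 1 = s.rarr 1 := hF.rarr rfl
    simp only [BExpr.Holds, IExpr.eval, h1, e8] at hlt
    obtain ⟨i, rfl⟩ : ∃ i', i = i' + 1 := ⟨i - 1, by omega⟩
    refine run_seq.2 (run_setI.2 ⟨by simp; omega, ?_⟩)
    refine run_seq.2 (run_setI.2 ⟨by simp; omega, ?_⟩)
    refine (Run.loop (fun s₁ => s₁.ivar 5 = i ∧ ∃ l, s₁.ivar 16 = l ∧ l ≤ k + 1 ∧
        S.Relaxing (s₁.iarr 9) (s₁.rarr 2) i fun j => ∃ k' < l, j = S.reach (S.thr k') i)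
      (fun s₁ => 100 * (k + 1 - s₁.ivar 16)) ⟨by simp [h1], 0, by simp, by omega, ?_⟩
      ?_ ?_).conseq ?_
    · simpa using Relaxing.start hs' hu'
    · rintro s₁ ⟨-, l, d1, d2, -⟩ hF₁
      have d10 : s₁.ivar 10 = k + 1 := by rw [hF₁.ivar rfl]; simpa using e10
      simp; omega
    · rintro s₁ ⟨d5, l, d1, d2, hX⟩ hF₁ hlt'
      have d10 : s₁.ivar 10 = k + 1 := by rw [hF₁.ivar rfl]; simpa using e10
      have d13 : s₁.ivar 13 = B := by rw [hF₁.ivar rfl]; simpa using e13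
      have d8 : s₁.ivar 8 = b := by rw [hF₁.ivar rfl]; simpa using e8
      have dI : s₁.iarr 8 = s.iarr 8 := by rw [hF₁.iarr rfl]; simpa using eI
      have dR : s₁.rarr 1 = s.rarr 1 := by rw [hF₁.rarr rfl]; simpa using eR
      simp only [BExpr.Holds, IExpr.eval, d1, d10] at hlt'
      have hlB : l * B + B ≤ S.n := by
        rw [← Nat.succ_mul]
        exact (Nat.mul_le_mul_right _ (by omega)).trans hkB
      obtain ⟨r1, r2⟩ := hR l (by omega) i (by omega) (by omega)
      have hr := hend l i (by omega)
      have hrn := hr.le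
      have hcell : ∀ s₂ : State, s₂.ivar = s₁.ivar ∨ (∃ v, s₂ = s₁.setI 6 v) →
          (edgeCell 16).eval s₂ = l * B + (i - b) ∧ (edgeCell 16).Ok S.M s₂ := by
        rintro s₂ (h | ⟨v, rfl⟩)
        · simp [edgeCell, h, d1, d13, d5, d8]; omega
        · simp [edgeCell, d1, d13, d5, d8]; omega
      have hcost : (edgeCell 16).cost = 7 := rfl
      obtain ⟨x1, x2⟩ := hcell s₁ (.inl rfl)
      refine run_seq.2 (run_setI.2 ⟨⟨x2, by rw [x1]; omega, by rw [x1, dI, r1]; omega⟩, ?_⟩)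
      have hv : (IExpr.cell 8 (edgeCell 16)).eval s₁ = S.reach (S.thr l) i := by
        rw [IExpr.eval, x1, dI, r1]
      rw [hv]
      obtain ⟨y1, y2⟩ := hcell (s₁.setI 6 (S.reach (S.thr l) i)) (.inr ⟨_, rfl⟩)
      refine run_seq.2 (run_setR.2 ⟨⟨y2, by rw [y1]; omega⟩, ?_⟩)
      refine Run.seq (run_relaxProg (i := i) (j := S.reach (S.thr l) i) hS hX hr.lt hr.le
        (by simpa using d5) (by simp) (by simp [y1, dR, r2])) ?_
      rintro s₂ t₂ hF₂ ⟨hX₂, ht₂⟩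
      have c16 : s₂.ivar 16 = l := by rw [hF₂.ivar rfl]; simpa using d1
      have c5 : s₂.ivar 5 = i := by rw [hF₂.ivar rfl]; simpa using d5
      refine run_setI.2 ⟨by simp; omega, ⟨by simpa using c5, l + 1, by simp [c16], by omega, ?_⟩,
        ?_⟩
      · refine hX₂.congr ?_
        rintro j ⟨k', hk', rfl⟩
        rcases Nat.lt_succ_iff_lt_or_eq.1 hk' with hk' | rfl
        · exact .inl ⟨k', hk', rfl⟩
        · exact .inr rfl
      · simp [c16, d1, hcost]
        omega
    · rintro s₁ t₁ hF₁ ⟨⟨d5, l, d1, d2, hX⟩, hlt', ht₁⟩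
      have d10 : s₁.ivar 10 = k + 1 := by rw [hF₁.ivar rfl]; simpa using e10
      simp only [BExpr.Holds, IExpr.eval, d1, d10] at hlt'
      obtain rfl : l = k + 1 := by omega
      refine ⟨⟨i, d5, by omega, by omega, hX.finish (fun j hj hj' => ?_) (by omega), hX.unset⟩, ?_⟩
      · have hr := hend k b (by omega)
        -- Monotonicity, as `[i, j)` lies inside `[b, S.n)`.
        have hc : S.cost i j ≤ S.thr k :=
          (hV.mono (by omega : b ≤ i) hj (hk ▸ hj') hr.le).trans hr.cost_le
        obtain ⟨k', hk', h4, h5⟩ := exists_reach hV heps hj hj' k hc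
        exact ⟨_, h4, (hend k' i (by omega)).le, ⟨k', by omega, rfl⟩, h5⟩
      · have q : i + 1 - b = (i - b) + 1 := by omega
        have q' : (i - b + 1) * (100 * (k + 1) + 100) =
          (i - b) * (100 * (k + 1) + 100) + (100 * (k + 1) + 100) := Nat.succ_mul _ _
        simp only [d5, h1, q, q', IExpr.cost, BExpr.cost]
        simp [d1] at ht₁
        omega
  · rintro s' t hF ⟨⟨i, h1, h2, h3, hs', hu'⟩, hlt, ht⟩
    have e8 : s'.ivar 8 = b := by rw [hF.ivar rfl]; simpa using h8
    simp only [BExpr.Holds, IExpr.eval, h1, e8] at hlt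
    obtain rfl : i = b := by omega
    refine ⟨hs', hu', ?_⟩
    simp [h1, h9] at ht ⊢
    have : (e - i) * (100 * (k + 1) + 100) ≤ 200 * ((k + 1) * (e - i)) := by
      nlinarith [Nat.zero_le (k * (e - i))]
    omega

/-! ### Assembling the blocks -/

/-- Solve the text block by block, from right to left; the block length is in variable 13. -/
def blocksProg (N : ℕ) : Prog :=
  .setI 8 (.var 0) ;;
  .loop (.ilt (.const 0) (.var 8))
    (.setI 9 (.var 8) ;; .setI 8 (.sub (.var 8) (.var 13)) ;; blockEdgesProg N ;; shrinkProg 8 ;;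
      blockSolveProg)

/-- All empty windows have the same counts, so the count array can be handed from one block to the
next. -/
theorem cnt_self_eq (A : ℕ → ℕ) (i j : ℕ) : cnt A i i = cnt A j j := by
  funext c
  rw [cnt_self, cnt_self]

theorem Setup.reach_len (S : Setup) (θ : ℝ) : S.reach θ S.n = S.n := by
  rw [reach, dif_neg]
  rintro ⟨j, h⟩
  have := h.lt
  have := h.le
  omega

set_option maxHeartbeats 1000000 in
-- Each block costs `O(S.n)` apart from the excursions of the right end. For a fixed threshold these
-- sum to at most `S.n` over all blocks, because `reach` is monotone in the left end.
theorem run_blocksProg {S : Setup} (hS : S.Fits) (hV : S.Sound) (heps : 0 < S.eps)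
    {s : State} (hB : S.Base s) {B kk : ℕ} (hC : S.Counts (cnt S.A 0 0) s) (hBpos : 0 < B)
    (hkB : (kk + 1) * B ≤ S.n)
    (hkk : ∀ i j, i < j → j ≤ S.n → S.cost i j ≤ S.thr kk)
    (hX : ∀ p, s.iarr 9 p = 0) (hP : s.rarr 2 S.n = 0) (h13 : s.ivar 13 = B) :
    Run S.M (blocksProg S.N) s fun s' t =>
      S.Solved (s'.iarr 9) (s'.rarr 2) 0 ∧
      t ≤ 4000 * (S.n * ((S.n + B - 1) / B)) + 1000 * ((kk + 1) * S.n) + 10 := by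
  have hw := hS.word
  have hsp := hS.space
  have hpos := hS.pos
  have hend : ∀ k i, i < S.n → S.IsEnd (S.thr k) i (S.reach (S.thr k) i) :=
    fun k i hi => isEnd_reach hV hi (single_le_thr heps k)
  have hBn : B ≤ S.n := (Nat.le_mul_of_pos_left B (Nat.succ_pos kk)).trans hkB
  refine run_seq.2 (run_setI.2 ⟨by simp [hB.len]; omega, ?_⟩)
  refine (Run.loop (fun s' => ∃ e, s'.ivar 8 = e ∧ e ≤ S.n ∧ S.Counts (cnt S.A 0 0) s' ∧
      S.Solved (s'.iarr 9) (s'.rarr 2) e ∧ ∀ p < e, s'.iarr 9 p = 0)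
    -- A linear budget for each remaining block, rounding their number up, and the current values of
    -- `reach`, whose decrease pays for the excursions.
    (fun s' => 4000 * (S.n * ((s'.ivar 8 + B - 1) / B)) +
      1000 * ∑ k ∈ Ico 0 (kk + 1), S.reach (S.thr k) (s'.ivar 8))
    ⟨S.n, by simp [hB.len], le_rfl, hC.setI _ _,
      ⟨fun i h h' => by omega, fun i j h h' h'' => by omega, hP⟩, fun p _ => hX p⟩ ?_ ?_).conseq ?_
  · rintro s' ⟨e, h1, h2, -⟩ -
    simp; omega
  · rintro s' ⟨e, h1, h2, hC', hs', hu'⟩ hF hlt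
    simp only [BExpr.Holds, IExpr.eval, h1] at hlt
    have e13 : s'.ivar 13 = B := by rw [hF.ivar rfl]; simpa using h13
    have hB' : S.Base s' := (hB.setI _ _).frame hF rfl
    refine run_seq.2 (run_setI.2 ⟨by simp; omega, ?_⟩)
    refine run_seq.2 (run_setI.2 ⟨by simp; omega, ?_⟩)
    refine Run.seq (run_blockEdgesProg (b := e - B) (e := e) hS hV heps
      ((hB'.setI _ _).setI _ _) (by rw [cnt_self_eq _ _ 0]; exact (hC'.setI _ _).setI _ _)
      (by omega) h2 (by omega) hkB hkk (by simp [h1, e13]) (by simp [h1])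
      (by simpa using e13)) ?_
    rintro s₁ t₁ hF₁ ⟨k, d10, hk, hreach, d6, d5, hC₁, hR₁, ht₁⟩
    have hB₁ := ((hB'.setI _ _).setI _ _).frame hF₁ rfl
    have d8 : s₁.ivar 8 = e - B := by rw [hF₁.ivar rfl]; simp [h1, e13]
    have d9 : s₁.ivar 9 = e := by rw [hF₁.ivar rfl]; simp [h1]
    have d13 : s₁.ivar 13 = B := by rw [hF₁.ivar rfl]; simpa using e13
    refine Run.seq (run_shrinkProg (i := e - B) (l := e - B) hS hB₁ hC₁ rfl le_rfl (by omega)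
      le_rfl d6 d8) ?_
    rintro s₂ t₂ hF₂ ⟨c6, hC₂, ht₂⟩
    refine (run_blockSolveProg (e := e) hS hV heps (by omega) h2 (by omega)
      ((Nat.mul_le_mul_right _ (by omega)).trans hkB) hreach
      ?_ ?_ ?_ ((hF₂.ivar rfl).trans d8) ((hF₂.ivar rfl).trans d9) ((hF₂.ivar rfl).trans d10)
      ((hF₂.ivar rfl).trans d13)).conseq ?_
    · intro k' hk' i hi hi'
      have := hR₁ k' hk' i hi hi'
      rw [Setup.Recorded] at this ⊢
      rwa [hF₂.iarr rfl, hF₂.rarr rfl]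
    · rw [hF₂.iarr rfl, hF₂.rarr rfl, hF₁.iarr rfl, hF₁.rarr rfl]
      exact hs'
    · rw [hF₂.iarr rfl, hF₁.iarr rfl]
      exact hu'
    rintro s₃ t₃ hF₃ ⟨hs₃, hu₃, ht₃⟩
    have b8 : s₃.ivar 8 = e - B := by rw [hF₃.ivar rfl, hF₂.ivar rfl, d8]
    refine ⟨⟨e - B, b8, by omega, ?_, hs₃, hu₃⟩, ?_⟩
    · rw [cnt_self_eq _ 0 (e - B)]
      exact hC₂.frame hF₃ rfl
    · have hq : (kk + 1) * (e - (e - B)) ≤ S.n :=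
        (Nat.mul_le_mul_left _ (by omega)).trans hkB
      have hq' : (k + 1) * (e - (e - B)) ≤ S.n :=
        (Nat.mul_le_mul_right _ (by omega)).trans hq
      -- The telescoping step: the gain inside the block is at most the drop of `reach` from `e` to
      -- `e - B`. At the right border of the text the default value of `reach` enters.
      have hsum : ∑ k ∈ Ico 0 (kk + 1), (S.reach (S.thr k) (e - 1) - S.reach (S.thr k) (e - B)) +
          ∑ k ∈ Ico 0 (kk + 1), S.reach (S.thr k) (e - B) ≤
          ∑ k ∈ Ico 0 (kk + 1), S.reach (S.thr k) e := by
        rw [← sum_add_distrib]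
        refine sum_le_sum fun k _ => ?_
        have r1 := hend k (e - 1) (by omega)
        have r2 := hend k (e - B) (by omega)
        have r3 := r2.mono hV r1 (by omega) le_rfl
        have r4 : S.reach (S.thr k) (e - 1) ≤ S.reach (S.thr k) e := by
          rcases h2.eq_or_lt with rfl | h2
          · rw [reach_len]
            exact r1.le
          · exact r1.mono hV (hend k e h2) (by omega) le_rfl
        omega
      -- The rounded-up number of blocks drops by at least one, also when truncated subtraction
      -- makes the leftmost block shorter.
      have hdiv : (e - B + B - 1) / B + 1 ≤ (e + B - 1) / B := by
        rw [Nat.le_div_iff_mul_le hBpos, Nat.succ_mul]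
        by_cases hc : e < B
        · rw [Nat.div_eq_of_lt (by omega)]
          omega
        · have := Nat.div_mul_le_self (e - B + B - 1) B
          omega
      have hdiv' := Nat.mul_le_mul_left S.n hdiv
      rw [Nat.mul_succ] at hdiv'
      simp only [b8, h1, IExpr.cost, BExpr.cost]
      omega
  · rintro s' t hF ⟨⟨e, h1, h2, hC', hs', hu'⟩, hlt, ht⟩
    simp only [BExpr.Holds, IExpr.eval, h1] at hlt
    obtain rfl : e = 0 := by omega
    refine ⟨hs', ?_⟩
    simp [hB.len, reach_len] at ht ⊢
    have : ∑ k ∈ range (kk + 1), S.reach (S.thr k) S.n = (kk + 1) * S.n := by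
      simp [reach_len]
    omega

/-! ### Exhaustive search when there are too many thresholds -/

/-- Solve the text by trying all edges. -/
def exactProg (N : ℕ) : Prog :=
  .setI 5 (.var 0) ;;
  .loop (.ilt (.const 0) (.var 5))
    (.setI 5 (.sub (.var 5) (.const 1)) ;; .setI 6 (.var 5) ;;
      .loop (.ilt (.var 6) (.var 0))
        (.setI 2 (.var 6) ;; addProg ;; .setI 6 (.add (.var 6) (.const 1)) ;; costProg N ;;
          relaxProg) ;;
      shrinkProg 5)

set_option maxHeartbeats 1000000 in
-- For each left end the window grows to the end of the text and shrinks back, with constant work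
-- per step, so the time is quadratic and no edge has to be stored.
theorem run_exactProg {S : Setup} (hS : S.Fits) (hV : S.Sound) (heps : 0 < S.eps)
    {s : State} (hB : S.Base s) (hC : S.Counts (cnt S.A 0 0) s)
    (hX : ∀ p, s.iarr 9 p = 0) (hP : s.rarr 2 S.n = 0) :
    Run S.M (exactProg S.N) s fun s' t =>
      S.Solved (s'.iarr 9) (s'.rarr 2) 0 ∧ t ≤ 1000 * (S.n * S.n) + 10 := by
  have hw := hS.word
  have hsp := hS.space
  have hpos := hS.pos
  refine run_seq.2 (run_setI.2 ⟨by simp [hB.len]; omega, ?_⟩)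
  refine (Run.loop (fun s' => ∃ e, s'.ivar 5 = e ∧ e ≤ S.n ∧ S.Counts (cnt S.A 0 0) s' ∧
      S.Solved (s'.iarr 9) (s'.rarr 2) e ∧ ∀ p < e, s'.iarr 9 p = 0)
    (fun s' => s'.ivar 5 * (500 * S.n + 100))
    ⟨S.n, by simp [hB.len], le_rfl, hC.setI _ _,
      ⟨fun i h h' => by omega, fun i j h h' h'' => by omega, hP⟩, fun p _ => hX p⟩ ?_ ?_).conseq ?_
  · rintro s' ⟨e, h1, h2, -⟩ -
    simp; omega
  · rintro s' ⟨i, h1, h2, hC', hs', hu'⟩ hF hlt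
    simp only [BExpr.Holds, IExpr.eval, h1] at hlt
    obtain ⟨i, rfl⟩ : ∃ i', i = i' + 1 := ⟨i - 1, by omega⟩
    have hB' : S.Base s' := (hB.setI _ _).frame hF rfl
    refine run_seq.2 (run_setI.2 ⟨by simp; omega, ?_⟩)
    refine run_seq.2 (run_setI.2 ⟨by simp; omega, ?_⟩)
    refine Run.seq (Run.loop (fun s₁ => s₁.ivar 5 = i ∧ ∃ j, s₁.ivar 6 = j ∧ i ≤ j ∧ j ≤ S.n ∧
        S.Counts (cnt S.A i j) s₁ ∧
        S.Relaxing (s₁.iarr 9) (s₁.rarr 2) i fun j' => i < j' ∧ j' ≤ j)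
      (fun s₁ => 300 * (S.n - s₁.ivar 6)) ⟨by simp [h1], i, by simp [h1], le_rfl, by omega,
        by rw [cnt_self_eq _ _ 0]; exact (hC'.setI _ _).setI _ _, ?_⟩ ?_ ?_) ?_
    · exact (Relaxing.start hs' hu').congr fun j hj => by omega
    · rintro s₁ ⟨-, j, d6, d, d', -⟩ hF₁
      have d0 := (((hB'.setI _ _).setI _ _).frame hF₁ rfl : S.Base s₁).len
      simp; omega
    · rintro s₁ ⟨d5, j, d6, d, d', hC₁, hX₁⟩ hF₁ hlt'
      have hB₁ : S.Base s₁ := ((hB'.setI _ _).setI _ _).frame hF₁ rfl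
      simp only [BExpr.Holds, IExpr.eval, d6, hB₁.len] at hlt'
      refine run_seq.2 (run_setI.2 ⟨by simp; omega, ?_⟩)
      refine Run.seq (run_addRight hS (hB₁.setI _ _) (hC₁.setI _ _) d hlt' (by simpa using d6)) ?_
      rintro s₂ t₂ hF₂ ⟨hC₂, ht₂⟩
      have hB₂ := (hB₁.setI _ _).frame hF₂ rfl
      have c5 : s₂.ivar 5 = i := by rw [hF₂.ivar rfl]; simpa using d5
      have c6 : s₂.ivar 6 = j := by rw [hF₂.ivar rfl]; simpa using d6
      refine run_seq.2 (run_setI.2 ⟨by simp; omega, ?_⟩)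
      refine Run.seq (run_costProg (i := i) (j := j + 1) hS (hB₂.setI _ _) (hC₂.setI _ _)
        (by omega) hlt' (by simpa using c5) (by simp [c6])) ?_
      rintro s₃ t₃ hF₃ ⟨b3, ht₃⟩
      have b5 : s₃.ivar 5 = i := by rw [hF₃.ivar rfl]; simpa using c5
      have b6 : s₃.ivar 6 = j + 1 := by rw [hF₃.ivar rfl]; simp [c6]
      have bX : s₃.iarr 9 = s₁.iarr 9 := by rw [hF₃.iarr rfl, iarr_setI, hF₂.iarr rfl, iarr_setI]
      have bP : s₃.rarr 2 = s₁.rarr 2 := by rw [hF₃.rarr rfl, rarr_setI, hF₂.rarr rfl, rarr_setI]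
      refine (run_relaxProg hS (R := fun j' => i < j' ∧ j' ≤ j) (bX ▸ bP ▸ hX₁)
        (by omega : i < j + 1) hlt' b5 b6 b3).conseq ?_
      rintro s₄ t₄ hF₄ ⟨hX₄, ht₄⟩
      have a5 : s₄.ivar 5 = i := by rw [hF₄.ivar rfl, b5]
      have a6 : s₄.ivar 6 = j + 1 := by rw [hF₄.ivar rfl, b6]
      refine ⟨⟨a5, j + 1, a6, by omega, hlt', ((hC₂.setI _ _).frame hF₃ rfl).frame hF₄ rfl, ?_⟩,
        ?_⟩
      · exact hX₄.congr fun j' hj' => by omega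
      · simp only [a6, d6, IExpr.cost, BExpr.cost]
        omega
    rintro s₁ t₁ hF₁ ⟨⟨d5, j, d6, d, d', hC₁, hX₁⟩, hlt', ht₁⟩
    have hB₁ : S.Base s₁ := ((hB'.setI _ _).setI _ _).frame hF₁ rfl
    simp only [BExpr.Holds, IExpr.eval, d6, hB₁.len] at hlt'
    obtain rfl : j = S.n := by omega
    refine (run_shrinkProg hS hB₁ hC₁ rfl le_rfl d le_rfl d6 d5).conseq ?_
    rintro s₂ t₂ hF₂ ⟨c6, hC₂, ht₂⟩
    have c5 : s₂.ivar 5 = i := by rw [hF₂.ivar rfl, d5]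
    refine ⟨⟨i, c5, by omega, by rw [cnt_self_eq _ 0 i]; exact hC₂, ?_⟩, ?_⟩
    · rw [hF₂.iarr rfl, hF₂.rarr rfl]
      -- Every edge was tried, so it dominates itself; the factor `1 + S.eps` is not needed but does
      -- no harm.
      refine ⟨hX₁.finish (fun j hj hj' => ⟨j, le_rfl, hj', ⟨hj, hj'⟩, ?_⟩) (by omega), hX₁.unset⟩
      nlinarith [hV.nonneg hj hj']
    · have q : (i + 1) * (500 * S.n + 100) = i * (500 * S.n + 100) + (500 * S.n + 100) :=
        Nat.succ_mul _ _
      simp [d6, h1] at ht₁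
      simp only [c5, h1, IExpr.cost, BExpr.cost, q]
      omega
  · rintro s' t hF ⟨⟨e, h1, h2, hC', hs', hu'⟩, hlt, ht⟩
    simp only [BExpr.Holds, IExpr.eval, h1] at hlt
    obtain rfl : e = 0 := by omega
    refine ⟨hs', ?_⟩
    simp [hB.len, h1] at ht ⊢
    nlinarith

/-! ### Renaming the symbols -/

/-- One more than the last position before `m` with symbol `a`, and `0` if there is none. -/
def lastBefore (A : ℕ → ℕ) (a : ℕ) : ℕ → ℕ
  | 0 => 0
  | m + 1 => if A m = a then m + 1 else lastBefore A a m

theorem lastBefore_le (A : ℕ → ℕ) (a m : ℕ) : lastBefore A a m ≤ m := by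
  induction m with
  | zero => exact le_rfl
  | succ m ih => rw [lastBefore]; split <;> omega

theorem lastBefore_spec (A : ℕ → ℕ) (a m : ℕ) :
    (∀ p, lastBefore A a m ≤ p → p < m → A p ≠ a) ∧
      ∀ p, lastBefore A a m = p + 1 → A p = a := by
  induction m with
  | zero => exact ⟨fun p _ h => by omega, fun p h => by simp [lastBefore] at h⟩
  | succ m ih =>
    rw [lastBefore]
    split
    · refine ⟨fun p h h' => by omega, fun p h => ?_⟩
      obtain rfl : m = p := by omega
      assumption
    · refine ⟨fun p h h' => ?_, ih.2⟩
      rcases Nat.lt_succ_iff_lt_or_eq.1 h' with h' | rfl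
      · exact ih.1 p h h'
      · assumption

theorem cnt_mono_right (A : ℕ → ℕ) (i c : ℕ) {j j' : ℕ} (h : j ≤ j') :
    cnt A i j c ≤ cnt A i j' c :=
  sum_le_sum_of_subset (Ico_subset_Ico_right h)

/-- The size of the machine that the renaming needs. -/
structure Roomy (M : Machine) (n : ℕ) : Prop where
  pos : 0 < n
  word : 4 * n + 4 < M.word
  space : 2 * n ≤ M.space

/-- Clear the heads of the lists. -/
def clearHeadsProg : Prog :=
  .setI 5 (.const 0) ;;
  .loop (.ilt (.var 5) (.var 0))
    (.storeI 3 (.var 5) (.const 0) ;; .setI 5 (.add (.var 5) (.const 1)))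

theorem run_clearHeadsProg {M : Machine} {n : ℕ} (hM : Roomy M n) {s : State}
    (h0 : s.ivar 0 = n) :
    Run M clearHeadsProg s fun s' t => (∀ a < n, s'.iarr 3 a = 0) ∧ t ≤ 20 * n + 10 := by
  have hp := hM.pos
  have hw := hM.word
  have hsp := hM.space
  refine run_seq.2 (run_setI.2 ⟨by simp; omega, ?_⟩)
  refine (Run.loop (fun s' => ∃ m, s'.ivar 5 = m ∧ m ≤ n ∧ ∀ a < m, s'.iarr 3 a = 0)
    (fun s' => 20 * (n - s'.ivar 5)) ⟨0, by simp⟩ ?_ ?_).conseq ?_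
  · rintro s' ⟨m, h1, h2, -⟩ hF
    have e0 : s'.ivar 0 = n := by rw [hF.ivar rfl]; simpa using h0
    simp; omega
  · rintro s' ⟨m, h1, h2, h3⟩ hF hb
    have e0 : s'.ivar 0 = n := by rw [hF.ivar rfl]; simpa using h0
    simp [h1, e0] at hb ⊢
    refine ⟨by omega, by omega, by omega, by omega, ⟨hb, fun a ha => ?_⟩, by omega⟩
    rw [Function.update_apply]
    split
    · rfl
    · exact h3 a (by omega)
  · rintro s' t hF ⟨⟨m, h1, h2, h3⟩, hb, ht⟩
    have e0 : s'.ivar 0 = n := by rw [hF.ivar rfl]; simpa using h0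
    simp [h1, e0] at hb ht ⊢
    obtain rfl : m = n := by omega
    exact ⟨h3, by omega⟩

/-- Link the positions that carry the same symbol into lists. -/
def linkProg : Prog :=
  .setI 5 (.const 0) ;;
  .loop (.ilt (.var 5) (.var 0))
    (.storeI 4 (.var 5) (.cell 3 (.cell 2 (.var 5))) ;;
      .storeI 3 (.cell 2 (.var 5)) (.add (.var 5) (.const 1)) ;;
      .setI 5 (.add (.var 5) (.const 1)))

/-- Array 3 holds the heads and array 4 the links of the lists. Positions are stored shifted by one,
so that zero can mark the end of a list. -/
theorem run_linkProg {M : Machine} {n : ℕ} (hM : Roomy M n) {s : State}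
    (h0 : s.ivar 0 = n) (hA : ∀ p < n, s.iarr 2 p < n) (hH : ∀ a < n, s.iarr 3 a = 0) :
    Run M linkProg s fun s' t => (∀ a < n, s'.iarr 3 a = lastBefore (s.iarr 2) a n) ∧
      (∀ p < n, s'.iarr 4 p = lastBefore (s.iarr 2) (s.iarr 2 p) p) ∧ t ≤ 30 * n + 10 := by
  have hp := hM.pos
  have hw := hM.word
  have hsp := hM.space
  refine run_seq.2 (run_setI.2 ⟨by simp; omega, ?_⟩)
  refine (Run.loop (fun s' => ∃ m, s'.ivar 5 = m ∧ m ≤ n ∧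
      (∀ a < n, s'.iarr 3 a = lastBefore (s.iarr 2) a m) ∧
      ∀ p < m, s'.iarr 4 p = lastBefore (s.iarr 2) (s.iarr 2 p) p)
    (fun s' => 30 * (n - s'.ivar 5)) ⟨0, by simpa [lastBefore] using hH⟩ ?_ ?_).conseq ?_
  · rintro s' ⟨m, h1, h2, -⟩ hF
    have e0 : s'.ivar 0 = n := by rw [hF.ivar rfl]; simpa using h0
    simp; omega
  · rintro s' ⟨m, h1, h2, h3, h4⟩ hF hb
    have e0 : s'.ivar 0 = n := by rw [hF.ivar rfl]; simpa using h0
    have e2 : s'.iarr 2 = s.iarr 2 := by rw [hF.iarr rfl]; simp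
    simp [h1, e0] at hb
    have h5 := hA m hb
    have h6 := h3 _ h5
    have h7 := lastBefore_le (s.iarr 2) (s.iarr 2 m) m
    simp [h1, e2, h6]
    constructorm* _ ∧ _ <;> try omega
    · intro a ha
      rw [Function.update_apply, lastBefore]
      by_cases h : a = s.iarr 2 m
      · simp [h]
      · rw [if_neg h, if_neg (Ne.symm h)]
        exact h3 a ha
    · intro p hp'
      rw [Function.update_apply]
      split
      · subst p; rfl
      · exact h4 p (by omega)
  · rintro s' t hF ⟨⟨m, h1, h2, h3, h4⟩, hb, ht⟩
    have e0 : s'.ivar 0 = n := by rw [hF.ivar rfl]; simpa using h0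
    simp [h1, e0] at hb ht ⊢
    obtain rfl : m = n := by omega
    exact ⟨h3, h4, by omega⟩

/-- Give the positions with symbol `var 5` new names, which depend on the last digit of the
remaining code; the name is the position of a representative. -/
def nameGroupProg : Prog :=
  .setI 6 (.cell 3 (.var 5)) ;;
  .loop (.ilt (.const 0) (.var 6))
    (.setI 6 (.sub (.var 6) (.const 1)) ;;
      .setI 3 (.mod (.cell 0 (.var 6)) (.add (.var 0) (.const 1))) ;;
      .setI 2 (.cell 5 (.var 3)) ;;
      .ite (.and (.ieq (.cell 2 (.var 2)) (.var 5))
          (.ieq (.mod (.cell 0 (.var 2)) (.add (.var 0) (.const 1))) (.var 3)))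
        .skip (.setI 2 (.var 6) ;; .storeI 5 (.var 3) (.var 6)) ;;
      .storeI 6 (.var 6) (.var 2) ;; .setI 6 (.cell 4 (.var 6)))

/-- The positions with symbols below `a`, and those with symbol `a` from `m` on, have their new
names `X`; the array `Y` leads from digits to representatives. -/
structure Named (n : ℕ) (A D : ℕ → ℕ) (X Y : ℕ → ℕ) (a m : ℕ) : Prop where
  cert : ∀ p < n, A p < a ∨ A p = a ∧ m ≤ p → X p < n ∧ A (X p) = A p ∧ D (X p) = D p
  eqv : ∀ p < n, ∀ q < n, A p < a → A q = A p → D q = D p → X p = X q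
  cur : ∀ p < n, A p = a → m ≤ p → X p = Y (D p)
  rep : ∀ r ≤ n, Y r < n

/-- The array `Y` is never cleared between groups. An entry is trusted only if the position it names
has the present symbol and digit; otherwise it is a leftover and `p` becomes the representative. -/
theorem Named.step {n : ℕ} {A D X Y : ℕ → ℕ} {a m p : ℕ} (h : Named n A D X Y a m)
    (hmn : m ≤ n) (hD : D p ≤ n)
    (hl : lastBefore A a m = p + 1) {x : ℕ} {Y' : ℕ → ℕ}
    (hx : (x = Y (D p) ∧ Y' = Y ∧ A (Y (D p)) = a ∧ D (Y (D p)) = D p) ∨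
      (x = p ∧ Y' = Function.update Y (D p) p ∧ ¬ (A (Y (D p)) = a ∧ D (Y (D p)) = D p))) :
    Named n A D (Function.update X p x) Y' a p := by
  have hpm : p + 1 ≤ m := hl ▸ lastBefore_le A a m
  obtain ⟨hlast, hAp⟩ := lastBefore_spec A a m
  have hAp := hAp p hl
  -- Between `p` and `m` no other position carries the symbol `a`.
  have hlast : ∀ q, A q = a → p ≤ q → q ≠ p → m ≤ q := by
    intro q hq hpq hne
    by_contra hc
    exact hlast q (by omega) (by omega) hq
  refine ⟨fun q hq hq' => ?_, fun q hq q' hq' hlt hA hD => ?_, fun q hq hA hpq => ?_, ?_⟩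
  · rw [Function.update_apply]
    split
    · subst q
      rcases hx with ⟨rfl, -, h1, h2⟩ | ⟨rfl, -⟩
      · exact ⟨h.rep _ hD, by rw [h1, hAp], h2⟩
      · exact ⟨hq, rfl, rfl⟩
    · rename_i hne
      exact h.cert q hq (hq'.imp_right fun ⟨h1, h2⟩ => ⟨h1, hlast q h1 h2 hne⟩)
  · rw [Function.update_of_ne (by rintro rfl; omega),
      Function.update_of_ne (by rintro rfl; omega)]
    exact h.eqv q hq q' hq' hlt hA hD
  · by_cases hqp : q = p
    · subst q
      rcases hx with ⟨rfl, rfl, -⟩ | ⟨rfl, rfl, -⟩ <;> simp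
    · have hm := hlast q hA hpq hqp
      rw [Function.update_of_ne hqp, h.cur q hq hA hm]
      rcases hx with ⟨rfl, rfl, -⟩ | ⟨rfl, rfl, hn⟩
      · rfl
      · rw [Function.update_of_ne]
        -- Overwriting `Y (D p)` spoils no earlier name: had a named position of this group the
        -- digit `D p`, the old entry would have passed the test.
        intro he
        apply hn
        have h1 := h.cert q hq (.inr ⟨hA, hm⟩)
        rw [h.cur q hq hA hm, he] at h1
        exact ⟨h1.2.1.trans hA, h1.2.2⟩
  · intro r hr
    rcases hx with ⟨-, rfl, -⟩ | ⟨-, rfl, -⟩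
    · exact h.rep r hr
    · rw [Function.update_apply]
      split
      · omega
      · exact h.rep r hr

/-- At the end of the list the whole group has been named through one common `Y`, so equal digits
received equal names. -/
theorem Named.next {n : ℕ} {A D X Y : ℕ → ℕ} {a m : ℕ} (h : Named n A D X Y a m)
    (hm : lastBefore A a m = 0) : Named n A D X Y (a + 1) n := by
  have hall : ∀ p, A p = a → m ≤ p := fun p hp => by
    by_contra hc
    exact (lastBefore_spec A a m).1 p (by omega) (by omega) hp
  refine ⟨fun p hp hp' => h.cert p hp ?_, fun p hp q hq hlt hA hD => ?_,
    fun p hp _ hnp => by omega, h.rep⟩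
  · rcases hp' with hp' | ⟨-, hp'⟩
    · rcases Nat.lt_succ_iff_lt_or_eq.1 hp' with hp' | hp'
      · exact .inl hp'
      · exact .inr ⟨hp', hall p hp'⟩
    · omega
  · rcases Nat.lt_succ_iff_lt_or_eq.1 hlt with hlt | hlt
    · exact h.eqv p hp q hq hlt hA hD
    · rw [h.cur p hp hlt (hall p hlt), h.cur q hq (hA.trans hlt) (hall q (hA.trans hlt)), hD]

theorem run_nameGroupProg {M : Machine} {n : ℕ} (hM : Roomy M n) {s : State} {A D : ℕ → ℕ}
    {a : ℕ} (ha : a < n) (h0 : s.ivar 0 = n) (h5 : s.ivar 5 = a) (hA : s.iarr 2 = A)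
    (hAn : ∀ p < n, A p < n)
    (hQ : ∀ p < n, s.iarr 0 p < M.word) (hD : ∀ p, D p = s.iarr 0 p % (n + 1))
    (hH : s.iarr 3 a = lastBefore A a n)
    (hN : ∀ p < n, s.iarr 4 p = lastBefore A (A p) p)
    (hX : Named n A D (s.iarr 6) (s.iarr 5) a n) :
    Run M nameGroupProg s fun s' t => Named n A D (s'.iarr 6) (s'.iarr 5) (a + 1) n ∧
      t ≤ 100 * cnt A 0 n a + 10 := by
  have hp := hM.pos
  have hw := hM.word
  have hsp := hM.space
  have hle := lastBefore_le A a n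
  refine run_seq.2 (run_setI.2 ⟨by simp [h5, hH]; omega, ?_⟩)
  refine (Run.loop (fun s' => ∃ m, m ≤ n ∧ s'.ivar 6 = lastBefore A a m ∧
      Named n A D (s'.iarr 6) (s'.iarr 5) a m)
    -- Each round is charged to one occurrence of `a`; summed over the groups this makes the
    -- renaming linear.
    (fun s' => 100 * cnt A 0 (s'.ivar 6) a) ?_ ?_ ?_).conseq ?_
  · exact ⟨n, le_rfl, by simp [h5, hH], hX⟩
  · rintro s' ⟨m, h1, h2, -⟩ hF
    have := lastBefore_le A a m
    simp; omega
  · rintro s' ⟨m, h1, h2, h3⟩ hF hb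
    have e0 : s'.ivar 0 = n := by rw [hF.ivar rfl]; simpa using h0
    have e5 : s'.ivar 5 = a := by rw [hF.ivar rfl]; simpa using h5
    have eA : s'.iarr 2 = A := by rw [hF.iarr rfl]; simpa using hA
    have eQ : s'.iarr 0 = s.iarr 0 := by rw [hF.iarr rfl]; simp
    have eN : s'.iarr 4 = s.iarr 4 := by rw [hF.iarr rfl]; simp
    have hlm := lastBefore_le A a m
    simp only [BExpr.Holds, IExpr.eval] at hb
    obtain ⟨p, hp'⟩ : ∃ p, lastBefore A a m = p + 1 := ⟨lastBefore A a m - 1, by omega⟩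
    have hAp := (lastBefore_spec A a m).2 p hp'
    have hDp : D p ≤ n := by rw [hD]; exact Nat.lt_succ_iff.1 (Nat.mod_lt _ (by omega))
    have hDp' : s.iarr 0 p % (n + 1) = D p := (hD p).symm
    have hQp := hQ p (by omega)
    have hY := h3.rep _ hDp
    have hAY := hAn _ hY
    have hQY := hQ _ hY
    have hDY' : s.iarr 0 (s'.iarr 5 (D p)) % (n + 1) = D (s'.iarr 5 (D p)) := (hD _).symm
    have hNp := hN p (by omega)
    rw [hAp] at hNp
    have hlp := lastBefore_le A a p
    have hc : cnt A 0 (lastBefore A a p) a + 1 ≤ cnt A 0 (p + 1) a := by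
      rw [cnt_succ_right A (Nat.zero_le p), if_pos hAp]
      exact Nat.succ_le_succ (cnt_mono_right A 0 a hlp)
    rw [hp'] at h2
    simp [h2, e0, e5, eA, eQ, eN, hDp', hDY', hNp]
    constructorm* _ ∧ _ <;> try omega
    · intro hc1 hc2
      have h4 := h3.step h1 hDp hp' (.inl ⟨rfl, rfl, hc1, hc2⟩)
      constructorm* _ ∧ _ <;> try omega
      exact ⟨p, by omega, rfl, h4⟩
    · intro hc1
      have h4 := h3.step h1 hDp hp' (.inr ⟨rfl, rfl, fun h => hc1 h.1 h.2⟩)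
      constructorm* _ ∧ _ <;> try omega
      exact ⟨p, by omega, rfl, h4⟩
  · rintro s' t hF ⟨⟨m, h1, h2, h3⟩, hb, ht⟩
    simp only [BExpr.Holds, IExpr.eval] at hb
    refine ⟨h3.next (by omega), ?_⟩
    have := cnt_mono_right A 0 a hle
    simp [h5, hH] at ht ⊢
    omega

/-- Compute new names for all positions. -/
def nameProg : Prog :=
  .setI 5 (.const 0) ;;
  .loop (.ilt (.var 5) (.var 0)) (nameGroupProg ;; .setI 5 (.add (.var 5) (.const 1)))

theorem run_nameProg {M : Machine} {n : ℕ} (hM : Roomy M n) {s : State} {A D : ℕ → ℕ}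
    (h0 : s.ivar 0 = n) (hA : s.iarr 2 = A)
    (hAn : ∀ p < n, A p < n)
    (hQ : ∀ p < n, s.iarr 0 p < M.word) (hD : ∀ p, D p = s.iarr 0 p % (n + 1))
    (hH : ∀ a < n, s.iarr 3 a = lastBefore A a n)
    (hN : ∀ p < n, s.iarr 4 p = lastBefore A (A p) p)
    (hY : ∀ r ≤ n, s.iarr 5 r < n) :
    Run M nameProg s fun s' t => Named n A D (s'.iarr 6) (s'.iarr 5) n n ∧ t ≤ 200 * n + 10 := by
  have hp := hM.pos
  have hw := hM.word
  refine run_seq.2 (run_setI.2 ⟨by simp; omega, ?_⟩)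
  refine (Run.loop (fun s' => ∃ a, a ≤ n ∧ s'.ivar 5 = a ∧
      Named n A D (s'.iarr 6) (s'.iarr 5) a n)
    (fun s' => 100 * (n - s'.ivar 5) + 100 * ∑ c ∈ Ico (s'.ivar 5) n, cnt A 0 n c)
    ?_ ?_ ?_).conseq ?_
  · exact ⟨0, by omega, by simp, ⟨fun p _ h => by omega, fun _ _ _ _ h => by omega,
      fun _ _ h => by omega, hY⟩⟩
  · rintro s' ⟨m, h1, h2, -⟩ hF
    have e0 : s'.ivar 0 = n := by rw [hF.ivar rfl]; simpa using h0
    simp; omega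
  · rintro s' ⟨a, h1, h2, h3⟩ hF hb
    have e0 : s'.ivar 0 = n := by rw [hF.ivar rfl]; simpa using h0
    have eA : s'.iarr 2 = A := by rw [hF.iarr rfl]; simpa using hA
    have eQ : s'.iarr 0 = s.iarr 0 := by rw [hF.iarr rfl]; simp
    have eN : s'.iarr 4 = s.iarr 4 := by rw [hF.iarr rfl]; simp
    have eH : s'.iarr 3 = s.iarr 3 := by rw [hF.iarr rfl]; simp
    simp only [BExpr.Holds, IExpr.eval, h2, e0] at hb
    refine Run.seq (run_nameGroupProg hM hb e0 h2 eA hAn (by rwa [eQ]) (by rwa [eQ])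
      (by rw [eH]; exact hH a hb) (by rwa [eN]) h3) ?_
    rintro s₁ t₁ hF₁ ⟨h4, ht₁⟩
    have d5 : s₁.ivar 5 = a := by rw [hF₁.ivar rfl, h2]
    refine run_setI.2 ⟨by simp; omega, ⟨a + 1, hb, by simp [d5], h4⟩, ?_⟩
    rw [h2, sum_eq_sum_Ico_succ_bot hb]
    simp [d5]
    omega
  · rintro s' t hF ⟨⟨a, h1, h2, h3⟩, hb, ht⟩
    have e0 : s'.ivar 0 = n := by rw [hF.ivar rfl]; simpa using h0
    simp only [BExpr.Holds, IExpr.eval, h2, e0] at hb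
    obtain rfl : a = n := by omega
    refine ⟨h3, ?_⟩
    -- Double counting: a position carries only one symbol.
    have hsum : ∑ c ∈ range a, cnt A 0 a c ≤ a := by
      simp only [cnt]
      rw [sum_comm]
      refine (sum_le_card_nsmul _ _ 1 fun p _ => ?_).trans (by simp)
      rw [sum_ite_eq]
      split <;> simp
    simp at ht ⊢
    omega

/-- Install the new names and drop a digit of the codes. -/
def installProg : Prog :=
  .setI 5 (.const 0) ;;
  .loop (.ilt (.var 5) (.var 0))
    (.storeI 2 (.var 5) (.cell 6 (.var 5)) ;;
      .storeI 0 (.var 5) (.div (.cell 0 (.var 5)) (.add (.var 0) (.const 1))) ;;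
      .setI 5 (.add (.var 5) (.const 1)))

theorem run_installProg {M : Machine} {n : ℕ} (hM : Roomy M n) {s : State}
    (h0 : s.ivar 0 = n) (hX : ∀ p < n, s.iarr 6 p < n) (hQ : ∀ p < n, s.iarr 0 p < M.word) :
    Run M installProg s fun s' t => (∀ p < n, s'.iarr 2 p = s.iarr 6 p) ∧
      (∀ p < n, s'.iarr 0 p = s.iarr 0 p / (n + 1)) ∧ t ≤ 40 * n + 10 := by
  have hp := hM.pos
  have hw := hM.word
  have hsp := hM.space
  refine run_seq.2 (run_setI.2 ⟨by simp; omega, ?_⟩)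
  refine (Run.loop (fun s' => ∃ m, s'.ivar 5 = m ∧ m ≤ n ∧
      (∀ p < m, s'.iarr 2 p = s.iarr 6 p) ∧ (∀ p < m, s'.iarr 0 p = s.iarr 0 p / (n + 1)) ∧
      ∀ p, m ≤ p → s'.iarr 0 p = s.iarr 0 p)
    (fun s' => 40 * (n - s'.ivar 5)) ⟨0, by simp⟩ ?_ ?_).conseq ?_
  · rintro s' ⟨m, h1, h2, -⟩ hF
    have e0 : s'.ivar 0 = n := by rw [hF.ivar rfl]; simpa using h0
    simp; omega
  · rintro s' ⟨m, h1, h2, h3, h4, h5⟩ hF hb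
    have e0 : s'.ivar 0 = n := by rw [hF.ivar rfl]; simpa using h0
    have e6 : s'.iarr 6 = s.iarr 6 := by rw [hF.iarr rfl]; simp
    simp [h1, e0] at hb
    have h6 := hX m hb
    have h7 := hQ m hb
    have h8 := h5 m le_rfl
    simp [h1, e6, h8, e0]
    constructorm* _ ∧ _ <;> try omega
    · intro p hp'
      rw [Function.update_apply]
      split
      · subst p; rfl
      · exact h3 p (by omega)
    · intro p hp'
      rw [Function.update_apply]
      split
      · subst p; rfl
      · exact h4 p (by omega)
    · intro p hp'
      rw [Function.update_of_ne (by omega)]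
      exact h5 p (by omega)
  · rintro s' t hF ⟨⟨m, h1, h2, h3, h4, -⟩, hb, ht⟩
    have e0 : s'.ivar 0 = n := by rw [hF.ivar rfl]; simpa using h0
    simp [h1, e0] at hb ht ⊢
    obtain rfl : m = n := by omega
    exact ⟨h3, h4, by omega⟩

/-- Refine the names of the positions by one digit of the codes. -/
def refineProg : Prog :=
  clearHeadsProg ;; linkProg ;; nameProg ;; installProg

/-- A new name is a position with the same old name and digit, so equal new names force equal old
names and digits; the converse is the field `eqv` of `Named`. -/
theorem run_refineProg {M : Machine} {n : ℕ} (hM : Roomy M n) {s : State}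
    (h0 : s.ivar 0 = n) (hA : ∀ p < n, s.iarr 2 p < n) (hQ : ∀ p < n, s.iarr 0 p < M.word)
    (hY : ∀ r ≤ n, s.iarr 5 r < n) :
    Run M refineProg s fun s' t => (∀ p < n, s'.iarr 2 p < n) ∧
      (∀ p < n, ∀ q < n, s'.iarr 2 p = s'.iarr 2 q ↔
        s.iarr 2 p = s.iarr 2 q ∧ s.iarr 0 p % (n + 1) = s.iarr 0 q % (n + 1)) ∧
      (∀ p < n, s'.iarr 0 p = s.iarr 0 p / (n + 1)) ∧ (∀ r ≤ n, s'.iarr 5 r < n) ∧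
      t ≤ 400 * n := by
  have hp := hM.pos
  refine Run.seq (run_clearHeadsProg hM h0) ?_
  rintro s₁ t₁ hF₁ ⟨hH, ht₁⟩
  refine Run.seq (run_linkProg hM ((hF₁.ivar rfl).trans h0) (by rwa [hF₁.iarr rfl]) hH) ?_
  rintro s₂ t₂ hF₂ ⟨hH₂, hN₂, ht₂⟩
  have d0 : s₂.ivar 0 = n := by rw [hF₂.ivar rfl, hF₁.ivar rfl, h0]
  have d2 : s₂.iarr 2 = s.iarr 2 := by rw [hF₂.iarr rfl, hF₁.iarr rfl]
  have dQ : s₂.iarr 0 = s.iarr 0 := by rw [hF₂.iarr rfl, hF₁.iarr rfl]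
  have d5 : s₂.iarr 5 = s.iarr 5 := by rw [hF₂.iarr rfl, hF₁.iarr rfl]
  refine Run.seq (run_nameProg hM (A := s.iarr 2) (D := fun p => s.iarr 0 p % (n + 1)) d0 d2 hA
    (by rwa [dQ]) (fun p => by rw [dQ]) (by rwa [hF₁.iarr rfl] at hH₂)
    (by rwa [hF₁.iarr rfl] at hN₂) (by rwa [d5])) ?_
  rintro s₃ t₃ hF₃ ⟨hX, ht₃⟩
  have c0 : s₃.ivar 0 = n := by rw [hF₃.ivar rfl, d0]
  have cQ : s₃.iarr 0 = s.iarr 0 := by rw [hF₃.iarr rfl, dQ]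
  refine (run_installProg hM c0 (fun p hp => (hX.cert p hp (.inl (hA p hp))).1)
    (by rwa [cQ])).conseq ?_
  rintro s₄ t₄ hF₄ ⟨h2, hQ', ht₄⟩
  refine ⟨fun p hp => ?_, fun p hp q hq => ?_, fun p hp => ?_, ?_, by omega⟩
  · rw [h2 p hp]
    exact (hX.cert p hp (.inl (hA p hp))).1
  · obtain ⟨-, p1, p2⟩ := hX.cert p hp (.inl (hA p hp))
    obtain ⟨-, q1, q2⟩ := hX.cert q hq (.inl (hA q hq))
    rw [h2 p hp, h2 q hq]
    constructor
    · intro he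
      rw [he] at p1 p2
      exact ⟨p1.symm.trans q1, p2.symm.trans q2⟩
    · exact fun he => hX.eqv p hp q hq (hA p hp) he.1.symm he.2.symm
  · rw [hQ' p hp, cQ]
  · rw [hF₄.iarr rfl]
    exact hX.rep

/-- Rename the symbols of the text, which have at most `d` digits, to numbers below the length. -/
def renameProg : ℕ → Prog
  | 0 => .skip
  | d + 1 => renameProg d ;; refineProg

/-- With the number of digits a variable, the syntactic check no longer reduces to `true` by
computation, so induction replaces `rfl` here and in the three analogues. -/
theorem keepsI_renameProg {y : ℕ} (h : refineProg.keepsI y = true) (d : ℕ) :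
    (renameProg d).keepsI y = true := by
  induction d with
  | zero => rfl
  | succ d ih => simp [renameProg, Prog.keepsI, ih, h]

theorem keepsR_renameProg {y : ℕ} (h : refineProg.keepsR y = true) (d : ℕ) :
    (renameProg d).keepsR y = true := by
  induction d with
  | zero => rfl
  | succ d ih => simp [renameProg, Prog.keepsR, ih, h]

theorem keepsIArr_renameProg {y : ℕ} (h : refineProg.keepsIArr y = true) (d : ℕ) :
    (renameProg d).keepsIArr y = true := by
  induction d with
  | zero => rfl
  | succ d ih => simp [renameProg, Prog.keepsIArr, ih, h]

theorem keepsRArr_renameProg {y : ℕ} (h : refineProg.keepsRArr y = true) (d : ℕ) :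
    (renameProg d).keepsRArr y = true := by
  induction d with
  | zero => rfl
  | succ d ih => simp [renameProg, Prog.keepsRArr, ih, h]

/-- After `d` digits the names distinguish residues modulo `(n + 1) ^ d`, which for symbols below
this bound are the symbols themselves. -/
theorem run_renameProg {M : Machine} {n : ℕ} (hM : Roomy M n) {s : State}
    (h0 : s.ivar 0 = n) (hA : ∀ p < n, s.iarr 2 p = 0) (hQ : ∀ p < n, s.iarr 0 p < M.word)
    (hY : ∀ r ≤ n, s.iarr 5 r = 0) (d : ℕ) :
    Run M (renameProg d) s fun s' t => (∀ p < n, s'.iarr 2 p < n) ∧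
      (∀ p < n, ∀ q < n, s'.iarr 2 p = s'.iarr 2 q ↔
        s.iarr 0 p % (n + 1) ^ d = s.iarr 0 q % (n + 1) ^ d) ∧
      (∀ p < n, s'.iarr 0 p = s.iarr 0 p / (n + 1) ^ d) ∧ (∀ r ≤ n, s'.iarr 5 r < n) ∧
      t ≤ 400 * n * d + 1 := by
  have hp := hM.pos
  induction d with
  | zero =>
    refine run_skip.2 ⟨fun p hp' => by rw [hA p hp']; exact hp, fun p hp' q hq => ?_,
      fun p _ => by simp, fun r hr => by rw [hY r hr]; exact hp, by simp⟩
    simp [hA p hp', hA q hq, Nat.mod_one]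
  | succ d ih =>
    refine Run.seq ih ?_
    rintro s₁ t₁ hF₁ ⟨h1, h2, h3, h4, ht₁⟩
    have d0 : s₁.ivar 0 = n := by rw [hF₁.ivar (keepsI_renameProg rfl d), h0]
    refine (run_refineProg hM d0 h1 (fun p hp' => ?_) h4).conseq ?_
    · rw [h3 p hp']
      exact (Nat.div_le_self _ _).trans_lt (hQ p hp')
    rintro s₂ t₂ - ⟨g1, g2, g3, g4, ht₂⟩
    refine ⟨g1, fun p hp' q hq => ?_, fun p hp' => ?_, g4, ?_⟩
    · rw [g2 p hp' q hq, h2 p hp' q hq, h3 p hp', h3 q hq, Nat.mod_pow_succ, Nat.mod_pow_succ]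
      constructor
      · rintro ⟨e1, e2⟩
        rw [e1, e2]
      · intro he
        have hb : 0 < (n + 1) ^ d := by positivity
        -- Reducing once more isolates the lower digits; cancelling them leaves the new digit.
        have e1 := congrArg (· % (n + 1) ^ d) he
        simp only [Nat.add_mul_mod_self_left, Nat.mod_mod] at e1
        rw [e1] at he
        exact ⟨e1, Nat.eq_of_mul_eq_mul_left hb (Nat.add_left_cancel he)⟩
    · rw [g3 p hp', h3 p hp', Nat.div_div_eq_div_mul, pow_succ]
    · rw [Nat.mul_succ]
      omega

/-! ### The table of `g`, the number of thresholds and the choice of the method -/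

/-- Tabulate the function that `e` computes from `var 5` and the previous entry. -/
def tableProg (e : RExpr) : Prog :=
  .setI 5 (.const 0) ;;
  .loop (.ilt (.var 5) (.var 0))
    (.setI 5 (.add (.var 5) (.const 1)) ;; .storeR 0 (.var 5) e)

/-- The previous entry is available to `e` because `log (x + 1)!` is computed from `log x!`. Entry
zero is never written; it is right because memory starts at zero and `g 0 = 0`. -/
theorem run_tableProg {M : Machine} {n : ℕ} (hM : Roomy M n) {s : State} {e : RExpr} {g : ℕ → ℝ}
    (h0 : s.ivar 0 = n) (hg : g 0 = 0) (hs : s.rarr 0 0 = 0) (hcost : e.cost ≤ 10)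
    (he : ∀ s' x, s'.ivar 5 = x + 1 → x + 1 ≤ n → s'.rarr 0 x = g x →
      e.Ok M s' ∧ e.eval M s' = g (x + 1)) :
    Run M (tableProg e) s fun s' t => (∀ x ≤ n, s'.rarr 0 x = g x) ∧ t ≤ 30 * n + 10 := by
  have hp := hM.pos
  have hw := hM.word
  have hsp := hM.space
  refine run_seq.2 (run_setI.2 ⟨by simp; omega, ?_⟩)
  refine (Run.loop (fun s' => ∃ m, s'.ivar 5 = m ∧ m ≤ n ∧ ∀ x ≤ m, s'.rarr 0 x = g x)
    (fun s' => 30 * (n - s'.ivar 5)) ?_ ?_ ?_).conseq ?_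
  · refine ⟨0, by simp, by simp, fun x hx => ?_⟩
    obtain rfl : x = 0 := by omega
    simp [hs, hg]
  · rintro s' ⟨m, h1, h2, -⟩ hF
    have e0 : s'.ivar 0 = n := by rw [hF.ivar rfl]; simpa using h0
    simp; omega
  · rintro s' ⟨m, h1, h2, h3⟩ hF hb
    have e0 : s'.ivar 0 = n := by rw [hF.ivar rfl]; simpa using h0
    simp only [BExpr.Holds, IExpr.eval, h1, e0] at hb
    obtain ⟨k1, k2⟩ := he (s'.setI 5 (m + 1)) m (by simp) hb (by simpa using h3 m le_rfl)
    simp [h1, k1, k2]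
    constructorm* _ ∧ _ <;> try omega
    intro x hx
    rw [Function.update_apply]
    split
    · subst x; rfl
    · exact h3 x (by omega)
  · rintro s' t hF ⟨⟨m, h1, h2, h3⟩, hb, ht⟩
    have e0 : s'.ivar 0 = n := by rw [hF.ivar rfl]; simpa using h0
    simp [h1, e0] at hb ht ⊢
    obtain rfl : m = n := by omega
    exact ⟨h3, by omega⟩

/-- Variable 12 becomes the number of thresholds, if this is at most `n`. -/
def scaleProg (x : RExpr) : Prog :=
  .setR 5 x ;; .setI 12 (.const 2) ;; .setR 6 (.ofNat (.const 1)) ;;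
  .loop (.and (.not (.ilt (.var 0) (.var 12))) (.not (.rle (.var 5) (.var 6))))
    (.setR 6 (.mul (.var 6) (.add (.ofNat (.const 1)) (.var 0))) ;;
      .setI 12 (.add (.var 12) (.const 1)))

/-- A real logarithm could not be turned into an integer, so the powers of `1 + eps` are counted one
by one. The count starts at 2 because, by `pow_le_thr_succ`, the thresholds with indices `0` to `m +
1` are needed to exceed `(1 + eps) ^ m`. It is cut off just above `n`, from where on exhaustive
search is used. -/
theorem run_scaleProg {M : Machine} {n : ℕ} (hM : Roomy M n) {s : State} {x : RExpr} {eps X : ℝ}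
    (h0 : s.ivar 0 = n) (heps : s.rvar 0 = eps) (hx : x.Ok M s) (hX : x.eval M s = X) :
    Run M (scaleProg x) s fun s' t => ∃ m, s'.ivar 12 = m + 2 ∧ (m = 0 ∨ m + 1 ≤ n) ∧
      (n < m + 2 ∨ X ≤ (1 + eps) ^ m) ∧ (∀ k < m, (1 + eps) ^ k < X) ∧
      t ≤ x.cost + 30 * m + 30 := by
  have hp := hM.pos
  have hw := hM.word
  have hsp := hM.space
  refine run_seq.2 (run_setR.2 ⟨hx, ?_⟩)
  refine run_seq.2 (run_setI.2 ⟨by simp; omega, ?_⟩)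
  refine run_seq.2 (run_setR.2 ⟨by simp; omega, ?_⟩)
  refine (Run.loop (fun s' => ∃ m, s'.ivar 12 = m + 2 ∧ (m = 0 ∨ m + 1 ≤ n) ∧
      s'.rvar 6 = (1 + eps) ^ m ∧ ∀ k < m, (1 + eps) ^ k < X)
    (fun s' => 30 * (n + 4 - s'.ivar 12)) ?_ ?_ ?_).conseq ?_
  · exact ⟨0, by simp⟩
  · rintro s' ⟨m, h1, h2, -⟩ hF
    have e0 : s'.ivar 0 = n := by rw [hF.ivar rfl]; simpa using h0
    simp; omega
  · rintro s' ⟨m, h1, h2, h3, h4⟩ hF hb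
    have e0 : s'.ivar 0 = n := by rw [hF.ivar rfl]; simpa using h0
    have e00 : s'.rvar 0 = eps := by rw [hF.rvar rfl]; simpa using heps
    have e5 : s'.rvar 5 = X := by rw [hF.rvar rfl]; simpa using hX
    simp only [BExpr.Holds, IExpr.eval, RExpr.eval, h1, e0, h3, e5, not_lt, not_le] at hb
    simp [h1, h3, e00]
    constructorm* _ ∧ _ <;> try omega
    · exact (pow_succ _ _).symm
    · intro k hk
      rcases hk.lt_or_eq with hk | rfl
      · exact h4 k hk
      · exact hb.2
  · rintro s' t hF ⟨⟨m, h1, h2, h3, h4⟩, hb, ht⟩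
    have e0 : s'.ivar 0 = n := by rw [hF.ivar rfl]; simpa using h0
    have e5 : s'.rvar 5 = X := by rw [hF.rvar rfl]; simpa using hX
    simp only [BExpr.Holds, IExpr.eval, RExpr.eval, h1, e0, h3, e5, not_and_or, not_not] at hb
    refine ⟨m, h1, h2, hb, h4, ?_⟩
    simp [h1] at ht ⊢
    omega

/-- Solve the text, by blocks if there are fewer than `n` thresholds. -/
def solveProg (N : ℕ) : Prog :=
  .ite (.ilt (.var 0) (.var 12)) (exactProg N)
    (.setI 13 (.div (.var 0) (.var 12)) ;; blocksProg N)

theorem run_solveProg {S : Setup} (hS : S.Fits) (hV : S.Sound) (heps : 0 < S.eps)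
    {s : State} (hB : S.Base s) (hC : S.Counts (cnt S.A 0 0) s)
    (hX : ∀ p, s.iarr 9 p = 0) (hP : s.rarr 2 S.n = 0) {m : ℕ} {X : ℝ}
    (h12 : s.ivar 12 = m + 2) (hm : m = 0 ∨ m + 1 ≤ S.n)
    (hmX : S.n < m + 2 ∨ X ≤ (1 + S.eps) ^ m)
    (hc : ∀ i j, i < j → j ≤ S.n → S.cost i j ≤ X) :
    Run S.M (solveProg S.N) s fun s' t => S.Solved (s'.iarr 9) (s'.rarr 2) 0 ∧
      t ≤ 13000 * (S.n * (m + 2)) + 50 := by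
  have hpos := hS.pos
  have hw := hS.word
  refine run_ite.2 ⟨by simp [hB.len, h12]; omega, fun hb => ?_, fun hb => ?_⟩
  · simp only [BExpr.Holds, IExpr.eval, h12, hB.len] at hb
    refine (run_exactProg hS hV heps hB hC hX hP).conseq ?_
    rintro s' t - ⟨h1, ht⟩
    refine ⟨h1, ?_⟩
    have : S.n * S.n ≤ S.n * (m + 2) := Nat.mul_le_mul_left _ hb.le
    simp
    omega
  · simp only [BExpr.Holds, IExpr.eval, h12, hB.len, not_lt] at hb
    have hX' := hmX.resolve_left (by omega)
    refine run_seq.2 (run_setI.2 ⟨by simp [hB.len, h12]; omega, ?_⟩)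
    have hq : IExpr.eval s (.div (.var 0) (.var 12)) = S.n / (m + 2) := by simp [hB.len, h12]
    rw [hq]
    have hBpos : 0 < S.n / (m + 2) := Nat.div_pos hb (by omega)
    have hBn := Nat.mul_div_le S.n (m + 2)
    -- With `m + 2` thresholds and blocks of length `S.n / (m + 2)`, the edge table of a block has
    -- at most `S.n` cells.
    refine (run_blocksProg (kk := m + 1) hS hV heps (hB.setI _ _) (hC.setI _ _) hBpos hBn
      (fun i j hij hj => (hc i j hij hj).trans (hX'.trans (pow_le_thr_succ hV hpos heps m)))
      hX hP (by simp)).conseq ?_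
    rintro s' t - ⟨h1, ht⟩
    refine ⟨h1, ?_⟩
    -- As `B ≥ 1`, the length is less than `(m + 2)(B + 1) ≤ 2 (m + 2) B`; the remaining summand `B`
    -- comes from rounding up.
    have hblocks : (S.n + S.n / (m + 2) - 1) / (S.n / (m + 2)) ≤ 3 * (m + 2) := by
      generalize hB' : S.n / (m + 2) = B at *
      have h2 : S.n < (m + 2) * (B + 1) := by
        rw [← hB']
        exact Nat.lt_mul_div_succ _ (by omega)
      refine Nat.div_le_of_le_mul ?_
      nlinarith [Nat.sub_le (S.n + B) 1, Nat.le_mul_of_pos_right (m + 2) hBpos,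
        Nat.le_mul_of_pos_left B (by omega : 0 < m + 2)]
    have h3 := Nat.mul_le_mul_left S.n hblocks
    have h4 : S.n * (3 * (m + 2)) = 3 * (S.n * (m + 2)) := by ring
    have h5 : (m + 1 + 1) * S.n = S.n * (m + 2) := by ring
    rw [h5] at ht
    simp
    omega

/-! ### Output and the approximation guarantee -/

/-- Write the part lengths. -/
def outputProg : Prog :=
  .setI 5 (.const 0) ;;
  .loop (.ilt (.var 5) (.var 0))
    (.storeI 1 (.var 1) (.sub (.cell 9 (.var 5)) (.var 5)) ;;
      .setI 1 (.add (.var 1) (.const 1)) ;; .setI 5 (.cell 9 (.var 5)))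

/-- The symbols of `T` at the positions in `[i, j)`. -/
def segment (T : List ℕ) (i j : ℕ) : List ℕ :=
  (T.drop i).take (j - i)

theorem length_segment {T : List ℕ} {i j : ℕ} (hj : j ≤ T.length) :
    (segment T i j).length = j - i := by
  rw [segment, List.length_take, List.length_drop]
  omega

theorem take_append_segment {T : List ℕ} {i j : ℕ} (hij : i ≤ j) :
    T.take i ++ segment T i j = T.take j := by
  obtain ⟨k, rfl⟩ := Nat.exists_eq_add_of_le hij
  rw [segment, Nat.add_sub_cancel_left, List.take_add]

/-- Along the path of successors from `0`, the scaled cost of the parts already written plus the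
stored cost of the present position is constant. Parts are nonempty, so their number never exceeds
the position and the output fits into its array. -/
theorem run_outputProg {S : Setup} (hS : S.Fits) {s : State} {T : List ℕ} {size : List ℕ → ℝ}
    (hT : T.length = S.n)
    (hc : ∀ i j, i < j → j ≤ S.n → S.cost i j = S.N * size (segment T i j))
    (hs : S.Solved (s.iarr 9) (s.rarr 2) 0) (h0 : s.ivar 0 = S.n) (h1 : s.ivar 1 = 0) :
    Run S.M outputProg s fun s' t => ∃ parts, IsPartition parts T ∧
      S.N * partitionCost size parts = s.rarr 2 0 ∧
      output s' = parts.map List.length ∧ t ≤ 30 * S.n + 10 := by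
  have hp := hS.pos
  have hw := hS.word
  have hsp := hS.space
  refine run_seq.2 (run_setI.2 ⟨by simp; omega, ?_⟩)
  refine (Run.loop (fun s' => ∃ i parts, s'.ivar 5 = i ∧ i ≤ S.n ∧ s'.ivar 1 ≤ i ∧
      parts.flatten = T.take i ∧ [] ∉ parts ∧
      S.N * partitionCost size parts + s.rarr 2 i = s.rarr 2 0 ∧
      output s' = parts.map List.length)
    (fun s' => 30 * (S.n - s'.ivar 5)) ?_ ?_ ?_).conseq ?_
  · exact ⟨0, [], by simp, by simp, by simp [h1], by simp, by simp, by simp [partitionCost],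
      by simp [output, h1]⟩
  · rintro s' ⟨i, parts, h1, h2, -⟩ hF
    have e0 : s'.ivar 0 = S.n := by rw [hF.ivar rfl]; simpa using h0
    simp; omega
  · rintro s' ⟨i, parts, h1, h2, h3, h4, h5, h6, h7⟩ hF hb
    have e0 : s'.ivar 0 = S.n := by rw [hF.ivar rfl]; simpa using h0
    have e9 : s'.iarr 9 = s.iarr 9 := by rw [hF.iarr rfl]; simp
    simp only [BExpr.Holds, IExpr.eval, h1, e0] at hb
    obtain ⟨k1, k2, k3⟩ := hs.edge i (Nat.zero_le i) hb
    simp [h1, e9]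
    constructorm* _ ∧ _ <;> try omega
    refine ⟨parts ++ [segment T i (s.iarr 9 i)], ?_, ?_, ?_, ?_⟩
    · rw [List.flatten_append, h4, List.flatten_singleton, take_append_segment k1.le]
    · rw [List.mem_append, List.mem_singleton]
      rintro (h | h)
      · exact h5 h
      · have := length_segment (i := i) (hT ▸ k2)
        rw [← h] at this
        simp at this
        omega
    · rw [k3, hc i _ k1 k2] at h6
      rw [← h6]
      simp only [partitionCost, List.map_append, List.sum_append, List.map_cons, List.map_nil,
        List.sum_cons, List.sum_nil]
      ring
    · simp only [output] at h7
      rw [List.map_append, ← h7]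
      simp only [output, ivar_setI, iarr_setI, iarr_storeI]
      simp [List.range_succ, length_segment (i := i) (hT ▸ k2)]
      intro x hx
      rw [Function.update_of_ne (by omega)]
  · rintro s' t hF ⟨⟨i, parts, h1, h2, h3, h4, h5, h6, h7⟩, hb, ht⟩
    have e0 : s'.ivar 0 = S.n := by rw [hF.ivar rfl]; simpa using h0
    simp only [BExpr.Holds, IExpr.eval, h1, e0] at hb
    obtain rfl : i = S.n := by omega
    refine ⟨parts, ⟨?_, h5⟩, ?_, h7, ?_⟩
    · rw [h4, ← hT, List.take_length]
    · rw [hs.last, add_zero] at h6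
      exact h6
    · simp [h1] at ht ⊢
      omega

/-- The solution is nearly optimal, even if the partition that it is compared with starts further
to the left. -/
theorem Setup.Solved.le_cost {S : Setup} (hV : S.Sound) (heps : 0 < S.eps) {X : ℕ → ℕ} {P : ℕ → ℝ}
    (hs : S.Solved X P 0) {T : List ℕ} {size : List ℕ → ℝ} (hT : T.length = S.n)
    (hc : ∀ i j, i < j → j ≤ S.n → S.cost i j = S.N * size (segment T i j))
    (parts : List (List ℕ)) : ∀ i, i ≤ S.n → parts.flatten = T.drop i → [] ∉ parts →
      ∀ j, i ≤ j → j ≤ S.n → P j ≤ (1 + S.eps) * (S.N * partitionCost size parts) := by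
  induction parts with
  | nil =>
    intro i hi hf _ j hij hj
    have := congrArg List.length hf
    simp at this
    obtain rfl : j = S.n := by omega
    simp [partitionCost, hs.last]
  | cons w parts ih =>
    intro i hi hf hne j hij hj
    have hw : w ≠ [] := fun h => hne (by simp [h])
    have hwl := List.length_pos_iff.2 hw
    have hlen := congrArg List.length hf
    simp only [List.flatten_cons, List.length_append, List.length_drop] at hlen
    have hseg : segment T i (i + w.length) = w := by
      rw [segment, ← hf, List.flatten_cons, Nat.add_sub_cancel_left, List.take_left]
    have hrest : parts.flatten = T.drop (i + w.length) := by
      rw [← List.drop_drop, ← hf, List.flatten_cons, List.drop_left]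
    have ih' := ih (i + w.length) (by omega) hrest fun h => hne (List.mem_cons_of_mem _ h)
    have hcost := hc i (i + w.length) (by omega) (by omega)
    rw [hseg] at hcost
    have hpc : S.N * partitionCost size (w :: parts) =
        S.cost i (i + w.length) + S.N * partitionCost size parts := by
      rw [hcost, partitionCost, partitionCost, List.map_cons, List.sum_cons]
      ring
    rw [hpc]
    have h0 := hV.nonneg (by omega : i < i + w.length) (by omega)
    -- If `j` lies beyond the first part, that part is simply dropped. Otherwise its remainder `[j,
    -- i + w.length)` costs no more than the whole part, and the dominating edge may end beyond the
    -- part, which is why the induction allows all later starting positions.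
    by_cases hj' : i + w.length ≤ j
    · have := ih' j hj' hj
      nlinarith
    · obtain ⟨j', h1, h2, h3⟩ := hs.approx j (i + w.length) (Nat.zero_le j) (by omega) (by omega)
      have h4 := ih' j' h1 h2
      have h5 := hV.mono hij (by omega : j < i + w.length) le_rfl (by omega)
      nlinarith

end RealRAM

/-! ### Entropies -/

/-- Functions `g` for which `g(m) - ∑ g(n_c)` behaves like an entropy of counts. -/
structure IsEntropyFn (g : ℕ → ℝ) : Prop where
  zero : g 0 = 0
  one : g 1 = 0
  two : 1 ≤ g 2
  nonneg : ∀ m, 0 ≤ g m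
  step_mono : ∀ {c m}, c ≤ m → g (c + 1) - g c ≤ g (m + 1) - g m
  le_sq : ∀ m, g m ≤ (m : ℝ) ^ 2

theorem logb_two_natCast_le (m : ℕ) : Real.logb 2 m ≤ m := by
  rcases Nat.eq_zero_or_pos m with rfl | hm
  · simp
  · rw [Real.logb_le_iff_le_rpow (by norm_num) (by exact_mod_cast hm), Real.rpow_natCast]
    exact_mod_cast Nat.lt_two_pow_self.le

theorem logb_two_natCast_nonneg (m : ℕ) : 0 ≤ Real.logb 2 m := by
  rcases Nat.eq_zero_or_pos m with rfl | hm
  · simp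
  · exact Real.logb_nonneg (by norm_num) (by exact_mod_cast hm)

/-- Monotone increments are the convexity of `x log x`, applied to adjacent unit intervals. -/
theorem isEntropyFn_mul_logb : IsEntropyFn fun m => (m : ℝ) * Real.logb 2 m where
  zero := by simp
  one := by simp
  two := by norm_num
  nonneg m := mul_nonneg (Nat.cast_nonneg m) (logb_two_natCast_nonneg m)
  step_mono := by
    intro c m hcm
    refine monotone_nat_of_le_succ (f := fun m : ℕ => ((m + 1 : ℕ) : ℝ) *
      Real.logb 2 ((m + 1 : ℕ) : ℝ) - m * Real.logb 2 m) (fun k => ?_) hcm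
    have h := Real.convexOn_mul_log.slope_mono_adjacent (x := k) (y := k + 1) (z := k + 2)
      (by simp) (by simp only [Set.mem_Ici]; positivity) (by linarith) (by linarith)
    have e1 : (k : ℝ) + 1 - k = 1 := by ring
    have e2 : (k : ℝ) + 2 - (k + 1) = 1 := by ring
    rw [e1, e2, div_one, div_one] at h
    have hl : 0 < Real.log 2 := Real.log_pos (by norm_num)
    have := div_le_div_of_nonneg_right h hl.le
    simp only [Real.logb]
    push_cast
    have e3 : (k : ℝ) + 1 + 1 = k + 2 := by ring
    rw [e3]
    convert this using 1 <;> ring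
  le_sq m := by
    rw [sq]
    exact mul_le_mul_of_nonneg_left (logb_two_natCast_le m) (Nat.cast_nonneg m)

theorem logb_factorial_succ (m : ℕ) : Real.logb 2 ((m + 1).factorial : ℝ) =
    Real.logb 2 (m.factorial : ℝ) + Real.logb 2 ((m + 1 : ℕ) : ℝ) := by
  rw [Nat.factorial_succ, Nat.cast_mul, Real.logb_mul, add_comm]
  · exact_mod_cast Nat.succ_ne_zero m
  · exact_mod_cast Nat.factorial_ne_zero m

/-- The increments are `log (m + 1)`, so their monotonicity is that of the logarithm. -/
theorem isEntropyFn_logb_factorial : IsEntropyFn fun m => Real.logb 2 (m.factorial : ℝ) where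
  zero := by simp
  one := by simp
  two := by norm_num
  nonneg m := logb_two_natCast_nonneg _
  step_mono := by
    intro c m hcm
    simp only [logb_factorial_succ, add_sub_cancel_left]
    exact Real.logb_le_logb_of_le (by norm_num) (by positivity) (by exact_mod_cast (by omega))
  le_sq m := by
    rcases Nat.eq_zero_or_pos m with rfl | hm
    · simp
    · have h1 : (m.factorial : ℝ) ≤ (m : ℝ) ^ m := by exact_mod_cast Nat.factorial_le_pow m
      have h2 := Real.logb_le_logb_of_le (b := 2) (by norm_num)
        (by exact_mod_cast Nat.factorial_pos m) h1
      rw [Real.logb_pow] at h2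
      rw [sq]
      exact h2.trans (mul_le_mul_of_nonneg_left (logb_two_natCast_le m) (Nat.cast_nonneg m))

theorem length_mul_entropy0 {w : List ℕ} (hw : w ≠ []) : (w.length : ℝ) * entropy0 w =
    (w.length : ℝ) * Real.logb 2 w.length -
      ∑ c ∈ w.toFinset, (w.count c : ℝ) * Real.logb 2 (w.count c) := by
  have hl : (w.length : ℝ) ≠ 0 := by exact_mod_cast (List.length_pos_iff.2 hw).ne'
  have h1 : ∑ c ∈ w.toFinset, (w.count c : ℝ) = w.length := by
    exact_mod_cast List.sum_toFinset_count_eq_length w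
  -- The counts add up to the length, so `|w| log |w|` can be distributed over the symbols.
  rw [entropy0, ← mul_assoc, mul_one_div_cancel hl, one_mul, ← h1, sum_mul, ← sum_sub_distrib, h1]
  refine sum_congr rfl fun c hc => ?_
  have hc' : (w.count c : ℝ) ≠ 0 := by
    exact_mod_cast (List.count_pos_iff.2 (List.mem_toFinset.1 hc)).ne'
  rw [Real.logb_div hl hc']
  ring

theorem length_mul_adaptiveEntropy0 {w : List ℕ} (hw : w ≠ []) :
    (w.length : ℝ) * adaptiveEntropy0 w = Real.logb 2 (w.length.factorial : ℝ) -
      ∑ c ∈ w.toFinset, Real.logb 2 ((w.count c).factorial : ℝ) := by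
  have hl : (w.length : ℝ) ≠ 0 := by exact_mod_cast (List.length_pos_iff.2 hw).ne'
  rw [adaptiveEntropy0, ← mul_assoc, mul_one_div_cancel hl, one_mul]

namespace RealRAM

/-! ### Segments and counts -/

theorem segment_succ {T : List ℕ} {i j : ℕ} (hij : i ≤ j) (hj : j < T.length) :
    segment T i (j + 1) = segment T i j ++ [T.getD j 0] := by
  have h : j - i < (T.drop i).length := by rw [List.length_drop]; omega
  rw [segment, segment, Nat.succ_sub hij, List.take_succ_eq_append_getElem h, List.getElem_drop,
    List.getD_eq_getElem _ _ hj]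
  congr 3
  omega

theorem segment_self (T : List ℕ) (i : ℕ) : segment T i i = [] := by
  simp [segment]

theorem count_segment {T : List ℕ} {i j : ℕ} (hij : i ≤ j) (hj : j ≤ T.length) (c : ℕ) :
    (segment T i j).count c = cnt (fun p => T.getD p 0) i j c := by
  induction j, hij using Nat.le_induction with
  | base => simp [segment_self, cnt_self]
  | succ j hij ih =>
    rw [segment_succ hij hj, List.count_append, ih (by omega), cnt_succ_right _ hij,
      List.count_singleton]
    simp

theorem toFinset_segment {T : List ℕ} {i j : ℕ} (hij : i ≤ j) (hj : j ≤ T.length) :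
    (segment T i j).toFinset = (Ico i j).image fun p => T.getD p 0 := by
  induction j, hij using Nat.le_induction with
  | base => simp [segment_self]
  | succ j hij ih =>
    rw [segment_succ hij hj, List.toFinset_append, ih (by omega), ← insert_Ico_right_eq_Ico_add_one hij,
      image_insert, union_comm]
    rfl

/-- Sums over the symbols do not depend on their names. -/
theorem sum_image_cnt {β : Type*} [AddCommMonoid β] {A : ℕ → ℕ} {x : ℕ → ℕ} {i j n : ℕ}
    (hA : ∀ p ∈ Ico i j, A p < n)
    (hAx : ∀ p ∈ Ico i j, ∀ q ∈ Ico i j, A p = A q ↔ x p = x q) {h : ℕ → β} (h0 : h 0 = 0) :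
    ∑ c ∈ (Ico i j).image x, h (cnt x i j c) = ∑ c ∈ range n, h (cnt A i j c) := by
  classical
  have h1 : ∑ c ∈ range n, h (cnt A i j c) = ∑ c ∈ (Ico i j).image A, h (cnt A i j c) := by
    symm
    refine sum_subset (fun c hc => ?_) fun c _ hc => ?_
    · obtain ⟨p, hp, rfl⟩ := mem_image.1 hc
      exact mem_range.2 (hA p hp)
    · have : cnt A i j c = 0 := sum_eq_zero fun p hp =>
        if_neg fun he => hc (mem_image.2 ⟨p, hp, he⟩)
      rw [this, h0]
  rw [h1]
  -- A symbol and its new name correspond if they occur at a common position; which position is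
  -- chosen is immaterial, since both labellings induce the same equality of positions.
  refine sum_bij' (fun c hc => A (mem_image.1 hc).choose) (fun c hc => x (mem_image.1 hc).choose)
    (fun c hc => ?_) (fun c hc => ?_) (fun c hc => ?_) (fun c hc => ?_) fun c hc => ?_
  · exact mem_image_of_mem _ (mem_image.1 hc).choose_spec.1
  · exact mem_image_of_mem _ (mem_image.1 hc).choose_spec.1
  · have hs := (mem_image.1 hc).choose_spec
    have hm : A (mem_image.1 hc).choose ∈ (Ico i j).image A := mem_image_of_mem _ hs.1
    have hs' := (mem_image.1 hm).choose_spec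
    rw [((hAx _ hs'.1 _ hs.1).1 hs'.2), hs.2]
  · have hs := (mem_image.1 hc).choose_spec
    have hm : x (mem_image.1 hc).choose ∈ (Ico i j).image x := mem_image_of_mem _ hs.1
    have hs' := (mem_image.1 hm).choose_spec
    rw [((hAx _ hs'.1 _ hs.1).2 hs'.2), hs.2]
  · have hs := (mem_image.1 hc).choose_spec
    congr 1
    refine sum_congr rfl fun p hp => ?_
    simp only [hAx p hp _ hs.1, hs.2]

/-! ### Soundness of the costs -/

section Costs

variable {A : ℕ → ℕ} {n : ℕ}

theorem distinct_cnt_le (hA : ∀ p < n, A p < n) {i j : ℕ} (hij : i ≤ j) (hj : j ≤ n) :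
    distinct n (cnt A i j) ≤ j - i := by
  induction j, hij using Nat.le_induction with
  | base => simp [distinct, cnt_self]
  | succ j hij ih =>
    rw [distinct_add (hA j hj) (cnt_succ_right A hij)]
    have := ih (by omega)
    split <;> omega

theorem one_le_distinct_cnt (hA : ∀ p < n, A p < n) {i j : ℕ} (hij : i < j) (hj : j ≤ n) :
    1 ≤ distinct n (cnt A i j) := by
  rw [distinct_add (hA i (by omega)) (cnt_succ_left A hij)]
  split
  · omega
  · rename_i h
    have hs := single_le_sum (f := fun c => if cnt A (i + 1) j c = 0 then 0 else 1)
      (fun c _ => Nat.zero_le _) (mem_range.2 (hA i (by omega)))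
    simp only [h, if_false] at hs
    exact hs

/-- The entropy part of the cost of a window. -/
noncomputable def info (g : ℕ → ℝ) (n : ℕ) (A : ℕ → ℕ) (i j : ℕ) : ℝ :=
  g (j - i) - countSum g n (cnt A i j)

variable {g : ℕ → ℝ}

theorem info_self (hg : IsEntropyFn g) (i : ℕ) : info g n A i i = 0 := by
  simp [info, countSum, cnt_self, hg.zero]

theorem info_succ_right (hA : ∀ p < n, A p < n) {i j : ℕ} (hij : i ≤ j) (hj : j < n) :
    info g n A i (j + 1) = info g n A i j + ((g (j - i + 1) - g (j - i)) -
      (g (cnt A i j (A j) + 1) - g (cnt A i j (A j)))) := by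
  rw [info, info, countSum_add (hA j hj) (cnt_succ_right A hij), Nat.succ_sub hij]
  simp only [Nat.succ_eq_add_one]
  ring

/-- The increment of `g` at the length dominates the one at the count of the new symbol, because a
count is at most the length. -/
theorem info_le_succ_right (hg : IsEntropyFn g) (hA : ∀ p < n, A p < n) {i j : ℕ} (hij : i ≤ j)
    (hj : j < n) : info g n A i j ≤ info g n A i (j + 1) := by
  rw [info_succ_right hA hij hj]
  linarith [hg.step_mono (cnt_le A i j (A j))]

theorem info_succ_le_left (hg : IsEntropyFn g) (hA : ∀ p < n, A p < n) {i j : ℕ} (hij : i < j)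
    (hj : j ≤ n) : info g n A (i + 1) j ≤ info g n A i j := by
  rw [info, info, countSum_add (hA i (by omega)) (cnt_succ_left A hij)]
  have h1 := hg.step_mono (cnt_le A (i + 1) j (A i))
  have h2 : j - i = j - (i + 1) + 1 := by omega
  rw [h2]
  linarith

theorem info_mono (hg : IsEntropyFn g) (hA : ∀ p < n, A p < n) {i i' j j' : ℕ} (hi : i ≤ i')
    (hij : i' ≤ j') (hj : j' ≤ j) (hjn : j ≤ n) : info g n A i' j' ≤ info g n A i j := by
  have h1 : info g n A i' j' ≤ info g n A i' j := by
    induction j, hj using Nat.le_induction with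
    | base => exact le_rfl
    | succ j hj ih =>
      exact (ih (by omega)).trans (info_le_succ_right hg hA (by omega) hjn)
  refine h1.trans ?_
  induction i', hi using Nat.le_induction with
  | base => exact le_rfl
  | succ i' hi ih =>
    refine (info_succ_le_left hg hA (by omega) hjn).trans (ih (by omega) ?_)
    clear ih h1
    induction j, hj using Nat.le_induction with
    | base => exact le_rfl
    | succ j hj ih =>
      exact (ih (by omega)).trans (info_le_succ_right hg hA (by omega) hjn)

theorem info_nonneg (hg : IsEntropyFn g) (hA : ∀ p < n, A p < n) {i j : ℕ} (hij : i ≤ j)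
    (hj : j ≤ n) : 0 ≤ info g n A i j :=
  (info_self hg i).symm.trans_le (info_mono hg hA le_rfl le_rfl hij hj)

theorem distinct_mono {h h' : ℕ → ℕ} (hh : ∀ c, h c ≤ h' c) : distinct n h ≤ distinct n h' := by
  refine sum_le_sum fun c _ => ?_
  have := hh c
  split <;> split <;> omega

theorem cnt_mono {i i' j j' : ℕ} (hi : i ≤ i') (hj : j' ≤ j) (c : ℕ) :
    cnt A i' j' c ≤ cnt A i j c :=
  sum_le_sum_of_subset (Ico_subset_Ico hi hj)

/-- A window either contains only one symbol, or at least one bit of information. -/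
theorem info_dichotomy (hg : IsEntropyFn g) (hA : ∀ p < n, A p < n) {i j : ℕ} (hij : i < j)
    (hj : j ≤ n) :
    1 ≤ info g n A i j ∨ info g n A i j = 0 ∧ distinct n (cnt A i j) = 1 := by
  -- Two different neighbours already form a window with information `g 2 ≥ 1`; without such a pair
  -- the window is constant.
  by_cases hc : ∃ p, i ≤ p ∧ p + 1 < j ∧ A p ≠ A (p + 1)
  · obtain ⟨p, hp, hpj, hne⟩ := hc
    left
    refine le_trans ?_ (info_mono hg hA hp (by omega : p ≤ p + 2) (by omega) hj)
    have c1 : cnt A p (p + 1) (A (p + 1)) = 0 := by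
      rw [cnt_succ_right A le_rfl, cnt_self, if_neg hne]
    rw [info_succ_right hA (by omega) (by omega), info_succ_right hA le_rfl (by omega), info_self hg,
      c1, cnt_self, Nat.sub_self, Nat.add_sub_cancel_left]
    norm_num [hg.zero, hg.one]
    exact hg.two
  · right
    push Not at hc
    have hconst : ∀ p, i ≤ p → p < j → A p = A i := by
      intro p hp
      induction p, hp using Nat.le_induction with
      | base => exact fun _ => rfl
      | succ p hp ih => exact fun h => (hc p hp h).symm.trans (ih (by omega))
    clear hc
    have h1 : ∀ k, i + k < j → info g n A i (i + k + 1) = 0 ∧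
        distinct n (cnt A i (i + k + 1)) = 1 := by
      intro k
      induction k with
      | zero =>
        intro hk
        rw [add_zero, info_succ_right hA le_rfl (by omega), info_self hg,
          distinct_add (hA i (by omega)) (cnt_succ_right A le_rfl), cnt_self, if_pos rfl]
        simp [distinct, cnt_self]
      | succ k ih =>
        intro hk
        have hk' := ih (by omega)
        have hcn : cnt A i (i + k + 1) (A (i + k + 1)) = i + k + 1 - i := by
          rw [cnt, sum_congr rfl (g := fun _ => 1) fun p hp => by
            have := mem_Ico.1 hp
            rw [if_pos]
            rw [hconst p this.1 (by omega), hconst (i + k + 1) (by omega) (by omega)]]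
          simp
        have hne : cnt A i (i + k + 1) (A (i + k + 1)) ≠ 0 := by omega
        rw [← add_assoc, info_succ_right hA (by omega) (by omega), hk'.1,
          distinct_add (hA (i + k + 1) (by omega)) (cnt_succ_right A (by omega)), hk'.2,
          if_neg hne, hcn]
        simp
    have := h1 (j - i - 1) (by omega)
    rwa [show i + (j - i - 1) + 1 = j by omega] at this

end Costs

open Setup

theorem cost_eq_info (S : Setup) (i j : ℕ) : S.cost i j =
    S.N * (S.lam * info S.g S.n S.A i j + S.M.f (j - i) (distinct S.n (cnt S.A i j))) :=
  rfl

/-- Monotonicity combines `info_mono` with the monotonicity of `f`. For the gap, a window with at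
least one bit costs at least `S.N * S.lam ≥ 1`, while a window with one symbol costs `S.N * f m 1`,
which `hN'` keeps out of the interval between zero and one. -/
theorem sound_of_isEntropyFn {S : Setup} (hA : ∀ p < S.n, S.A p < S.n) (hg : IsEntropyFn S.g)
    (hf : IsOverhead S.M.f) (hlam : 0 < S.lam) (hN : 1 ≤ S.N * S.lam)
    (hN' : ∀ m, 1 ≤ m → S.M.f m 1 ≤ 0 ∨ 1 ≤ S.N * S.M.f m 1) : S.Sound where
  mono := by
    intro i i' j j' hi hij hj hjn
    rw [cost_eq_info, cost_eq_info]
    refine mul_le_mul_of_nonneg_left (add_le_add (mul_le_mul_of_nonneg_left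
      (info_mono hg hA hi hij.le hj hjn) hlam.le) ?_) (Nat.cast_nonneg _)
    exact hf.mono _ _ _ _ (one_le_distinct_cnt hA hij (by omega))
      (distinct_cnt_le hA hij.le (by omega)) (distinct_cnt_le hA (by omega) hjn) (by omega)
      (distinct_mono (cnt_mono hi hj))
  single := by
    intro i hi
    rw [cost_eq_info, info_succ_right hA le_rfl hi, info_self hg,
      distinct_add (hA i hi) (cnt_succ_right S.A le_rfl), cnt_self, if_pos rfl]
    simp [distinct, cnt_self]
  gap := by
    intro i j hij hj
    rw [cost_eq_info]
    rcases info_dichotomy hg hA hij hj with h | ⟨h, h'⟩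
    · right
      have h1 := hf.nonneg _ _ (one_le_distinct_cnt hA hij hj) (distinct_cnt_le hA hij.le hj)
      have h2 : (0 : ℝ) ≤ S.N := Nat.cast_nonneg _
      have h3 := mul_nonneg h2 h1
      have h4 : 0 ≤ S.N * S.lam := by positivity
      nlinarith
    · rw [h, h', mul_zero, zero_add]
      rcases hN' (j - i) (by omega) with h1 | h1
      · exact .inl (mul_nonpos_of_nonneg_of_nonpos (Nat.cast_nonneg _) h1)
      · exact .inr h1
  nonneg := by
    intro i j hij hj
    rw [cost_eq_info]
    exact mul_nonneg (Nat.cast_nonneg _) (add_nonneg (mul_nonneg hlam.le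
      (info_nonneg hg hA hij.le hj)) (hf.nonneg _ _ (one_le_distinct_cnt hA hij hj)
      (distinct_cnt_le hA hij.le hj)))

/-- The costs are polynomially bounded. -/
theorem cost_le_pow {S : Setup} (hA : ∀ p < S.n, S.A p < S.n) (hg : IsEntropyFn S.g) {c L : ℕ} (hL : S.lam ≤ L)
    (hc : ∀ m s, 1 ≤ s → s ≤ m → S.M.f m s ≤ (c : ℝ) * (m : ℝ) ^ c) {i j : ℕ} (hij : i < j)
    (hj : j ≤ S.n) : S.cost i j ≤ ((S.N * (L + c) : ℕ) : ℝ) * (S.n : ℝ) ^ (c + 2) := by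
  have hn : (1 : ℝ) ≤ S.n := by exact_mod_cast (by omega : 1 ≤ S.n)
  have hm1 : ((j - i : ℕ) : ℝ) ≤ S.n := by exact_mod_cast (by omega : j - i ≤ S.n)
  have hcs : 0 ≤ countSum S.g S.n (cnt S.A i j) := sum_nonneg fun _ _ => hg.nonneg _
  have h1 : info S.g S.n S.A i j ≤ (S.n : ℝ) ^ (c + 2) := by
    have h2 : ((j - i : ℕ) : ℝ) ^ 2 ≤ (S.n : ℝ) ^ 2 := by gcongr
    have h3 : (S.n : ℝ) ^ 2 ≤ (S.n : ℝ) ^ (c + 2) := pow_le_pow_right₀ hn (by omega)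
    rw [info]
    linarith [hg.le_sq (j - i)]
  have h2 : S.M.f (j - i) (distinct S.n (cnt S.A i j)) ≤ c * (S.n : ℝ) ^ (c + 2) := by
    refine (hc _ _ (one_le_distinct_cnt hA hij hj) (distinct_cnt_le hA hij.le hj)).trans ?_
    refine mul_le_mul_of_nonneg_left ?_ (Nat.cast_nonneg c)
    exact (pow_le_pow_left₀ (Nat.cast_nonneg _) hm1 c).trans (pow_le_pow_right₀ hn (by omega))
  have h3 := info_nonneg hg hA hij.le hj
  rw [cost_eq_info]
  push_cast
  rw [mul_assoc, add_mul]
  refine mul_le_mul_of_nonneg_left (add_le_add ?_ h2) (Nat.cast_nonneg _)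
  exact mul_le_mul hL h1 h3 (Nat.cast_nonneg _)

/-- The cost of a window is the scaled estimated size of the segment of the text. -/
theorem cost_eq_estimatedSize {S : Setup} {T : List ℕ} {H : List ℕ → ℝ} (hT : T.length = S.n)
    (hA : ∀ p < S.n, S.A p < S.n)
    (hAT : ∀ p < S.n, ∀ q < S.n, S.A p = S.A q ↔ T.getD p 0 = T.getD q 0)
    (hg : IsEntropyFn S.g)
    (hH : ∀ w : List ℕ, w ≠ [] → (w.length : ℝ) * H w =
      S.g w.length - ∑ c ∈ w.toFinset, S.g (w.count c))
    {i j : ℕ} (hij : i < j) (hj : j ≤ S.n) :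
    S.cost i j = S.N * estimatedSize H S.lam S.M.f (segment T i j) := by
  have hlen := length_segment (T := T) (i := i) (j := j) (by omega)
  have hne : segment T i j ≠ [] := by
    rw [← List.length_pos_iff]
    omega
  have hA' : ∀ p ∈ Ico i j, S.A p < S.n := fun p hp => hA p (by have := mem_Ico.1 hp; omega)
  have hAx : ∀ p ∈ Ico i j, ∀ q ∈ Ico i j, S.A p = S.A q ↔ T.getD p 0 = T.getD q 0 :=
    fun p hp q hq => hAT p (by have := mem_Ico.1 hp; omega) q (by have := mem_Ico.1 hq; omega)
  have h1 := sum_image_cnt hA' hAx (h := S.g) hg.zero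
  have h2 := sum_image_cnt hA' hAx (h := fun k => if k = 0 then 0 else 1) (if_pos rfl)
  have h3 : (segment T i j).toFinset.card = distinct S.n (cnt S.A i j) := by
    rw [distinct, ← h2, ← toFinset_segment hij.le (by omega), card_eq_sum_ones]
    refine sum_congr rfl fun c hc => ?_
    rw [← count_segment hij.le (by omega), if_neg]
    exact (List.count_pos_iff.2 (List.mem_toFinset.1 hc)).ne'
  rw [Setup.cost, estimatedSize, hH _ hne, hlen, h3, countSum, ← h1,
    ← toFinset_segment hij.le (by omega)]
  simp only [count_segment hij.le (by omega : j ≤ T.length)]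

/-! ### The complete algorithm and its running time -/

/-- The `k`-th power of the length of the text. -/
def powExpr : ℕ → RExpr
  | 0 => .ofNat (.const 1)
  | k + 1 => .mul (powExpr k) (.ofNat (.var 0))

theorem powExpr_eval (M : Machine) (s : State) (k : ℕ) :
    (powExpr k).eval M s = (s.ivar 0 : ℝ) ^ k := by
  induction k with
  | zero => simp [powExpr]
  | succ k ih => simp [powExpr, ih, pow_succ]

theorem powExpr_ok {M : Machine} {s : State} (h1 : 1 < M.word) (h : s.ivar 0 < M.word) (k : ℕ) :
    (powExpr k).Ok M s := by
  induction k with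
  | zero => simpa [powExpr] using h1
  | succ k ih => simpa [powExpr, ih] using h

/-- The complete algorithm: `d` is the number of digits of the symbols, `N` the factor by which
the costs are scaled, `e` computes the function that defines the entropy, and `a * n ^ k` bounds
the scaled costs. -/
def partitionProg (d N a k : ℕ) (e : RExpr) : Prog :=
  renameProg d ;; tableProg e ;; scaleProg (.mul (.ofNat (.const a)) (powExpr k)) ;;
    solveProg N ;; outputProg

/-- Time is expressed through the number `m` of powers of `1 + eps` that were counted; the bounds on
these powers let `thresholds_le` turn `m` into a logarithm. -/
theorem run_partitionProg {M : Machine} {T : List ℕ} {eps lam : ℝ} {H : List ℕ → ℝ} {g : ℕ → ℝ}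
    {d N c L : ℕ} {e : RExpr} (hM : Roomy M T.length) (hNw : N < M.word)
    (haw : N * (L + c) < M.word)
    (hTd : ∀ x ∈ T, x < (T.length + 1) ^ d) (hTw : ∀ x ∈ T, x < M.word)
    (heps : 0 < eps) (hlam : 0 < lam) (hf : IsOverhead M.f) (hg : IsEntropyFn g)
    (hH : ∀ w : List ℕ, w ≠ [] → (w.length : ℝ) * H w =
      g w.length - ∑ c ∈ w.toFinset, g (w.count c))
    (hecost : e.cost ≤ 10)
    (he : ∀ s' x, s'.ivar 5 = x + 1 → x + 1 ≤ T.length → s'.rarr 0 x = g x →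
      e.Ok M s' ∧ e.eval M s' = g (x + 1))
    (hN : 1 ≤ N * lam) (hN' : ∀ m, 1 ≤ m → M.f m 1 ≤ 0 ∨ 1 ≤ N * M.f m 1)
    (hL : lam ≤ L) (hc : ∀ m s, 1 ≤ s → s ≤ m → M.f m s ≤ (c : ℝ) * (m : ℝ) ^ c) :
    Run M (partitionProg d N (N * (L + c)) (c + 2) e) (initial T eps lam) fun s t =>
      ∃ parts, output s = parts.map List.length ∧
        IsApproxOptimal (estimatedSize H lam M.f) eps T parts ∧
        ∃ m : ℕ, (m = 0 ∨ m + 1 ≤ T.length) ∧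
          (∀ k < m, (1 + eps) ^ k < ((N * (L + c) : ℕ) : ℝ) * (T.length : ℝ) ^ (c + 2)) ∧
          t ≤ (400 * d + (powExpr (c + 2)).cost + 14000) * (T.length * (m + 2)) := by
  set n := T.length with hn
  have hpos := hM.pos
  have hw := hM.word
  have hget : ∀ p < n, T.getD p 0 ∈ T := fun p hp => by
    rw [List.getD_eq_getElem _ _ hp]
    exact List.getElem_mem hp
  refine Run.seq (run_renameProg hM (by simp [initial, hn]) (by simp [initial])
    (fun p hp => by simpa [initial] using hTw _ (hget p hp)) (by simp [initial]) d) ?_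
  rintro s₁ t₁ hF₁ ⟨hA, hAeq, -, -, ht₁⟩
  have z0 : s₁.ivar 0 = n := by rw [hF₁.ivar (keepsI_renameProg rfl d)]; simp [initial, hn]
  have z1 : s₁.ivar 1 = 0 := by rw [hF₁.ivar (keepsI_renameProg rfl d)]; simp [initial]
  have z4 : s₁.ivar 4 = 0 := by rw [hF₁.ivar (keepsI_renameProg rfl d)]; simp [initial]
  have y0 : s₁.rvar 0 = eps := by rw [hF₁.rvar (keepsR_renameProg rfl d)]; simp [initial]
  have y1 : s₁.rvar 1 = lam := by rw [hF₁.rvar (keepsR_renameProg rfl d)]; simp [initial]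
  have y2 : s₁.rvar 2 = 0 := by rw [hF₁.rvar (keepsR_renameProg rfl d)]; simp [initial]
  have x7 : s₁.iarr 7 = fun _ => 0 := by
    rw [hF₁.iarr (keepsIArr_renameProg rfl d)]; simp [initial]
  have x9 : s₁.iarr 9 = fun _ => 0 := by
    rw [hF₁.iarr (keepsIArr_renameProg rfl d)]; simp [initial]
  have w0 : s₁.rarr 0 = fun _ => 0 := by
    rw [hF₁.rarr (keepsRArr_renameProg rfl d)]; simp [initial]
  have w2 : s₁.rarr 2 = fun _ => 0 := by
    rw [hF₁.rarr (keepsRArr_renameProg rfl d)]; simp [initial]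
  have hAT : ∀ p < n, ∀ q < n, s₁.iarr 2 p = s₁.iarr 2 q ↔ T.getD p 0 = T.getD q 0 := by
    intro p hp q hq
    rw [hAeq p hp q hq]
    simp only [initial, if_pos]
    rw [Nat.mod_eq_of_lt (hTd _ (hget p hp)), Nat.mod_eq_of_lt (hTd _ (hget q hq))]
  refine Run.seq (run_tableProg hM z0 hg.zero (by rw [w0]) hecost he) ?_
  rintro s₂ t₂ hF₂ ⟨hG, ht₂⟩
  have hok : (RExpr.mul (.ofNat (.const (N * (L + c)))) (powExpr (c + 2))).Ok M s₂ :=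
    ⟨haw, powExpr_ok (by omega) (by rw [hF₂.ivar rfl, z0]; omega) _⟩
  have hev : (RExpr.mul (.ofNat (.const (N * (L + c)))) (powExpr (c + 2))).eval M s₂ =
      ((N * (L + c) : ℕ) : ℝ) * (n : ℝ) ^ (c + 2) := by
    rw [RExpr.eval, powExpr_eval, hF₂.ivar rfl, z0]
    rfl
  refine Run.seq (run_scaleProg hM ((hF₂.ivar rfl).trans z0) ((hF₂.rvar rfl).trans y0) hok hev) ?_
  rintro s₃ t₃ hF₃ ⟨m, h12, hm, hmX, hmlt, ht₃⟩
  let S : Setup := ⟨M, n, N, lam, eps, s₁.iarr 2, g⟩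
  have hS : S.Fits := ⟨hpos, hA, hw, hNw, hM.space⟩
  have hV : S.Sound := sound_of_isEntropyFn hA hg hf hlam hN hN'
  have hB : S.Base s₃ := by
    refine ⟨?_, ?_, ?_, fun p _ => ?_, fun x hx => ?_⟩
    · rw [hF₃.ivar rfl, hF₂.ivar rfl, z0]
    · rw [hF₃.rvar rfl, hF₂.rvar rfl, y0]
    · rw [hF₃.rvar rfl, hF₂.rvar rfl, y1]
    · rw [hF₃.iarr rfl, hF₂.iarr rfl]
    · rw [hF₃.rarr rfl]
      exact hG x hx
  have hC : S.Counts (cnt S.A 0 0) s₃ := by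
    refine ⟨fun c _ => ?_, ?_, ?_⟩
    · rw [hF₃.iarr rfl, hF₂.iarr rfl, x7, cnt_self]
    · rw [hF₃.rvar rfl, hF₂.rvar rfl, y2]
      simp [countSum, cnt_self, S, hg.zero]
    · rw [hF₃.ivar rfl, hF₂.ivar rfl, z4]
      simp [distinct, cnt_self]
  refine Run.seq (run_solveProg (X := ((N * (L + c) : ℕ) : ℝ) * (n : ℝ) ^ (c + 2)) hS hV heps hB hC
    (fun p => by rw [hF₃.iarr rfl, hF₂.iarr rfl, x9])
    (by rw [hF₃.rarr rfl, hF₂.rarr rfl, w2]) h12 hm hmX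
    fun i j hij hj => cost_le_pow (S := S) hA hg hL hc hij hj) ?_
  rintro s₄ t₄ hF₄ ⟨hs, ht₄⟩
  have hcost : ∀ i j, i < j → j ≤ S.n →
      S.cost i j = S.N * estimatedSize H lam M.f (segment T i j) := fun i j hij hj =>
    cost_eq_estimatedSize (S := S) rfl hA hAT hg hH hij hj
  refine (run_outputProg hS (T := T) rfl hcost hs (by rw [hF₄.ivar rfl]; exact hB.len)
    (by rw [hF₄.ivar rfl, hF₃.ivar rfl, hF₂.ivar rfl, z1])).conseq ?_
  rintro s₅ t₅ - ⟨parts, hp, hpc, hout, ht₅⟩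
  refine ⟨parts, hout, ⟨hp, fun parts' hp' => ?_⟩, m, hm, hmlt, ?_⟩
  · have h1 := hs.le_cost hV heps (T := T) rfl hcost parts' 0 (Nat.zero_le _) (by simpa using hp'.1)
      hp'.2 0 le_rfl (Nat.zero_le _)
    rw [← hpc] at h1
    -- The common factor `N` is divided out of the approximation guarantee.
    have hNpos : (0 : ℝ) < N := by
      by_contra hle
      have : (N : ℝ) * lam ≤ 0 := mul_nonpos_of_nonpos_of_nonneg (not_lt.1 hle) hlam.le
      linarith
    have h2 : (N : ℝ) * partitionCost (estimatedSize H lam M.f) parts ≤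
        N * ((1 + eps) * partitionCost (estimatedSize H lam M.f) parts') := by
      refine h1.trans_eq ?_
      ring
    exact le_of_mul_le_mul_left h2 hNpos
  · have h1 : n ≤ n * (m + 2) := Nat.le_mul_of_pos_right _ (by omega)
    have h2 : m + 2 ≤ n * (m + 2) := Nat.le_mul_of_pos_left _ hpos
    have h3 : n * d ≤ n * (m + 2) * d := Nat.mul_le_mul_right _ h1
    have h4 : (powExpr (c + 2)).cost ≤ (powExpr (c + 2)).cost * (n * (m + 2)) :=
      Nat.le_mul_of_pos_right _ (by omega)
    have h5 : (400 * d + (powExpr (c + 2)).cost + 14000) * (n * (m + 2)) =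
      400 * (n * (m + 2) * d) + (powExpr (c + 2)).cost * (n * (m + 2)) +
        14000 * (n * (m + 2)) := by ring
    have h6 : 400 * n * d = 400 * (n * d) := by ring
    have ht₄' : t₄ ≤ 13000 * (n * (m + 2)) + 50 := ht₄
    have ht₅' : t₅ ≤ 30 * n + 10 := ht₅
    simp only [RExpr.cost, IExpr.cost] at ht₃
    rw [h5]
    omega

/-- The number of thresholds is logarithmic. -/
theorem thresholds_le {n m a k : ℕ} {eps : ℝ} (heps : 0 < eps) (hn : 0 < n)
    (hm : m = 0 ∨ m + 1 ≤ n) (h : ∀ l < m, (1 + eps) ^ l < (a : ℝ) * (n : ℝ) ^ k) :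
    ((m + 2 : ℕ) : ℝ) ≤ ((a + k + 3 : ℕ) : ℝ) * (1 + Real.logb (1 + eps) n) := by
  have hlog : 0 ≤ Real.logb (1 + eps) n := Real.logb_nonneg (by linarith) (by exact_mod_cast hn)
  rcases Nat.eq_zero_or_pos m with rfl | hmpos
  · push_cast
    have : 0 ≤ ((a : ℝ) + k + 3) * Real.logb (1 + eps) n := by positivity
    have ha : (0 : ℝ) ≤ a := Nat.cast_nonneg a
    have hk : (0 : ℝ) ≤ k := Nat.cast_nonneg k
    nlinarith
  · have hn2 : (2 : ℝ) ≤ n := by exact_mod_cast (by omega : 2 ≤ n)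
    -- The last power that was still too small; taking logarithms bounds `m - 1`.
    have h1 := h (m - 1) (by omega)
    have hnk : (0 : ℝ) < (n : ℝ) ^ k := by positivity
    have hb : (1 : ℝ) < 1 + eps := by linarith
    have ha : (0 : ℝ) < a := by
      have : 0 < (a : ℝ) * (n : ℝ) ^ k := lt_trans (by positivity) h1
      exact pos_of_mul_pos_left this hnk.le
    have h2 := Real.logb_lt_logb hb (by positivity) h1
    rw [Real.logb_pow, Real.logb_self_eq_one hb, mul_one, Real.logb_mul ha.ne' hnk.ne',
      Real.logb_pow] at h2
    -- The constant `a` must not contribute a term that depends on `eps` alone. Since `n ≥ 2`,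
    -- `log_{1+ε} a` is a constant multiple of `log_{1+ε} 2` and is absorbed into `log_{1+ε} n`.
    have h3 : Real.logb (1 + eps) a ≤ a * Real.logb (1 + eps) n := by
      have e1 : Real.logb (1 + eps) a = Real.logb 2 a * Real.logb (1 + eps) 2 := by
        rw [mul_comm, Real.mul_logb] <;> norm_num
      have e2 : Real.logb (1 + eps) 2 ≤ Real.logb (1 + eps) n :=
        Real.logb_le_logb_of_le hb (by norm_num) hn2
      rw [e1]
      exact mul_le_mul (logb_two_natCast_le a) e2 (Real.logb_nonneg hb (by norm_num))
        (Nat.cast_nonneg a)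
    have h4 : ((m - 1 : ℕ) : ℝ) = m - 1 := by
      rw [Nat.cast_sub hmpos, Nat.cast_one]
    rw [h4] at h2
    push_cast
    have hk : (0 : ℝ) ≤ k := Nat.cast_nonneg k
    nlinarith

/-- As `f m 1` is nondecreasing in `m`, its first positive value bounds all positive ones from
below. One constant therefore serves every length, and it depends only on `f` and `lam`. -/
theorem exists_scale {f : ℕ → ℕ → ℝ} (hf : IsOverhead f) {lam : ℝ} (hlam : 0 < lam) :
    ∃ N : ℕ, 1 ≤ N * lam ∧ ∀ m, 1 ≤ m → f m 1 ≤ 0 ∨ 1 ≤ N * f m 1 := by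
  classical
  obtain ⟨N₁, h₁⟩ := exists_nat_ge (1 / lam)
  rw [div_le_iff₀ hlam] at h₁
  by_cases hpos : ∃ m, 1 ≤ m ∧ 0 < f m 1
  · have hm := Nat.find_spec hpos
    obtain ⟨N₂, h₂⟩ := exists_nat_ge (1 / f (Nat.find hpos) 1)
    rw [div_le_iff₀ hm.2] at h₂
    refine ⟨N₁ + N₂, ?_, fun m hm' => ?_⟩
    · push_cast
      nlinarith [mul_nonneg (Nat.cast_nonneg (α := ℝ) N₂) hlam.le]
    · by_cases h : f m 1 ≤ 0
      · exact .inl h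
      · right
        have hle := Nat.find_min' hpos ⟨hm', not_le.1 h⟩
        have hmono := hf.mono _ _ m 1 le_rfl hm.1 hm' hle le_rfl
        have h3 : (0 : ℝ) ≤ N₁ := Nat.cast_nonneg _
        have h4 : (0 : ℝ) ≤ N₂ := Nat.cast_nonneg _
        push_cast
        have h5 := mul_le_mul_of_nonneg_left hmono h4
        have h6 := mul_nonneg h3 (not_le.1 h).le
        linarith
  · push Not at hpos
    exact ⟨N₁, h₁, fun m hm => .inl (hpos m hm)⟩

/-- Both entropies come from a function that the machine can tabulate. -/
theorem exists_entropyFn {H : List ℕ → ℝ} (hH : H = entropy0 ∨ H = adaptiveEntropy0) :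
    ∃ (g : ℕ → ℝ) (e : RExpr), IsEntropyFn g ∧ e.cost ≤ 10 ∧
      (∀ w : List ℕ, w ≠ [] → (w.length : ℝ) * H w =
        g w.length - ∑ c ∈ w.toFinset, g (w.count c)) ∧
      ∀ (M : Machine) (n : ℕ), Roomy M n → ∀ s x, s.ivar 5 = x + 1 → x + 1 ≤ n →
        s.rarr 0 x = g x → e.Ok M s ∧ e.eval M s = g (x + 1) := by
  rcases hH with rfl | rfl
  · refine ⟨_, .mul (.ofNat (.var 5)) (.log (.var 5)), isEntropyFn_mul_logb, by simp,
      fun w hw => length_mul_entropy0 hw, fun M n hM s x h5 hx _ => ?_⟩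
    have := hM.word
    simp [h5]
    omega
  · refine ⟨_, .add (.cell 0 (.sub (.var 5) (.const 1))) (.log (.var 5)),
      isEntropyFn_logb_factorial, by simp,
      fun w hw => length_mul_adaptiveEntropy0 hw, fun M n hM s x h5 hx h0 => ?_⟩
    have := hM.word
    have := hM.space
    have hl := logb_factorial_succ x
    push_cast at hl
    simp [h5, h0, hl]
    omega

end RealRAM

open RealRAM

theorem theorem3 (d : ℕ) (lam : ℝ) (hlam : 0 < lam) (f : ℕ → ℕ → ℝ) (hf : IsOverhead f)
    (H : List ℕ → ℝ) (hH : H = entropy0 ∨ H = adaptiveEntropy0) :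
    ∃ (P : RealRAM.Prog) (K : ℕ), ∀ ε : ℝ, 0 < ε → ∀ T : List ℕ, T ≠ [] →
      (∀ x ∈ T, x < (T.length + 1) ^ d) →
      ∃ (s : RealRAM.State) (t : ℕ) (parts : List (List ℕ)),
        RealRAM.Exec ⟨f, K * T.length, (T.length + 1) ^ K⟩ P (RealRAM.initial T ε lam) s t ∧
        (t : ℝ) ≤ K * (T.length * (1 + Real.logb (1 + ε) T.length)) ∧
        RealRAM.output s = parts.map List.length ∧
        IsApproxOptimal (estimatedSize H lam f) ε T parts := by
  obtain ⟨g, e, hg, hecost, hHg, he⟩ := exists_entropyFn hH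
  obtain ⟨N, hN, hN'⟩ := exists_scale hf hlam
  obtain ⟨c, hc⟩ := hf.poly
  obtain ⟨L, hL⟩ := exists_nat_ge lam
  set a := N * (L + c) with ha
  set C := 400 * d + (powExpr (c + 2)).cost + 14000 with hC
  refine ⟨partitionProg d N a (c + 2) e, C * (a + (c + 2) + 3) + N + a + d + 4,
    fun ε hε T hT hTd => ?_⟩
  -- The product is the constant of the time bound; the other summands make the word bound exceed
  -- the program's constants and the symbols.
  set K := C * (a + (c + 2) + 3) + N + a + d + 4 with hK
  have hpos : 0 < T.length := List.length_pos_iff.2 hT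
  -- A nonempty text has `T.length + 1 ≥ 2`, and `2 ^ K` already exceeds `K`.
  have hpow : ∀ x ≤ K, x < (T.length + 1) ^ K := fun x hx =>
    hx.trans_lt (Nat.lt_two_pow_self.trans_le (Nat.pow_le_pow_left (by omega) K))
  have hM : Roomy ⟨f, K * T.length, (T.length + 1) ^ K⟩ T.length := by
    refine ⟨hpos, ?_, Nat.mul_le_mul_right _ (by omega)⟩
    -- The fourth power of `T.length + 1` is at least eight times its base, which exceeds `4 *
    -- T.length + 4`.
    have h1 : (T.length + 1) ^ 4 ≤ (T.length + 1) ^ K := Nat.pow_le_pow_right (by omega) (by omega)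
    have h2 : 2 ^ 3 ≤ (T.length + 1) ^ 3 := Nat.pow_le_pow_left (by omega) 3
    have h3 : (T.length + 1) ^ 4 = (T.length + 1) ^ 3 * (T.length + 1) := pow_succ _ _
    have h4 := Nat.mul_le_mul_right (T.length + 1) h2
    rw [← h3] at h4
    refine lt_of_lt_of_le ?_ (h4.trans h1)
    omega
  obtain ⟨s, t, hexec, parts, hout, hopt, m, hm, hmlt, ht⟩ :=
    run_partitionProg (eps := ε) (d := d) hM (hpow N (by omega)) (hpow a (by omega)) hTd
      (fun x hx => (hTd x hx).trans_le (Nat.pow_le_pow_right (by omega) (by omega))) hε hlam hf hg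
      hHg hecost (he _ _ hM) hN hN' hL hc
  refine ⟨s, t, parts, hexec, ?_, hout, hopt⟩
  have h1 := thresholds_le hε hpos hm hmlt
  have hlog : 0 ≤ Real.logb (1 + ε) T.length :=
    Real.logb_nonneg (by linarith) (by exact_mod_cast hpos)
  have ht' : (t : ℝ) ≤ C * (T.length * ((m + 2 : ℕ) : ℝ)) := by exact_mod_cast ht
  have hKC : ((C * (a + (c + 2) + 3) : ℕ) : ℝ) ≤ K := by
    exact_mod_cast (by omega : C * (a + (c + 2) + 3) ≤ K)
  calc (t : ℝ) ≤ C * (T.length * ((m + 2 : ℕ) : ℝ)) := ht'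
    _ ≤ C * (T.length * (((a + (c + 2) + 3 : ℕ) : ℝ) * (1 + Real.logb (1 + ε) T.length))) := by
        gcongr
    _ = ((C * (a + (c + 2) + 3) : ℕ) : ℝ) *
        (T.length * (1 + Real.logb (1 + ε) T.length)) := by
        push_cast
        ring
    _ ≤ K * (T.length * (1 + Real.logb (1 + ε) T.length)) := by
        gcongr
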